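/- Let $\gamma>1$, $\theta=\frac{\gamma-1}{2}$, $\lambda=\frac{3-\gamma}{2(\gamma-1)}$, $\kappa=\frac{(\gamma-1)^2}{4\gamma}$, $p(\rho)=\kappa\rho^\gamma$, $e(\rho)=\frac{\kappa}{\gamma-1}\rho^\gamma$, and $e^*(\rho,\bar\rho)=e(\rho)-e(\bar\rho)-e'(\bar\rho)(\rho-\bar\rho)$. Let $\rho^\pm>0$ and $u^\pm$ be real constants, and let $(\bar\rho,\bar u)$ be a pair of smooth monotone functions on $\mathbb R$ with $(\bar\rho(x),\bar u(x))=(\rho^\pm,u^\pm)$ for $\pm x\ge L_0$, for some $L_0>0$. Let $\varepsilon_0>0$ and let $E_0,E_1,M_0$ be constants. For each $\varepsilon\in(0,\varepsilon_0]$ let $(\rho_0^\varepsilon,u_0^\varepsilon)$ be initial data with $\inf_x\rho_0^\varepsilon>0$ and $$\int_{\mathbb R}\Big(\tfrac12\rho_0^\varepsilon|u_0^\varepsilon-\bar u|^2+e^*(\rho_0^\varepsilon,\bar\rho)\Big)dx\le E_0,\qquad \varepsilon^2\int_{\mathbb R}\frac{|\rho_{0,x}^\varepsilon|^2}{(\rho_0^\varepsilon)^3}\,dx\le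 E_1,\qquad \int_{\mathbb R}\rho_0^\varepsilon|u_0^\varepsilon-\bar u|\,dx\le M_0,$$ and let $(\rho^\varepsilon,u^\varepsilon)$ be a smooth solution on $[0,\infty)\times\mathbb R$ of the Navier–Stokes equations $$\rho_t+(\rho u)_x=0,\qquad (\rho u)_t+(\rho u^2+p(\rho))_x=\varepsilon u_{xx}$$ with initial data $(\rho_0^\varepsilon,u_0^\varepsilon)$, such that for every $t\ge0$ there is $c_\varepsilon(t)>0$ with $\rho^\varepsilon(t,x)\ge c_\varepsilon(t)$ for all $x$, and such that $(\rho^\varepsilon(t,x),u^\varepsilon(t,x))\to(\rho^\pm,u^\pm)$ as $x\to\pm\infty$, uniformly for $t$ in bounded intervals. Put $m^\varepsilon=\rho^\varepsilon u^\varepsilon$. Let $\psi:\mathbb R\to\mathbb R$ be a compactly supported $C^2$ function and let $(\eta^\psi,q^\psi)$ be the weak entropy pair that it generates: with $\chi(\rho;v)=[\rho^{2\theta}-v^2]_+^\lambda$ (which is $0$ where $\rho^{2\theta}\le v^2$), $$\eta^\psi(\rho,\rho u)=\int_{\mathbb R}\chi(\rho;s-u)\,\psi(s)\,ds,\qquad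 q^\psi(\rho,\rho u)=\int_{\mathbb R}\big(\theta s+(1-\theta)u\big)\chi(\rho;s-u)\,\psi(s)\,ds .$$ Then the entropy dissipation measures $$\eta^\psi(\rho^\varepsilon,m^\varepsilon)_t+q^\psi(\rho^\varepsilon,m^\varepsilon)_x,\qquad \varepsilon\in(0,\varepsilon_0],$$ are confined in a compact subset of $H^{-1}_{loc}(\mathbb R^2_+)$, $\mathbb R^2_+=[0,\infty)\times\mathbb R$. Here $H^{-1}_{loc}(\mathbb R^2_+)$ is the space of distributions on $(0,\infty)\times\mathbb R$ whose restriction to each rectangle $Q_n=(0,n)\times(-n,n)$, $n\in\mathbb N$, belongs to $H^{-1}(Q_n)$, the dual of $H^1_0(Q_n)$, with the topology of convergence in the norm of $H^{-1}(Q_n)$ for every $n$. -/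

import Mathlib

open Set Filter Topology MeasureTheory
open scoped ContDiff

noncomputable section

/-! ### The polytropic gas and its weak entropy pairs -/

/-- `θ = (γ - 1) / 2`. -/
def gasTheta (γ : ℝ) : ℝ := (γ - 1) / 2

/-- `λ = (3 - γ) / (2 (γ - 1))`. -/
def gasLambda (γ : ℝ) : ℝ := (3 - γ) / (2 * (γ - 1))

/-- `κ = (γ - 1)² / (4 γ)`. -/
def gasKappa (γ : ℝ) : ℝ := (γ - 1) ^ 2 / (4 * γ)

/-- The pressure `p(ρ) = κ ρ^γ`. -/
def pressure (γ r : ℝ) : ℝ := gasKappa γ * r ^ γ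

/-- The internal energy `e(ρ) = κ / (γ - 1) ρ^γ`. -/
def internalEnergy (γ r : ℝ) : ℝ := gasKappa γ / (γ - 1) * r ^ γ

/-- `e*(ρ, ρ̄) = e(ρ) - e(ρ̄) - e'(ρ̄) (ρ - ρ̄)`. -/
def relInternalEnergy (γ r rbar : ℝ) : ℝ :=
  internalEnergy γ r - internalEnergy γ rbar - deriv (internalEnergy γ) rbar * (r - rbar)

/-- `[y]_+^l`: it vanishes for `y ≤ 0`, also when `l ≤ 0`
(for `l = 0` it is the indicator function of `y > 0`). -/
def posPartPow (y l : ℝ) : ℝ := if 0 < y then y ^ l else 0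

/-- The weak entropy kernel `χ(ρ; v) = [ρ^{2θ} - v²]_+^λ`. -/
def entropyKernel (γ r v : ℝ) : ℝ :=
  posPartPow (r ^ (2 * gasTheta γ) - v ^ 2) (gasLambda γ)

/-- The weak entropy `η^ψ(ρ, m) = ∫ χ(ρ; s - u) ψ(s) ds`, `u = m / ρ`. -/
def weakEntropy (γ : ℝ) (ψ : ℝ → ℝ) (r m : ℝ) : ℝ :=
  ∫ s, entropyKernel γ r (s - m / r) * ψ s

/-- The entropy flux `q^ψ(ρ, m) = ∫ (θ s + (1 - θ) u) χ(ρ; s - u) ψ(s) ds`, `u = m / ρ`. -/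
def weakEntropyFlux (γ : ℝ) (ψ : ℝ → ℝ) (r m : ℝ) : ℝ :=
  ∫ s, (gasTheta γ * s + (1 - gasTheta γ) * (m / r)) * entropyKernel γ r (s - m / r) * ψ s

/-! ### The Cauchy problem for the Navier-Stokes equations -/

/-- `(ρ̄, ū)` is a pair of smooth monotone functions that equals the end states
`(ρl, ul)` for `x ≤ -L₀` and `(ρr, ur)` for `x ≥ L₀`, for some `L₀ > 0`. -/
structure IsReferenceProfile (ρl ρr ul ur : ℝ) (ρbar ubar : ℝ → ℝ) : Prop where
  smooth_rho : ContDiff ℝ ∞ ρbar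
  smooth_u : ContDiff ℝ ∞ ubar
  monotone_rho : Monotone ρbar ∨ Antitone ρbar
  monotone_u : Monotone ubar ∨ Antitone ubar
  eq_ends : ∃ L₀ : ℝ, 0 < L₀ ∧
    (∀ x, x ≤ -L₀ → ρbar x = ρl ∧ ubar x = ul) ∧
    (∀ x, L₀ ≤ x → ρbar x = ρr ∧ ubar x = ur)

/-- The bounds on the initial data `(ρ₀, u₀)` at viscosity `ε`: positive lower bound of the
density, relative mechanical energy at most `E₀`, weighted density gradient at most `E₁`,
relative momentum in `L¹` at most `M₀`. -/
structure HasDataBounds (γ ε : ℝ) (ρbar ubar : ℝ → ℝ) (E₀ E₁ M₀ : ℝ)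
    (ρ₀ u₀ : ℝ → ℝ) : Prop where
  lower : ∃ c : ℝ, 0 < c ∧ ∀ x, c ≤ ρ₀ x
  energy_integrable : Integrable fun x =>
    1 / 2 * ρ₀ x * (u₀ x - ubar x) ^ 2 + relInternalEnergy γ (ρ₀ x) (ρbar x)
  energy_le :
    ∫ x, (1 / 2 * ρ₀ x * (u₀ x - ubar x) ^ 2 + relInternalEnergy γ (ρ₀ x) (ρbar x)) ≤ E₀
  gradient_integrable : Integrable fun x => deriv ρ₀ x ^ 2 / ρ₀ x ^ 3
  gradient_le : ε ^ 2 * ∫ x, deriv ρ₀ x ^ 2 / ρ₀ x ^ 3 ≤ E₁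
  momentum_integrable : Integrable fun x => ρ₀ x * |u₀ x - ubar x|
  momentum_le : ∫ x, ρ₀ x * |u₀ x - ubar x| ≤ M₀

/-- `(ρ, u)`, functions of `(t, x)`, is a global smooth solution on `[0, ∞) × ℝ` of
`ρ_t + (ρ u)_x = 0`, `(ρ u)_t + (ρ u² + p(ρ))_x = ε u_xx` with initial data `(ρ₀, u₀)`,
with density bounded away from the vacuum at each time and with end states
`(ρl, ul)` at `x = -∞` and `(ρr, ur)` at `x = +∞`, attained locally uniformly in time. -/
structure IsNavierStokesSolution (γ ε ρl ρr ul ur : ℝ) (ρ₀ u₀ : ℝ → ℝ)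
    (ρ u : ℝ → ℝ → ℝ) : Prop where
  smooth_rho : ContDiffOn ℝ ∞ (fun z : ℝ × ℝ => ρ z.1 z.2) (Ici 0 ×ˢ univ)
  smooth_u : ContDiffOn ℝ ∞ (fun z : ℝ × ℝ => u z.1 z.2) (Ici 0 ×ˢ univ)
  mass : ∀ t x : ℝ, 0 < t →
    deriv (fun s => ρ s x) t + deriv (fun y => ρ t y * u t y) x = 0
  momentum : ∀ t x : ℝ, 0 < t →
    deriv (fun s => ρ s x * u s x) t
      + deriv (fun y => ρ t y * u t y ^ 2 + pressure γ (ρ t y)) x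
      = ε * deriv (deriv fun y => u t y) x
  init_rho : ∀ x, ρ 0 x = ρ₀ x
  init_u : ∀ x, u 0 x = u₀ x
  lower : ∀ t : ℝ, 0 ≤ t → ∃ c : ℝ, 0 < c ∧ ∀ x, c ≤ ρ t x
  rho_right : ∀ T : ℝ, TendstoUniformlyOn (fun x t => ρ t x) (fun _ => ρr) atTop (Icc 0 T)
  rho_left : ∀ T : ℝ, TendstoUniformlyOn (fun x t => ρ t x) (fun _ => ρl) atBot (Icc 0 T)
  u_right : ∀ T : ℝ, TendstoUniformlyOn (fun x t => u t x) (fun _ => ur) atTop (Icc 0 T)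
  u_left : ∀ T : ℝ, TendstoUniformlyOn (fun x t => u t x) (fun _ => ul) atBot (Icc 0 T)

/-! ### The spaces `H¹₀(Q)`, `H⁻¹(Q)` and `H⁻¹_loc` of the half-plane -/

/-- The time derivative of a function of `(t, x)`. -/
def dt (φ : ℝ × ℝ → ℝ) (z : ℝ × ℝ) : ℝ := fderiv ℝ φ z (1, 0)

/-- The space derivative of a function of `(t, x)`. -/
def dx (φ : ℝ × ℝ → ℝ) (z : ℝ × ℝ) : ℝ := fderiv ℝ φ z (0, 1)

/-- `(φ, φ_t, φ_x)`; its `L²(Q)` norm is the `H¹(Q)` norm of `φ`. -/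
def jet (φ : ℝ × ℝ → ℝ) (z : ℝ × ℝ) : EuclideanSpace ℝ (Fin 3) := !₂[φ z, dt φ z, dx φ z]

theorem memLp_jet {Q : TopologicalSpace.Opens (ℝ × ℝ)} (φ : TestFunction Q ℝ ⊤) :
    MemLp (jet φ) 2 (volume.restrict (Q : Set (ℝ × ℝ))) := by
  have hd : Continuous (fderiv ℝ φ) := φ.contDiff.continuous_fderiv (by simp)
  have hc : Continuous (jet φ) := by
    have h0 : Continuous φ := φ.continuous
    have h1 : Continuous (dt φ) := hd.clm_apply continuous_const
    have h2 : Continuous (dx φ) := hd.clm_apply continuous_const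
    refine (PiLp.continuous_toLp 2 (fun _ : Fin 3 => ℝ)).comp (continuous_pi fun i => ?_)
    fin_cases i
    · exact h0
    · exact h1
    · exact h2
  have hs : HasCompactSupport (jet φ) := by
    refine HasCompactSupport.intro φ.hasCompactSupport fun z hz => ?_
    have e0 : φ z = 0 := image_eq_zero_of_notMem_tsupport hz
    have e1 : fderiv ℝ φ z = 0 := by
      by_contra hne
      exact hz (support_fderiv_subset ℝ (f := φ) hne)
    ext i
    fin_cases i <;> simp [jet, dt, dx, e0, e1]
  exact (hc.memLp_of_hasCompactSupport hs).restrict _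

/-- `H¹₀(Q)`: the closure of `C_c^∞(Q)` in the `H¹(Q)` norm, `φ` being identified with
the class of `(φ, φ_t, φ_x)` in `L²(Q)³`. -/
def H1Zero (Q : TopologicalSpace.Opens (ℝ × ℝ)) :
    Submodule ℝ (Lp (EuclideanSpace ℝ (Fin 3)) 2 (volume.restrict (Q : Set (ℝ × ℝ)))) :=
  (Submodule.span ℝ
    (range fun φ : TestFunction Q ℝ ⊤ => (memLp_jet φ).toLp (jet φ))).topologicalClosure

/-- A test function as an element of `H¹₀(Q)`. -/
def toH1Zero {Q : TopologicalSpace.Opens (ℝ × ℝ)} (φ : TestFunction Q ℝ ⊤) : H1Zero Q :=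
  ⟨(memLp_jet φ).toLp (jet φ),
    Submodule.le_topologicalClosure _ (Submodule.subset_span ⟨φ, rfl⟩)⟩

/-- `H⁻¹(Q)`: the dual space of `H¹₀(Q)`, with the dual norm. -/
abbrev HNegOne (Q : TopologicalSpace.Opens (ℝ × ℝ)) : Type := StrongDual ℝ (H1Zero Q)

/-- The rectangles `(0, n) × (-n, n)`, which exhaust the half-plane; every bounded subset of the
half-plane, also if it touches `t = 0`, lies in one of them. -/
def halfPlaneBox (n : ℕ) : TopologicalSpace.Opens (ℝ × ℝ) :=
  ⟨Ioo (0 : ℝ) n ×ˢ Ioo (-(n : ℝ)) n, isOpen_Ioo.prod isOpen_Ioo⟩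

/-- `H⁻¹_loc` of the half-plane `t > 0`, local up to `t = 0`: a distribution on the half-plane
whose restriction to each rectangle is in `H⁻¹` is the same as a family of elements of
`H⁻¹((0, n) × (-n, n))` that agree on common test functions. As a subtype of a product it
carries the topology of convergence in the `H⁻¹` norm on each rectangle. -/
abbrev HNegOneLoc : Type :=
  {T : (n : ℕ) → HNegOne (halfPlaneBox n) //
    ∀ (m n : ℕ) (φ : TestFunction (halfPlaneBox m) ℝ ⊤) (χ : TestFunction (halfPlaneBox n) ℝ ⊤),
      (∀ z, φ z = χ z) → T m (toH1Zero φ) = T n (toH1Zero χ)}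

/-- `T = f_t + g_x` in the sense of distributions on the half-plane `t > 0`. -/
def IsDistribDivergence (T : HNegOneLoc) (f g : ℝ × ℝ → ℝ) : Prop :=
  ∀ (n : ℕ) (φ : TestFunction (halfPlaneBox n) ℝ ⊤),
    T.1 n (toH1Zero φ)
      = -∫ z in (halfPlaneBox n : Set (ℝ × ℝ)), (f z * dt φ z + g z * dx φ z)

end

/-! Compactness is obtained from one quantitative estimate rather than by interpolation between
negative Sobolev spaces. For every rectangle and every δ > 0 there is a constant K, the same for all
viscosities ε, such that the dissipation tested against φ is at most δ + K‖φ‖² (L² norm) whenever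
‖φ‖ ≤ 1 in H¹ (`exists_dissipation_le`). Poincaré's inequality on a fine grid bounds ‖φ‖² in L² by a
small multiple of the squared H¹ norm plus finitely many squared cell integrals
(`exists_cellIntegral_bound`). So the functionals are bounded in H⁻¹ and uniformly small on a
subspace of finite codimension, hence totally bounded (`totallyBounded_range_divergenceDual`).
Tychonoff's theorem assembles the rectangles.

The flow enters through bounds that do not depend on ε. The velocity u + ερ_x/ρ² is transported
without viscosity, so the relative energies built with u and with this velocity together dissipate ε
u_x² and ε ρ^(γ-3) ρ_x² (`ViscousFlow.energy_estimate`). A shrinking cone of dependence localizes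
the estimate, so that integrability at infinity is needed only at t = 0. Multiplying the mass
equation by a primitive of the momentum bounds ρ^(γ+1) locally in L¹
(`exists_integral_rpow_succ_le`).

The entropy is η = ρ ∫ w(τ) ψ(u + ρ^θ τ) dτ with w(τ) = (1 - τ²)_+^λ. Differentiation and one
integration by parts give η_t + q_x = ε u_xx η_m, where η_m is bounded and (η_m)_x² is controlled by
u_x² + ρ^(γ-3) ρ_x² (`exists_entropyFlow`). Since λ > -1/2, the weight w is square integrable; with
the compact support of ψ this gives η² + q² ≤ A ρ² (1 + ρ^θ). The right side is of lower order than
ρ^(γ+1) = ρ^(2+2θ), so η² + q² is uniformly integrable on the rectangle.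

For the main estimate φ is replaced by a smooth truncation of size at most k; uniform integrability
controls the error (`abs_integral_truncation_rest_le`). Against the truncation the dissipation is
the integral of ε u_x ((η_m)_x φ + η_m φ_x). The first term is O(k), because ε u_x (η_m)_x is
bounded in L¹, and the second is small with ε. This settles ε ≤ d. The family also contains
viscosities that are not small: for ε ≥ d the density is bounded (`ViscousFlow.density_le`), η and q
have x-derivatives in L², and the missing control of η_t comes from averaging η in x over a short
length (`EntropyFlow.abs_integral_le_of_large`). -/

/-! ### Smooth solutions up to t = 0 and the equations in nonconservative form -/

/-- First partial derivatives of a function that is smooth on the closed half-plane `t ≥ 0`. -/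
theorem exists_partials_of_contDiffOn_halfPlane {f : ℝ → ℝ → ℝ}
    (hf : ContDiffOn ℝ ∞ (fun z : ℝ × ℝ => f z.1 z.2) (Ici 0 ×ˢ univ)) :
    ∃ fx ft : ℝ → ℝ → ℝ,
      ContDiffOn ℝ ∞ (fun z : ℝ × ℝ => fx z.1 z.2) (Ici 0 ×ˢ univ) ∧
      (∀ t x, 0 ≤ t → HasDerivAt (f t) (fx t x) x) ∧
      (∀ t x, 0 < t → HasDerivAt (fun s => f s x) (ft t x) t) ∧
      (∀ t x, 0 < t → ∃ d, HasDerivAt (fun s => fx s x) d t ∧ HasDerivAt (ft t) d x) := by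
  set S : Set (ℝ × ℝ) := Ici 0 ×ˢ univ with hS
  set F : ℝ × ℝ → ℝ := fun z => f z.1 z.2 with hF
  have hu : UniqueDiffOn ℝ S := (uniqueDiffOn_Ici 0).prod uniqueDiffOn_univ
  have hd : ContDiffOn ℝ ∞ (fderivWithin ℝ F S) S :=
    hf.fderivWithin hu (by simp)
  have hnhds : ∀ t x : ℝ, 0 < t → S ∈ 𝓝 (t, x) := fun t x ht =>
    prod_mem_nhds (Ici_mem_nhds ht) univ_mem
  have hdx : ∀ t x : ℝ, 0 < t → HasFDerivAt F (fderivWithin ℝ F S (t, x)) (t, x) := by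
    intro t x ht
    exact ((hf.differentiableOn (by simp)) (t, x) (mem_of_mem_nhds (hnhds t x ht))
      ).hasFDerivWithinAt.hasFDerivAt (hnhds t x ht)
  have hcurx : ∀ t x : ℝ, HasDerivAt (fun y : ℝ => ((t, y) : ℝ × ℝ)) (0, 1) x := fun t x =>
    (hasDerivAt_const x t).prodMk (hasDerivAt_id x)
  have hcurt : ∀ t x : ℝ, HasDerivAt (fun s : ℝ => ((s, x) : ℝ × ℝ)) (1, 0) t := fun t x =>
    (hasDerivAt_id t).prodMk (hasDerivAt_const t x)
  refine ⟨fun t x => fderivWithin ℝ F S (t, x) (0, 1), fun t x => fderivWithin ℝ F S (t, x) (1, 0),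
    hd.clm_apply contDiffOn_const, ?_, ?_, ?_⟩
  · intro t x ht
    have h1 := ((hf.differentiableOn (by simp)) (t, x) ⟨ht, mem_univ _⟩).hasFDerivWithinAt
    have h2 := h1.comp_hasDerivWithinAt (s := univ) (f := fun y : ℝ => ((t, y) : ℝ × ℝ)) x
      (hcurx t x).hasDerivWithinAt (fun y _ => ⟨ht, mem_univ _⟩)
    exact hasDerivWithinAt_univ.1 h2
  · intro t x ht
    exact (hdx t x ht).comp_hasDerivAt t (hcurt t x)
  · intro t x ht
    have hc : ContDiffAt ℝ ∞ F (t, x) := hf.contDiffAt (hnhds t x ht)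
    have hev : fderivWithin ℝ F S =ᶠ[𝓝 (t, x)] fderiv ℝ F := by
      filter_upwards [prod_mem_nhds (Ioi_mem_nhds ht) (univ_mem (f := 𝓝 x))] with z hz
      exact fderivWithin_of_mem_nhds (hnhds z.1 z.2 hz.1)
    -- Symmetry of the second derivative lets one number serve as both mixed derivatives; this is
    -- how ρ_xt is later read off from the mass equation.
    have hsym : IsSymmSndFDerivAt ℝ F (t, x) := hc.isSymmSndFDerivAt
      (by simpa using WithTop.coe_le_coe.2 (le_top : (2 : ℕ∞) ≤ ⊤))
    have hdd : HasFDerivAt (fderivWithin ℝ F S) (fderiv ℝ (fderiv ℝ F) (t, x)) (t, x) := by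
      have : DifferentiableAt ℝ (fderiv ℝ F) (t, x) :=
        (hc.fderiv_right (m := ∞) (by simp)).differentiableAt (by simp)
      exact this.hasFDerivAt.congr_of_eventuallyEq hev
    have hap : ∀ v : ℝ × ℝ, HasFDerivAt (fun z => fderivWithin ℝ F S z v)
        ((ContinuousLinearMap.apply ℝ ℝ v).comp (fderiv ℝ (fderiv ℝ F) (t, x))) (t, x) := fun v =>
      (ContinuousLinearMap.apply ℝ ℝ v).hasFDerivAt.comp (t, x) hdd
    refine ⟨fderiv ℝ (fderiv ℝ F) (t, x) (1, 0) (0, 1), ?_, ?_⟩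
    · exact (hap (0, 1)).comp_hasDerivAt t (hcurt t x)
    · refine ((hap (1, 0)).comp_hasDerivAt x (hcurx t x)).congr_deriv ?_
      exact hsym.eq (0, 1) (1, 0)

/-- A flow with density `r` and velocity `u`, extended continuously to all times, that solves the
Navier-Stokes equations in nonconservative form for `t > 0`. -/
structure ViscousFlow (γ ε ρl ρr ul ur : ℝ) (r u rx rxx ux uxx : ℝ → ℝ → ℝ) : Prop where
  cont_r : Continuous fun z : ℝ × ℝ => r z.1 z.2
  cont_u : Continuous fun z : ℝ × ℝ => u z.1 z.2
  cont_rx : Continuous fun z : ℝ × ℝ => rx z.1 z.2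
  cont_rxx : Continuous fun z : ℝ × ℝ => rxx z.1 z.2
  cont_ux : Continuous fun z : ℝ × ℝ => ux z.1 z.2
  cont_uxx : Continuous fun z : ℝ × ℝ => uxx z.1 z.2
  pos : ∀ t x, 0 < r t x
  r_x : ∀ t x, HasDerivAt (r t) (rx t x) x
  rx_x : ∀ t x, HasDerivAt (rx t) (rxx t x) x
  u_x : ∀ t x, HasDerivAt (u t) (ux t x) x
  ux_x : ∀ t x, HasDerivAt (ux t) (uxx t x) x
  r_t : ∀ t x, 0 < t → HasDerivAt (fun s => r s x) (-(rx t x * u t x + r t x * ux t x)) t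
  rx_t : ∀ t x, 0 < t → HasDerivAt (fun s => rx s x)
    (-(rxx t x * u t x + 2 * (rx t x * ux t x) + r t x * uxx t x)) t
  u_t : ∀ t x, 0 < t → HasDerivAt (fun s => u s x)
    (-(u t x * ux t x) - gasKappa γ * γ * r t x ^ (γ - 2) * rx t x + ε * uxx t x / r t x) t
  bound : ∀ T : ℝ, ∃ B : ℝ, ∀ t ∈ Icc 0 T, ∀ x, r t x ≤ B ∧ |u t x| ≤ B
  right : ∀ T δ : ℝ, 0 < δ → ∃ X : ℝ, ∀ t ∈ Icc 0 T, ∀ x, X ≤ x →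
    |r t x - ρr| < δ ∧ |u t x - ur| < δ
  left : ∀ T δ : ℝ, 0 < δ → ∃ X : ℝ, ∀ t ∈ Icc 0 T, ∀ x, x ≤ X →
    |r t x - ρl| < δ ∧ |u t x - ul| < δ

/-- Freezing time at `max t 0` turns continuity on the closed half-plane into continuity on the
whole plane, so that facts on globally continuous integrands apply. Nothing changes for t > 0. -/
theorem continuous_comp_max_of_continuousOn {f : ℝ → ℝ → ℝ}
    (hf : ContinuousOn (fun z : ℝ × ℝ => f z.1 z.2) (Ici 0 ×ˢ univ)) :
    Continuous fun z : ℝ × ℝ => f (max z.1 0) z.2 := by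
  have h : Continuous fun z : ℝ × ℝ => ((max z.1 0, z.2) : ℝ × ℝ) := by fun_prop
  exact hf.comp_continuous h fun z => ⟨le_max_right z.1 0, mem_univ _⟩

theorem hasDerivAt_comp_max {f : ℝ → ℝ} {d t : ℝ} (ht : 0 < t) (h : HasDerivAt f d t) :
    HasDerivAt (fun s => f (max s 0)) d t := by
  refine h.congr_of_eventuallyEq ?_
  filter_upwards [Ioi_mem_nhds ht] with s hs
  rw [max_eq_left (le_of_lt hs)]

theorem bounded_of_continuous_of_ends {f : ℝ → ℝ → ℝ} {a b T : ℝ}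
    (hf : Continuous fun z : ℝ × ℝ => f z.1 z.2)
    (hr : ∃ X : ℝ, ∀ t ∈ Icc 0 T, ∀ x, X ≤ x → |f t x - b| < 1)
    (hl : ∃ X : ℝ, ∀ t ∈ Icc 0 T, ∀ x, x ≤ X → |f t x - a| < 1) :
    ∃ B : ℝ, ∀ t ∈ Icc 0 T, ∀ x, |f t x| ≤ B := by
  obtain ⟨X, hX⟩ := hr
  obtain ⟨Y, hY⟩ := hl
  obtain ⟨C, hC⟩ := ((isCompact_Icc (a := (0 : ℝ)) (b := T)).prod
    (isCompact_Icc (a := Y) (b := X))).exists_bound_of_continuousOn hf.continuousOn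
  refine ⟨max C (max (|b| + 1) (|a| + 1)), fun t ht x => ?_⟩
  rcases le_total X x with h | h
  · have h1 := hX t ht x h
    have h2 := abs_sub_abs_le_abs_sub (f t x) b
    exact le_max_of_le_right (le_max_of_le_left (by linarith))
  rcases le_total x Y with h' | h'
  · have h1 := hY t ht x h'
    have h2 := abs_sub_abs_le_abs_sub (f t x) a
    exact le_max_of_le_right (le_max_of_le_right (by linarith))
  · exact le_max_of_le_left (hC (t, x) ⟨ht, h', h⟩)

theorem IsNavierStokesSolution.exists_viscousFlow {γ ε ρl ρr ul ur : ℝ} {ρ₀ u₀ : ℝ → ℝ}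
    {ρ u : ℝ → ℝ → ℝ} (h : IsNavierStokesSolution γ ε ρl ρr ul ur ρ₀ u₀ ρ u) :
    ∃ rx rxx ux uxx : ℝ → ℝ → ℝ, ViscousFlow γ ε ρl ρr ul ur
      (fun t x => ρ (max t 0) x) (fun t x => u (max t 0) x) rx rxx ux uxx := by
  obtain ⟨rx, rt, hrxs, hrx, hrt, hrm⟩ := exists_partials_of_contDiffOn_halfPlane h.smooth_rho
  obtain ⟨rxx, rxt, hrxxs, hrxx, hrxt, -⟩ := exists_partials_of_contDiffOn_halfPlane hrxs
  obtain ⟨ux, ut, huxs, hux, hut, -⟩ := exists_partials_of_contDiffOn_halfPlane h.smooth_u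
  obtain ⟨uxx, -, huxxs, huxx, -, -⟩ := exists_partials_of_contDiffOn_halfPlane huxs
  have hpos : ∀ t x, 0 ≤ t → 0 < ρ t x := fun t x ht => by
    obtain ⟨c, hc, hcx⟩ := h.lower t ht
    exact hc.trans_le (hcx x)
  have hmass : ∀ t x, 0 < t → rt t x = -(rx t x * u t x + ρ t x * ux t x) := by
    intro t x ht
    have h1 := h.mass t x ht
    have e : deriv (fun y => ρ t y * u t y) x = _ := ((hrx t x ht.le).mul (hux t x ht.le)).deriv
    rw [(hrt t x ht).deriv, e] at h1
    linarith
  have hmom : ∀ t x, 0 < t → ut t x = -(u t x * ux t x)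
      - gasKappa γ * γ * ρ t x ^ (γ - 2) * rx t x + ε * uxx t x / ρ t x := by
    intro t x ht
    have hp := hpos t x ht.le
    have h1 := h.momentum t x ht
    have hfun : (deriv fun y => u t y) = ux t := by
      funext y; exact (hux t y ht.le).deriv
    have hpr : HasDerivAt (fun y => pressure γ (ρ t y))
        (gasKappa γ * (rx t x * γ * ρ t x ^ (γ - 1))) x :=
      ((hrx t x ht.le).rpow_const (Or.inl hp.ne')).const_mul _
    have hflux := ((hrx t x ht.le).mul ((hux t x ht.le).pow 2)).add hpr
    have hm := (hrt t x ht).mul (hut t x ht)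
    have e1 : deriv (fun s => ρ s x * u s x) t = _ := hm.deriv
    have e2 : deriv (fun y => ρ t y * u t y ^ 2 + pressure γ (ρ t y)) x = _ := hflux.deriv
    rw [e1, e2, hfun, (huxx t x ht.le).deriv, hmass t x ht] at h1
    have hpw : ρ t x ^ (γ - 1) = ρ t x ^ (γ - 2) * ρ t x := by
      rw [← Real.rpow_add_one hp.ne']; ring_nf
    rw [hpw] at h1
    simp only [Pi.pow_apply] at h1
    field_simp
    push_cast at h1
    ring_nf at h1 ⊢
    linarith
  have hmax : ∀ t : ℝ, 0 ≤ max t 0 := fun t => le_max_right _ _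
  have hmaxt : ∀ t : ℝ, 0 ≤ t → max t 0 = t := fun t ht => max_eq_left ht
  have cr := continuous_comp_max_of_continuousOn h.smooth_rho.continuousOn
  have cu := continuous_comp_max_of_continuousOn h.smooth_u.continuousOn
  have hright : ∀ T δ : ℝ, 0 < δ → ∃ X : ℝ, ∀ t ∈ Icc 0 T, ∀ x, X ≤ x →
      |ρ (max t 0) x - ρr| < δ ∧ |u (max t 0) x - ur| < δ := by
    intro T δ hδ
    have h1 := Metric.tendstoUniformlyOn_iff.1 (h.rho_right T) δ hδ
    have h2 := Metric.tendstoUniformlyOn_iff.1 (h.u_right T) δ hδ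
    obtain ⟨X, hX⟩ := eventually_atTop.1 (h1.and h2)
    refine ⟨X, fun t ht x hx => ?_⟩
    obtain ⟨ha, hb⟩ := hX x hx
    have ha' := ha t ht
    have hb' := hb t ht
    rw [dist_comm, Real.dist_eq] at ha' hb'
    rw [hmaxt t ht.1]
    exact ⟨ha', hb'⟩
  have hleft : ∀ T δ : ℝ, 0 < δ → ∃ X : ℝ, ∀ t ∈ Icc 0 T, ∀ x, x ≤ X →
      |ρ (max t 0) x - ρl| < δ ∧ |u (max t 0) x - ul| < δ := by
    intro T δ hδ
    have h1 := Metric.tendstoUniformlyOn_iff.1 (h.rho_left T) δ hδ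
    have h2 := Metric.tendstoUniformlyOn_iff.1 (h.u_left T) δ hδ
    obtain ⟨X, hX⟩ := eventually_atBot.1 (h1.and h2)
    refine ⟨X, fun t ht x hx => ?_⟩
    obtain ⟨ha, hb⟩ := hX x hx
    have ha' := ha t ht
    have hb' := hb t ht
    rw [dist_comm, Real.dist_eq] at ha' hb'
    rw [hmaxt t ht.1]
    exact ⟨ha', hb'⟩
  refine ⟨fun t x => rx (max t 0) x, fun t x => rxx (max t 0) x, fun t x => ux (max t 0) x,
    fun t x => uxx (max t 0) x, ?_⟩
  constructor
  · exact cr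
  · exact cu
  · exact continuous_comp_max_of_continuousOn hrxs.continuousOn
  · exact continuous_comp_max_of_continuousOn hrxxs.continuousOn
  · exact continuous_comp_max_of_continuousOn huxs.continuousOn
  · exact continuous_comp_max_of_continuousOn huxxs.continuousOn
  · exact fun t x => hpos _ x (hmax t)
  · exact fun t x => hrx _ x (hmax t)
  · exact fun t x => hrxx _ x (hmax t)
  · exact fun t x => hux _ x (hmax t)
  · exact fun t x => huxx _ x (hmax t)
  · intro t x ht
    have := hasDerivAt_comp_max ht (hrt t x ht)
    rw [hmass t x ht] at this
    simpa only [hmaxt t ht.le] using this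
  · intro t x ht
    -- The mass equation holds for all x at this time, so it may be differentiated in x; the
    -- equality of the mixed derivatives then gives the time derivative of ρ_x.
    obtain ⟨d, hd1, hd2⟩ := hrm t x ht
    have hfun : rt t = fun y => -(rx t y * u t y + ρ t y * ux t y) := by
      funext y; exact hmass t y ht
    rw [hfun] at hd2
    have h3 := (((hrxx t x ht.le).mul (hux t x ht.le)).add
      ((hrx t x ht.le).mul (huxx t x ht.le))).neg
    have h4 := hd2.unique h3
    have := hasDerivAt_comp_max ht hd1
    rw [h4] at this
    simp only [hmaxt t ht.le]
    refine this.congr_deriv ?_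
    ring
  · intro t x ht
    have := hasDerivAt_comp_max ht (hut t x ht)
    rw [hmom t x ht] at this
    simpa only [hmaxt t ht.le] using this
  · intro T
    obtain ⟨B, hB⟩ := bounded_of_continuous_of_ends (T := T) cr
      ((hright T 1 one_pos).imp fun X hX t ht x hx => (hX t ht x hx).1)
      ((hleft T 1 one_pos).imp fun X hX t ht x hx => (hX t ht x hx).1)
    obtain ⟨B', hB'⟩ := bounded_of_continuous_of_ends (T := T) cu
      ((hright T 1 one_pos).imp fun X hX t ht x hx => (hX t ht x hx).2)
      ((hleft T 1 one_pos).imp fun X hX t ht x hx => (hX t ht x hx).2)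
    exact ⟨max B B', fun t ht x => ⟨(le_abs_self _).trans ((hB t ht x).trans (le_max_left _ _)),
      (hB' t ht x).trans (le_max_right _ _)⟩⟩
  · exact hright
  · exact hleft

/-! ### The relative internal energy -/

theorem gasKappa_pos {γ : ℝ} (hγ : 1 < γ) : 0 < gasKappa γ := by
  have h : (γ - 1) ≠ 0 := by linarith
  unfold gasKappa
  positivity

theorem hasDerivAt_internalEnergy {γ b : ℝ} (hb : 0 < b) :
    HasDerivAt (internalEnergy γ) (gasKappa γ / (γ - 1) * (γ * b ^ (γ - 1))) b :=
  (Real.hasDerivAt_rpow_const (Or.inl hb.ne')).const_mul _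

theorem relInternalEnergy_eq {γ b : ℝ} (hb : 0 < b) (r : ℝ) :
    relInternalEnergy γ r b =
      gasKappa γ / (γ - 1) * (r ^ γ - b ^ γ - γ * b ^ (γ - 1) * (r - b)) := by
  rw [relInternalEnergy, (hasDerivAt_internalEnergy hb).deriv, internalEnergy, internalEnergy]
  ring

/-- Bernoulli's inequality for (r / b)^γ, multiplied by b^γ. -/
theorem relInternalEnergy_nonneg {γ r b : ℝ} (hγ : 1 < γ) (hr : 0 < r) (hb : 0 < b) :
    0 ≤ relInternalEnergy γ r b := by
  rw [relInternalEnergy_eq hb]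
  have hk := gasKappa_pos hγ
  have h1 : 0 < γ - 1 := by linarith
  refine mul_nonneg (by positivity) ?_
  have hB := one_add_mul_self_le_rpow_one_add (s := r / b - 1) (p := γ)
    (by have : 0 < r / b := by positivity
        linarith) hγ.le
  have e1 : 1 + (r / b - 1) = r / b := by ring
  rw [e1, Real.div_rpow hr.le hb.le] at hB
  have hbg : 0 < b ^ γ := Real.rpow_pos_of_pos hb γ
  rw [le_div_iff₀ hbg] at hB
  have e2 : b ^ γ = b ^ (γ - 1) * b := by
    rw [← Real.rpow_add_one hb.ne']; ring_nf
  have e3 : (1 + γ * (r / b - 1)) * b ^ γ = b ^ γ + γ * b ^ (γ - 1) * (r - b) := by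
    rw [add_mul, one_mul]
    nth_rewrite 2 [e2]
    field_simp
  linarith

theorem le_one_add_rpow {γ r : ℝ} (hγ : 1 ≤ γ) (hr : 0 ≤ r) : r ≤ 1 + r ^ γ := by
  rcases le_total r 1 with h | h
  · have := Real.rpow_nonneg hr γ
    linarith
  · have := Real.rpow_le_rpow_of_exponent_le h hγ
    rw [Real.rpow_one] at this
    linarith

theorem exists_rpow_le_relInternalEnergy {γ : ℝ} (hγ : 1 < γ) {B : ℝ} (hB : 0 < B) :
    ∃ C : ℝ, 0 < C ∧ ∀ b r : ℝ, 0 < b → b ≤ B → 0 < r →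
      r ^ γ ≤ C * (1 + relInternalEnergy γ r b) := by
  have hk := gasKappa_pos hγ
  have h1 : 0 < γ - 1 := by linarith
  have hγ0 : 0 < γ := by linarith
  set k := gasKappa γ / (γ - 1) with hkdef
  have hk0 : 0 < k := by positivity
  -- A solves A^(γ-1) = 2γ B^(γ-1): for r ≥ A the linear term γ B^(γ-1) r is at most r^γ / 2 and can
  -- be absorbed; for r ≤ A it is bounded.
  set A : ℝ := (2 * γ) ^ (1 / (γ - 1)) * B with hA
  have hA0 : 0 < A := by positivity
  have hAp : A ^ (γ - 1) = 2 * γ * B ^ (γ - 1) := by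
    rw [hA, Real.mul_rpow (by positivity) hB.le, ← Real.rpow_mul (by positivity),
      one_div, inv_mul_cancel₀ h1.ne', Real.rpow_one]
  set C' : ℝ := B ^ γ + γ * B ^ (γ - 1) * A with hC'
  have hC'0 : 0 < C' := by positivity
  refine ⟨2 / k + 2 * C', by positivity, fun b r hb hbB hr => ?_⟩
  have hE := relInternalEnergy_nonneg hγ hr hb
  have heq := relInternalEnergy_eq (γ := γ) hb r
  rw [← hkdef] at heq
  set E := relInternalEnergy γ r b
  have e1 : r ^ γ - b ^ γ - γ * b ^ (γ - 1) * (r - b) = E / k := by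
    rw [heq]; field_simp
  have hb1 : b ^ γ ≤ B ^ γ := Real.rpow_le_rpow hb.le hbB hγ0.le
  have hb2 : b ^ (γ - 1) ≤ B ^ (γ - 1) := Real.rpow_le_rpow hb.le hbB h1.le
  have hb3 : 0 < b ^ (γ - 1) := Real.rpow_pos_of_pos hb _
  have h3 : γ * b ^ (γ - 1) * (r - b) ≤ γ * B ^ (γ - 1) * r := by
    have : γ * b ^ (γ - 1) * (r - b) ≤ γ * b ^ (γ - 1) * r := by
      apply mul_le_mul_of_nonneg_left (by linarith) (by positivity)
    exact this.trans (by gcongr)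
  have h4 : γ * B ^ (γ - 1) * r ≤ r ^ γ / 2 + γ * B ^ (γ - 1) * A := by
    rcases le_total r A with h | h
    · have h5 : γ * B ^ (γ - 1) * r ≤ γ * B ^ (γ - 1) * A := by gcongr
      have := Real.rpow_nonneg hr.le γ
      linarith
    · have h5 : A ^ (γ - 1) ≤ r ^ (γ - 1) := Real.rpow_le_rpow hA0.le h h1.le
      rw [hAp] at h5
      have e2 : r ^ γ = r ^ (γ - 1) * r := by
        rw [← Real.rpow_add_one hr.ne']; ring_nf
      have h6 : 0 ≤ γ * B ^ (γ - 1) * A := by positivity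
      rw [e2]
      nlinarith
  have h7 : r ^ γ ≤ 2 * (E / k) + 2 * C' := by rw [hC']; linarith
  have h8 : (2 / k + 2 * C') * (1 + E) = 2 * (E / k) + 2 * C' + (2 / k + 2 * C' * E) := by
    field_simp; ring
  have h9 : 0 ≤ 2 / k + 2 * C' * E := by positivity
  linarith

theorem hasDerivAt_relInternalEnergy_comp {γ : ℝ} {f g : ℝ → ℝ} {f' g' t : ℝ}
    (hfp : 0 < f t) (hgp : ∀ s, 0 < g s) (hf : HasDerivAt f f' t) (hg : HasDerivAt g g' t) :
    HasDerivAt (fun s => relInternalEnergy γ (f s) (g s))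
      (gasKappa γ / (γ - 1) * (γ * (f t ^ (γ - 1) - g t ^ (γ - 1)) * f'
        - γ * (γ - 1) * g t ^ (γ - 2) * (f t - g t) * g')) t := by
  have h1 := hf.rpow_const (p := γ) (Or.inl hfp.ne')
  have h2 := hg.rpow_const (p := γ) (Or.inl (hgp t).ne')
  have h3 := hg.rpow_const (p := γ - 1) (Or.inl (hgp t).ne')
  have h4 := ((h1.sub h2).sub ((h3.const_mul γ).mul (hf.sub hg))).const_mul (gasKappa γ / (γ - 1))
  have e : (fun s => relInternalEnergy γ (f s) (g s)) = fun s => gasKappa γ / (γ - 1) *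
      (f s ^ γ - g s ^ γ - γ * g s ^ (γ - 1) * (f s - g s)) := by
    funext s; exact relInternalEnergy_eq (hgp s) _
  rw [e]
  refine h4.congr_deriv ?_
  have : γ - 1 - 1 = γ - 2 := by ring
  rw [this]
  simp only [Pi.sub_apply]
  ring

/-! ### The reference profile -/

/-- Quantitative content of `IsReferenceProfile`. -/
structure ProfileBounds (ρbar ubar ρbar' ubar' : ℝ → ℝ) (L a B : ℝ) : Prop where
  L_pos : 0 < L
  a_pos : 0 < a
  B_pos : 0 < B
  der_rho : ∀ x, HasDerivAt ρbar (ρbar' x) x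
  der_u : ∀ x, HasDerivAt ubar (ubar' x) x
  cont_rho' : Continuous ρbar'
  cont_u' : Continuous ubar'
  rho_lower : ∀ x, a ≤ ρbar x
  rho_upper : ∀ x, ρbar x ≤ B
  u_bound : ∀ x, |ubar x| ≤ B
  rho'_bound : ∀ x, |ρbar' x| ≤ B
  u'_bound : ∀ x, |ubar' x| ≤ B
  support : ∀ x, L < |x| → ρbar' x = 0 ∧ ubar' x = 0

theorem mem_Icc_of_monotone_or_antitone {f : ℝ → ℝ} {a b L : ℝ} (hL : 0 < L)
    (hm : Monotone f ∨ Antitone f) (hl : ∀ x, x ≤ -L → f x = a) (hr : ∀ x, L ≤ x → f x = b)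
    (x : ℝ) : min a b ≤ f x ∧ f x ≤ max a b := by
  have h1 : -(|x| + L) ≤ x := by have := neg_abs_le x; linarith
  have h2 : x ≤ |x| + L := by have := le_abs_self x; linarith
  have e1 := hl (-(|x| + L)) (by have := abs_nonneg x; linarith)
  have e2 := hr (|x| + L) (by have := abs_nonneg x; linarith)
  rcases hm with hm | hm
  · have := hm h1
    have := hm h2
    rw [e1] at *; rw [e2] at *
    exact ⟨min_le_of_left_le ‹_›, le_max_of_le_right ‹_›⟩
  · have := hm h1
    have := hm h2
    rw [e1] at *; rw [e2] at *
    exact ⟨min_le_of_right_le ‹_›, le_max_of_le_left ‹_›⟩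

theorem deriv_eq_zero_of_const_ends {f : ℝ → ℝ} {a b L : ℝ}
    (hl : ∀ x, x ≤ -L → f x = a) (hr : ∀ x, L ≤ x → f x = b) {x : ℝ} (hx : L < |x|) :
    deriv f x = 0 := by
  rcases lt_abs.1 hx with h | h
  · have : f =ᶠ[𝓝 x] fun _ => b := by
      filter_upwards [Ioi_mem_nhds h] with y hy using hr y (le_of_lt hy)
    rw [this.deriv_eq, deriv_const]
  · have : f =ᶠ[𝓝 x] fun _ => a := by
      filter_upwards [Iio_mem_nhds (show x < -L by linarith)] with y hy using hl y (le_of_lt hy)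
    rw [this.deriv_eq, deriv_const]

theorem exists_bound_of_support {f : ℝ → ℝ} {L : ℝ} (hf : Continuous f)
    (h : ∀ x, L < |x| → f x = 0) : ∃ C, ∀ x, |f x| ≤ C := by
  obtain ⟨C, hC⟩ := (isCompact_Icc (a := -L) (b := L)).exists_bound_of_continuousOn hf.continuousOn
  refine ⟨max C 0, fun x => ?_⟩
  by_cases hx : L < |x|
  · rw [h x hx, abs_zero]; exact le_max_right _ _
  · exact le_max_of_le_left (hC x (abs_le.1 (not_lt.1 hx)))

theorem IsReferenceProfile.exists_bounds {ρl ρr ul ur : ℝ} {ρbar ubar : ℝ → ℝ}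
    (hρl : 0 < ρl) (hρr : 0 < ρr) (h : IsReferenceProfile ρl ρr ul ur ρbar ubar) :
    ∃ L a B, ProfileBounds ρbar ubar (deriv ρbar) (deriv ubar) L a B ∧
      (∀ x, x ≤ -L → ρbar x = ρl ∧ ubar x = ul) ∧ (∀ x, L ≤ x → ρbar x = ρr ∧ ubar x = ur) := by
  obtain ⟨L, hL, hl, hr⟩ := h.eq_ends
  have hc1 : Continuous (deriv ρbar) := h.smooth_rho.continuous_deriv (by simp)
  have hc2 : Continuous (deriv ubar) := h.smooth_u.continuous_deriv (by simp)
  have hs1 : ∀ x, L < |x| → deriv ρbar x = 0 := fun x hx =>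
    deriv_eq_zero_of_const_ends (fun y hy => (hl y hy).1) (fun y hy => (hr y hy).1) hx
  have hs2 : ∀ x, L < |x| → deriv ubar x = 0 := fun x hx =>
    deriv_eq_zero_of_const_ends (fun y hy => (hl y hy).2) (fun y hy => (hr y hy).2) hx
  obtain ⟨C1, hC1⟩ := exists_bound_of_support hc1 hs1
  obtain ⟨C2, hC2⟩ := exists_bound_of_support hc2 hs2
  have hm1 := mem_Icc_of_monotone_or_antitone hL h.monotone_rho (fun y hy => (hl y hy).1)
    (fun y hy => (hr y hy).1)
  have hm2 := mem_Icc_of_monotone_or_antitone hL h.monotone_u (fun y hy => (hl y hy).2)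
    (fun y hy => (hr y hy).2)
  have hC1' : 0 ≤ C1 := (abs_nonneg _).trans (hC1 0)
  have hC2' : 0 ≤ C2 := (abs_nonneg _).trans (hC2 0)
  refine ⟨L, min ρl ρr, C1 + C2 + ρl + ρr + |ul| + |ur|,
    ⟨hL, lt_min hρl hρr, by positivity, fun x => (h.smooth_rho.differentiable (by simp) x).hasDerivAt,
      fun x => (h.smooth_u.differentiable (by simp) x).hasDerivAt, hc1, hc2,
      fun x => (hm1 x).1, fun x => ?_, fun x => ?_, fun x => ?_, fun x => ?_,
      fun x hx => ⟨hs1 x hx, hs2 x hx⟩⟩, hl, hr⟩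
  · have := (hm1 x).2
    have : max ρl ρr ≤ ρl + ρr := max_le (by linarith) (by linarith)
    linarith [abs_nonneg ul, abs_nonneg ur]
  · have h3 := (hm2 x).2
    have h4 := (hm2 x).1
    have h5 : max ul ur ≤ |ul| + |ur| := max_le (by linarith [le_abs_self ul, abs_nonneg ur])
      (by linarith [le_abs_self ur, abs_nonneg ul])
    have h6 : -(|ul| + |ur|) ≤ min ul ur := le_min (by linarith [neg_abs_le ul, abs_nonneg ur])
      (by linarith [neg_abs_le ur, abs_nonneg ul])
    rw [abs_le]
    constructor <;> linarith
  · linarith [hC1 x, abs_nonneg ul, abs_nonneg ur]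
  · linarith [hC2 x, abs_nonneg ul, abs_nonneg ur]

/-! ### The energy identity -/

/-- Sum of the relative mechanical energy and of the relative energy built with the effective
velocity `u + ε ρ_x / ρ²`. -/
noncomputable def energyDensity (γ ε r u rx rb ub : ℝ) : ℝ :=
  1 / 2 * r * (u - ub) ^ 2 + 1 / 2 * r * (u + ε * rx / r ^ 2 - ub) ^ 2
    + 2 * relInternalEnergy γ r rb

/-- The part of the energy flux that vanishes at the end states. -/
noncomputable def pressureFlux (γ r u rb ub : ℝ) : ℝ :=
  2 * (gasKappa γ * γ / (γ - 1) * (r ^ (γ - 1) - rb ^ (γ - 1))) * (r * u)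
    - 2 * ub * (gasKappa γ * (r ^ γ - rb ^ γ))

/-- Minus the flux of `energyDensity`. -/
noncomputable def energyFlux (γ ε r u rx ux rb ub : ℝ) : ℝ :=
  -(1 / 2 * (r * u) * ((u - ub) ^ 2 + (u + ε * rx / r ^ 2 - ub) ^ 2))
    - pressureFlux γ r u rb ub + ε * ((u - ub) * ux)

/-- The `x`-derivative of `energyFlux`. -/
noncomputable def energyFluxDeriv (γ ε r u rx rxx ux uxx rb ub rb' ub' : ℝ) : ℝ :=
  -(1 / 2 * ((rx * u + r * ux) * ((u - ub) ^ 2 + (u + ε * rx / r ^ 2 - ub) ^ 2)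
      + (r * u) * (2 * (u - ub) * (ux - ub') + 2 * (u + ε * rx / r ^ 2 - ub)
        * (ux + ε * (rxx / r ^ 2 - 2 * rx ^ 2 / r ^ 3) - ub'))))
    - (2 * (gasKappa γ * γ * (r ^ (γ - 2) * rx - rb ^ (γ - 2) * rb')) * (r * u)
      + 2 * (gasKappa γ * γ / (γ - 1) * (r ^ (γ - 1) - rb ^ (γ - 1))) * (rx * u + r * ux)
      - (2 * ub' * (gasKappa γ * (r ^ γ - rb ^ γ))
        + 2 * ub * (gasKappa γ * γ * (r ^ (γ - 1) * rx - rb ^ (γ - 1) * rb'))))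
    + ε * ((ux - ub') * ux + (u - ub) * uxx)

/-- The source term in the balance law of `energyDensity`. -/
noncomputable def energySource (γ ε r u rx ux rb ub rb' ub' : ℝ) : ℝ :=
  -(ε * ux ^ 2) + ε * ux * ub' - ε * (gasKappa γ * γ) * (r ^ (γ - 3) * rx ^ 2)
    - r * u * ub' * (u - ub) - r * u * ub' * (u + ε * rx / r ^ 2 - ub)
    - 2 * (gasKappa γ * γ) * rb ^ (γ - 2) * rb' * (r * u - rb * ub)
    - 2 * ub' * (gasKappa γ * (r ^ γ - rb ^ γ))

theorem rpow_sub_one_eq {r : ℝ} (hr : 0 < r) (γ : ℝ) : r ^ (γ - 1) = r ^ (γ - 2) * r := by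
  rw [← Real.rpow_add_one hr.ne']; ring_nf

theorem rpow_eq_mul_sq {r : ℝ} (hr : 0 < r) (γ : ℝ) : r ^ γ = r ^ (γ - 2) * r ^ 2 := by
  rw [← Real.rpow_natCast r 2, ← Real.rpow_add hr]; norm_num

theorem rpow_sub_three_eq {r : ℝ} (hr : 0 < r) (γ : ℝ) : r ^ (γ - 3) = r ^ (γ - 2) / r := by
  rw [← Real.rpow_sub_one hr.ne']; ring_nf

theorem hasDerivAt_energyFlux {γ ε x : ℝ} (hγ : 1 < γ) {r u rx ux rb ub : ℝ → ℝ}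
    {rxx uxx rb' ub' : ℝ}
    (hr0 : 0 < r x) (hb0 : 0 < rb x) (hr : HasDerivAt r (rx x) x) (hrx : HasDerivAt rx rxx x)
    (hu : HasDerivAt u (ux x) x) (hux : HasDerivAt ux uxx x)
    (hrb : HasDerivAt rb rb' x) (hub : HasDerivAt ub ub' x) :
    HasDerivAt (fun y => energyFlux γ ε (r y) (u y) (rx y) (ux y) (rb y) (ub y))
      (energyFluxDeriv γ ε (r x) (u x) (rx x) rxx (ux x) uxx (rb x) (ub x) rb' ub') x := by
  have ha := hu.sub hub
  have hV := (hu.add ((hrx.const_mul ε).div (hr.pow 2) (by simp [hr0.ne']))).sub hub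
  have hru := hr.mul hu
  have hp1 := hr.rpow_const (p := γ - 1) (Or.inl hr0.ne')
  have hp2 := hrb.rpow_const (p := γ - 1) (Or.inl hb0.ne')
  have hp3 := hr.rpow_const (p := γ) (Or.inl hr0.ne')
  have hp4 := hrb.rpow_const (p := γ) (Or.inl hb0.ne')
  have h1 := ((hru.const_mul (1 / 2)).mul ((ha.pow 2).add (hV.pow 2))).neg
  have h2 := ((((hp1.sub hp2).const_mul (gasKappa γ * γ / (γ - 1))).const_mul 2).mul hru).sub
    ((hub.const_mul 2).mul ((hp3.sub hp4).const_mul (gasKappa γ)))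
  have h3 := (ha.mul hux).const_mul ε
  have h := (h1.sub h2).add h3
  refine h.congr_deriv ?_
  have e1 : γ - 1 - 1 = γ - 2 := by ring
  have hg : γ - 1 ≠ 0 := by linarith
  have hr1 := hr0.ne'
  unfold energyFluxDeriv
  simp only [Pi.sub_apply, Pi.pow_apply, Pi.mul_apply, Pi.add_apply, Pi.div_apply, e1]
  generalize gasKappa γ = k
  generalize r x ^ (γ - 2) = P
  generalize r x ^ (γ - 1) = P1
  generalize r x ^ γ = P2
  generalize rb x ^ (γ - 2) = Q
  generalize rb x ^ (γ - 1) = Q1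
  generalize rb x ^ γ = Q2
  push_cast
  field_simp

/-- Both u and V = u + ερ_x/ρ² are advected by u. The viscous force is absent from the equation of
V, which reads ρ(V_t + uV_x) + p_x = 0, since the material derivative of ερ_x/ρ² is -εu_xx/ρ. The
energy with u dissipates ε u_x², and the energy with V dissipates ε p_x ρ_x/ρ², which is κγ ε
ρ^(γ-3) ρ_x². The numbers `rb'` and `ub'` are free because they cancel between the flux derivative
and the source. -/
theorem ViscousFlow.hasDerivAt_energyDensity {γ ε ρl ρr ul ur : ℝ}
    {r u rx rxx ux uxx : ℝ → ℝ → ℝ} (hγ : 1 < γ)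
    (h : ViscousFlow γ ε ρl ρr ul ur r u rx rxx ux uxx)
    {rb : ℝ} (ub rb' ub' : ℝ) (hb0 : 0 < rb) {t : ℝ} (x : ℝ) (ht : 0 < t) :
    HasDerivAt (fun s => energyDensity γ ε (r s x) (u s x) (rx s x) rb ub)
      (energyFluxDeriv γ ε (r t x) (u t x) (rx t x) (rxx t x) (ux t x) (uxx t x) rb ub rb' ub'
        + energySource γ ε (r t x) (u t x) (rx t x) (ux t x) rb ub rb' ub') t := by
  have hr0 := h.pos t x
  have hr := h.r_t t x ht
  have hu := h.u_t t x ht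
  have hrx := h.rx_t t x ht
  have ha := hu.sub_const ub
  have hV := (hu.add ((hrx.const_mul ε).div (hr.pow 2) (by simp [hr0.ne']))).sub_const ub
  have hE := hasDerivAt_relInternalEnergy_comp (γ := γ) (f := fun s => r s x) (t := t)
    (g := fun _ => rb) hr0 (fun _ => hb0) hr
    (hasDerivAt_const t rb)
  have hd := (((hr.const_mul (1 / 2)).mul (ha.pow 2)).add
    ((hr.const_mul (1 / 2)).mul (hV.pow 2))).add (hE.const_mul 2)
  refine hd.congr_deriv ?_
  have hg : γ - 1 ≠ 0 := by linarith
  have hr1 := hr0.ne'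
  have hb1 := hb0.ne'
  unfold energyFluxDeriv energySource
  simp only [Pi.pow_apply, Pi.add_apply, Pi.div_apply]
  rw [rpow_sub_three_eq hr0, rpow_sub_one_eq hr0, rpow_eq_mul_sq hr0,
    rpow_sub_one_eq hb0, rpow_eq_mul_sq hb0]
  generalize gasKappa γ = k
  generalize r t x ^ (γ - 2) = P
  generalize rb ^ (γ - 2) = Q
  generalize rx t x = R1
  generalize rxx t x = R2
  generalize ux t x = U1
  generalize uxx t x = U2
  generalize u t x = U0 at *
  generalize r t x = R0 at *
  push_cast
  field_simp
  ring

/-! ### Continuity of the energy expressions -/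

section continuity
variable {X : Type*} [TopologicalSpace X] {γ ε : ℝ} {r u rx rxx ux uxx rb ub rb' ub' : X → ℝ}

theorem exists_continuous_rpow (hr : Continuous r) (h0 : ∀ z, 0 < r z) (p : ℝ) :
    ∃ P : X → ℝ, Continuous P ∧ ∀ z, r z ^ p = P z :=
  ⟨fun z => r z ^ p, hr.rpow_const fun z => Or.inl (h0 z).ne', fun _ => rfl⟩

theorem continuous_energyDensity (hr : Continuous r) (hu : Continuous u) (hrx : Continuous rx)
    (hrb : Continuous rb) (hub : Continuous ub) (h0 : ∀ z, 0 < r z) (h1 : ∀ z, 0 < rb z) :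
    Continuous fun z => energyDensity γ ε (r z) (u z) (rx z) (rb z) (ub z) := by
  have e : (fun z => relInternalEnergy γ (r z) (rb z)) = fun z => gasKappa γ / (γ - 1) *
      (r z ^ γ - rb z ^ γ - γ * rb z ^ (γ - 1) * (r z - rb z)) := by
    funext z; exact relInternalEnergy_eq (h1 z) _
  have hc : Continuous fun z => relInternalEnergy γ (r z) (rb z) := by
    obtain ⟨P, hP, eP⟩ := exists_continuous_rpow hr h0 γ
    obtain ⟨Q, hQ, eQ⟩ := exists_continuous_rpow hrb h1 γ
    obtain ⟨Q', hQ', eQ'⟩ := exists_continuous_rpow hrb h1 (γ - 1)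
    rw [e]
    simp only [eP, eQ, eQ']
    fun_prop
  unfold energyDensity
  fun_prop (disch := exact fun z => (pow_pos (h0 z) _).ne')

theorem continuous_pressureFlux (hr : Continuous r) (hu : Continuous u)
    (hrb : Continuous rb) (hub : Continuous ub) (h0 : ∀ z, 0 < r z) (h1 : ∀ z, 0 < rb z) :
    Continuous fun z => pressureFlux γ (r z) (u z) (rb z) (ub z) := by
  unfold pressureFlux
  obtain ⟨P1, hP1, eP1⟩ := exists_continuous_rpow hr h0 (γ - 1)
  obtain ⟨Q1, hQ1, eQ1⟩ := exists_continuous_rpow hrb h1 (γ - 1)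
  obtain ⟨P, hP, eP⟩ := exists_continuous_rpow hr h0 γ
  obtain ⟨Q, hQ, eQ⟩ := exists_continuous_rpow hrb h1 γ
  simp only [eP1, eQ1, eP, eQ]
  fun_prop

theorem continuous_energyFlux (hr : Continuous r) (hu : Continuous u) (hrx : Continuous rx)
    (hux : Continuous ux) (hrb : Continuous rb) (hub : Continuous ub) (h0 : ∀ z, 0 < r z)
    (h1 : ∀ z, 0 < rb z) :
    Continuous fun z => energyFlux γ ε (r z) (u z) (rx z) (ux z) (rb z) (ub z) := by
  have := continuous_pressureFlux (γ := γ) hr hu hrb hub h0 h1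
  unfold energyFlux
  fun_prop (disch := exact fun z => (pow_pos (h0 z) _).ne')

theorem continuous_energyFluxDeriv (hr : Continuous r) (hu : Continuous u) (hrx : Continuous rx)
    (hrxx : Continuous rxx) (hux : Continuous ux) (huxx : Continuous uxx) (hrb : Continuous rb)
    (hub : Continuous ub) (hrb' : Continuous rb') (hub' : Continuous ub') (h0 : ∀ z, 0 < r z)
    (h1 : ∀ z, 0 < rb z) :
    Continuous fun z => energyFluxDeriv γ ε (r z) (u z) (rx z) (rxx z) (ux z) (uxx z) (rb z) (ub z)
      (rb' z) (ub' z) := by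
  unfold energyFluxDeriv
  obtain ⟨P2, hP2, eP2⟩ := exists_continuous_rpow hr h0 (γ - 2)
  obtain ⟨Q2, hQ2, eQ2⟩ := exists_continuous_rpow hrb h1 (γ - 2)
  obtain ⟨P1, hP1, eP1⟩ := exists_continuous_rpow hr h0 (γ - 1)
  obtain ⟨Q1, hQ1, eQ1⟩ := exists_continuous_rpow hrb h1 (γ - 1)
  obtain ⟨P, hP, eP⟩ := exists_continuous_rpow hr h0 γ
  obtain ⟨Q, hQ, eQ⟩ := exists_continuous_rpow hrb h1 γ
  simp only [eP2, eQ2, eP1, eQ1, eP, eQ]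
  fun_prop (disch := exact fun z => (pow_pos (h0 z) _).ne')

theorem continuous_energySource (hr : Continuous r) (hu : Continuous u) (hrx : Continuous rx)
    (hux : Continuous ux) (hrb : Continuous rb)
    (hub : Continuous ub) (hrb' : Continuous rb') (hub' : Continuous ub') (h0 : ∀ z, 0 < r z)
    (h1 : ∀ z, 0 < rb z) :
    Continuous fun z => energySource γ ε (r z) (u z) (rx z) (ux z) (rb z) (ub z)
      (rb' z) (ub' z) := by
  unfold energySource
  obtain ⟨P3, hP3, eP3⟩ := exists_continuous_rpow hr h0 (γ - 3)
  obtain ⟨Q2, hQ2, eQ2⟩ := exists_continuous_rpow hrb h1 (γ - 2)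
  obtain ⟨P, hP, eP⟩ := exists_continuous_rpow hr h0 γ
  obtain ⟨Q, hQ, eQ⟩ := exists_continuous_rpow hrb h1 γ
  simp only [eP3, eQ2, eP, eQ]
  fun_prop (disch := exact fun z => (pow_pos (h0 z) _).ne')

end continuity

/-! ### Sign of the energy and bound on its source -/

theorem energyDensity_nonneg {γ ε r u rx rb ub : ℝ} (hγ : 1 < γ) (hr : 0 < r) (hb : 0 < rb) :
    0 ≤ energyDensity γ ε r u rx rb ub := by
  have := relInternalEnergy_nonneg hγ hr hb
  unfold energyDensity
  positivity

set_option maxHeartbeats 1000000 in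
/-- The source term is dominated by dissipation, energy, and a constant on the support of the
derivatives of the profile. -/
theorem ProfileBounds.exists_energySource_le {γ : ℝ} (hγ : 1 < γ) {ρbar ubar ρbar' ubar' : ℝ → ℝ}
    {L a B : ℝ} (hp : ProfileBounds ρbar ubar ρbar' ubar' L a B) (ε₀ : ℝ) :
    ∃ K C : ℝ, 0 ≤ K ∧ 0 ≤ C ∧ ∀ ε ∈ Ioc 0 ε₀, ∀ x r u rx ux : ℝ, 0 < r →
      energySource γ ε r u rx ux (ρbar x) (ubar x) (ρbar' x) (ubar' x) ≤
        -(ε / 2 * ux ^ 2) - ε * (gasKappa γ * γ) * (r ^ (γ - 3) * rx ^ 2)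
        + K * energyDensity γ ε r u rx (ρbar x) (ubar x) + (Icc (-L) L).indicator (fun _ => C) x := by
  obtain ⟨c, hc, hcE⟩ := exists_rpow_le_relInternalEnergy hγ hp.B_pos
  have hk := gasKappa_pos hγ
  have hγ0 : 0 < γ := by linarith
  have hB := hp.B_pos
  have ha := hp.a_pos
  set k := gasKappa γ with hkd
  set Q : ℝ := B ^ γ / a ^ 2 with hQ
  have hQ0 : 0 ≤ Q := by positivity
  set M : ℝ := k * γ * Q * B with hM
  have hM0 : 0 ≤ M := by positivity
  set m : ℝ := B + M with hm
  have hm0 : 0 ≤ m := by positivity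
  set N : ℝ := (2 * m * B ^ 2 + M) * (1 + c) + 2 * B * k * c with hN
  have hN0 : 0 ≤ N := by positivity
  refine ⟨2 * (2 * m + B) + N, |ε₀| * B ^ 2 + N + 2 * M * B ^ 2 + 2 * B * k * B ^ γ,
    by positivity, by positivity, fun ε hε x r u rx ux hr => ?_⟩
  have hb0 : 0 < ρbar x := ha.trans_le (hp.rho_lower x)
  have hG := energyDensity_nonneg (γ := γ) (ε := ε) (u := u) (rx := rx) (ub := ubar x) hγ hr hb0
  have hε0 := hε.1
  have hux2 : 0 ≤ ε * ux ^ 2 := by positivity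
  -- Off [-L, L] the derivatives of the profile vanish, and only the dissipation is left in the
  -- source.
  by_cases hx : x ∈ Icc (-L) L
  swap
  · rw [indicator_of_notMem hx]
    have hx' : L < |x| := by
      by_contra hcon
      exact hx (abs_le.1 (not_lt.1 hcon))
    obtain ⟨h1, h2⟩ := hp.support x hx'
    unfold energySource
    rw [h1, h2]
    have : 0 ≤ (2 * (2 * m + B) + N) * energyDensity γ ε r u rx (ρbar x) (ubar x) := by positivity
    nlinarith
  rw [indicator_of_mem hx]
  unfold energySource energyDensity
  have hE := relInternalEnergy_nonneg hγ hr hb0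
  have h1 := hcE (ρbar x) r hb0 (hp.rho_upper x) hr
  have hrle := le_one_add_rpow hγ.le hr.le
  set E := relInternalEnergy γ r (ρbar x)
  have hrE : r ≤ (1 + c) * (1 + E) := by nlinarith
  set b := ubar x
  set s := ubar' x
  set σ := ρbar' x
  set V := u + ε * rx / r ^ 2 - b with hV
  set A := u - b with hA
  have hb : |b| ≤ B := hp.u_bound x
  have hs : |s| ≤ B := hp.u'_bound x
  have hσ : |σ| ≤ B := hp.rho'_bound x
  have hb2 : b ^ 2 ≤ B ^ 2 := sq_le_sq' (abs_le.1 hb).1 (abs_le.1 hb).2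
  have hs2 : s ^ 2 ≤ B ^ 2 := sq_le_sq' (abs_le.1 hs).1 (abs_le.1 hs).2
  have hru2 : r * u ^ 2 ≤ 2 * (r * A ^ 2) + 2 * B ^ 2 * r := by
    have : u ^ 2 ≤ 2 * A ^ 2 + 2 * B ^ 2 := by
      have : u = A + b := by rw [hA]; ring
      rw [this]
      nlinarith [sq_nonneg (A - b)]
    nlinarith
  have hr2 : 0 ≤ r * u ^ 2 := by positivity
  have hrA : 0 ≤ r * A ^ 2 := by positivity
  have hrV : 0 ≤ r * V ^ 2 := by positivity
  -- the five terms
  have t1 : ε * ux * s ≤ ε / 2 * ux ^ 2 + |ε₀| * B ^ 2 := by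
    have e1 : ε * ux * s ≤ ε / 2 * ux ^ 2 + ε / 2 * s ^ 2 := by linarith [mul_nonneg hε0.le (sq_nonneg (ux - s))]
    have e2 : ε ≤ |ε₀| := hε.2.trans (le_abs_self _)
    have e3 : ε / 2 * s ^ 2 ≤ |ε₀| * B ^ 2 := mul_le_mul (by linarith) hs2 (by positivity)
      (by positivity)
    linarith
  -- Used with w = u - ū and with w = u + ερ_x/ρ² - ū, the two velocities whose squares the energy
  -- controls.
  have key : ∀ w : ℝ, -(r * u * s * w) ≤ B / 2 * (r * u ^ 2 + r * w ^ 2) := by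
    intro w
    have e1 : -(r * u * s * w) ≤ |s| * (r * (|u| * |w|)) := by
      have : |r * u * s * w| = |s| * (r * (|u| * |w|)) := by
        rw [abs_mul, abs_mul, abs_mul, abs_of_pos hr]; ring
      rw [← this]; exact neg_le_abs _
    have e2 : |u| * |w| ≤ (u ^ 2 + w ^ 2) / 2 := by
      nlinarith [sq_nonneg (|u| - |w|), sq_abs u, sq_abs w]
    have e3 : |s| * (r * (|u| * |w|)) ≤ B * (r * ((u ^ 2 + w ^ 2) / 2)) := by gcongr
    linarith
  have t2 := key A
  have t3 := key V
  have hQb : ρbar x ^ (γ - 2) ≤ Q := by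
    have e1 := rpow_eq_mul_sq hb0 γ
    have e2 : ρbar x ^ (γ - 2) = ρbar x ^ γ / ρbar x ^ 2 := by rw [e1]; field_simp
    rw [e2, hQ]
    have := hp.rho_lower x
    have := hp.rho_upper x
    gcongr
  have hQb0 : 0 < ρbar x ^ (γ - 2) := Real.rpow_pos_of_pos hb0 _
  have t4 : -(2 * (k * γ) * ρbar x ^ (γ - 2) * σ * (r * u - ρbar x * b)) ≤
      M * (r + r * u ^ 2) + 2 * M * B ^ 2 := by
    have e1 : |r * u - ρbar x * b| ≤ (r + r * u ^ 2) / 2 + B ^ 2 := by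
      have f1 : |r * u| ≤ (r + r * u ^ 2) / 2 := by
        rw [abs_mul, abs_of_pos hr]
        nlinarith [sq_nonneg (|u| - 1), sq_abs u]
      have f2 : |ρbar x * b| ≤ B ^ 2 := by
        rw [abs_mul, abs_of_pos hb0, sq]
        exact mul_le_mul (hp.rho_upper x) hb (abs_nonneg _) hB.le
      exact (abs_sub _ _).trans (by linarith)
    have e2 : |2 * (k * γ) * ρbar x ^ (γ - 2) * σ * (r * u - ρbar x * b)| ≤
        2 * (k * γ) * Q * B * ((r + r * u ^ 2) / 2 + B ^ 2) := by
      rw [abs_mul, abs_mul, abs_of_nonneg (by positivity : 0 ≤ 2 * (k * γ) * ρbar x ^ (γ - 2))]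
      gcongr
    have := neg_le_abs (2 * (k * γ) * ρbar x ^ (γ - 2) * σ * (r * u - ρbar x * b))
    rw [hM]
    linarith
  have t5 : -(2 * s * (k * (r ^ γ - ρbar x ^ γ))) ≤ 2 * B * k * r ^ γ + 2 * B * k * B ^ γ := by
    have f1 : ρbar x ^ γ ≤ B ^ γ := Real.rpow_le_rpow hb0.le (hp.rho_upper x) hγ0.le
    have f2 : 0 < r ^ γ := Real.rpow_pos_of_pos hr _
    have f3 : 0 < ρbar x ^ γ := Real.rpow_pos_of_pos hb0 _
    have e1 : |r ^ γ - ρbar x ^ γ| ≤ r ^ γ + B ^ γ := by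
      rw [abs_le]; constructor <;> linarith
    have e2 : |2 * s * (k * (r ^ γ - ρbar x ^ γ))| ≤ 2 * B * (k * (r ^ γ + B ^ γ)) := by
      rw [abs_mul, abs_mul, abs_mul, abs_of_pos hk, abs_of_pos (two_pos (α := ℝ))]
      gcongr
    have := neg_le_abs (2 * s * (k * (r ^ γ - ρbar x ^ γ)))
    linarith
  have f1 : m * (r * u ^ 2) ≤ m * (2 * (r * A ^ 2) + 2 * B ^ 2 * r) :=
    mul_le_mul_of_nonneg_left hru2 hm0
  have f2 : (2 * m * B ^ 2 + M) * r ≤ (2 * m * B ^ 2 + M) * ((1 + c) * (1 + E)) :=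
    mul_le_mul_of_nonneg_left hrE (by positivity)
  have f3 : 2 * B * k * r ^ γ ≤ 2 * B * k * (c * (1 + E)) :=
    mul_le_mul_of_nonneg_left h1 (by positivity)
  have f4 : 0 ≤ m * (r * V ^ 2) := by positivity
  have f5 : 0 ≤ N * (1 / 2 * r * A ^ 2 + 1 / 2 * r * V ^ 2) := by positivity
  have f6 : 0 ≤ (2 * (2 * m + B)) * (2 * E) := by positivity
  have f7 : 0 ≤ N * E := by positivity
  have f8 : (2 * m * B ^ 2 + M) * ((1 + c) * (1 + E)) + 2 * B * k * (c * (1 + E))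
      = N * (1 + E) := by rw [hN]; ring
  have f9 : 0 ≤ B * (r * A ^ 2) := by positivity
  have f10 : 0 ≤ B * (r * V ^ 2) := by positivity
  rw [hm] at f1 f2 f4 f6 f8 ⊢
  linarith

/-! ### The localized energy estimate -/

/-- Integrated form of a pointwise evolution equation over a strip. -/
theorem integral_sub_eq_integral_of_hasDerivAt {F F' : ℝ → ℝ → ℝ}
    (hF : Continuous fun z : ℝ × ℝ => F z.1 z.2) (hF' : Continuous fun z : ℝ × ℝ => F' z.1 z.2)
    (h : ∀ t x, 0 < t → HasDerivAt (fun s => F s x) (F' t x) t) {T : ℝ} (hT : 0 ≤ T) (a b : ℝ) :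
    (∫ x in a..b, F T x) - ∫ x in a..b, F 0 x = ∫ t in (0 : ℝ)..T, ∫ x in a..b, F' t x := by
  have h1 : ∀ x, F T x - F 0 x = ∫ t in (0 : ℝ)..T, F' t x := fun x => by
    rw [intervalIntegral.integral_eq_sub_of_hasDerivAt_of_le hT (f := fun s => F s x)]
    · exact (hF.comp (by fun_prop : Continuous fun s : ℝ => ((s, x) : ℝ × ℝ))).continuousOn
    · exact fun t ht => h t x ht.1
    · exact (hF'.comp (by fun_prop : Continuous fun s : ℝ => ((s, x) : ℝ × ℝ))).intervalIntegrable _ _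
  have hc : ∀ t, Continuous (F t) := fun t =>
    hF.comp (by fun_prop : Continuous fun x : ℝ => ((t, x) : ℝ × ℝ))
  rw [← intervalIntegral.integral_sub ((hc T).intervalIntegrable _ _)
    ((hc 0).intervalIntegrable _ _), MeasureTheory.intervalIntegral_intervalIntegral_swap]
  · simp_rw [h1]
  · have h2 : IntegrableOn (fun z : ℝ × ℝ => F' z.1 z.2) (uIcc 0 T ×ˢ uIcc a b) volume :=
      hF'.continuousOn.integrableOn_compact (isCompact_uIcc.prod isCompact_uIcc)
    exact h2.mono_set (prod_mono uIoc_subset_uIcc uIoc_subset_uIcc)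

/-- Squaring the positive part removes its corner, because the square is O(s²) at 0. Both cutoffs of
the proof, the cone and the bump, are differentiable for this reason. -/
theorem hasDerivAt_max_zero_sq (s : ℝ) : HasDerivAt (fun s : ℝ => max 0 s ^ 2) (2 * max 0 s) s := by
  rcases lt_trichotomy s 0 with h | h | h
  · rw [max_eq_left h.le, mul_zero]
    refine (hasDerivAt_const s (0 : ℝ)).congr_of_eventuallyEq ?_
    filter_upwards [Iio_mem_nhds h] with y hy
    rw [max_eq_left (le_of_lt hy)]; norm_num
  · subst h
    rw [max_self, mul_zero, hasDerivAt_iff_isLittleO]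
    simp only [max_self, sub_zero, smul_zero, ne_eq, OfNat.ofNat_ne_zero, not_false_eq_true,
      zero_pow]
    refine Asymptotics.IsBigO.trans_isLittleO (g := fun y : ℝ => y ^ 2) ?_ ?_
    · refine Asymptotics.IsBigO.of_bound 1 (Eventually.of_forall fun y => ?_)
      rw [one_mul, Real.norm_of_nonneg (by positivity), Real.norm_of_nonneg (by positivity)]
      rcases le_total y 0 with hy | hy
      · rw [max_eq_left hy]; nlinarith
      · rw [max_eq_right hy]
    · exact Asymptotics.isLittleO_pow_id (by norm_num)
  · rw [max_eq_right h.le]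
    have h1 : HasDerivAt (fun s : ℝ => s ^ 2) (2 * s) s := by simpa using hasDerivAt_pow 2 s
    refine h1.congr_of_eventuallyEq ?_
    filter_upwards [Ioi_mem_nhds h] with y hy
    rw [max_eq_right (le_of_lt hy)]

/-- A cone-shaped cutoff that shrinks with speed `U`. -/
noncomputable def coneCutoff (R U t x : ℝ) : ℝ := max 0 (1 - (√(1 + x ^ 2) + U * t) / R)

theorem coneCutoff_nonneg (R U t x : ℝ) : 0 ≤ coneCutoff R U t x := le_max_left _ _

theorem coneCutoff_le_one {R U t : ℝ} (hR : 0 < R) (hU : 0 ≤ U) (ht : 0 ≤ t) (x : ℝ) :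
    coneCutoff R U t x ≤ 1 := by
  refine max_le zero_le_one ?_
  have : 0 ≤ (√(1 + x ^ 2) + U * t) / R := by positivity
  linarith

theorem coneCutoff_eq_zero {R U t x : ℝ} (hR : 0 < R) (hU : 0 ≤ U) (ht : 0 ≤ t) (hx : R ≤ |x|) :
    coneCutoff R U t x = 0 := by
  refine max_eq_left ?_
  have h1 : |x| ≤ √(1 + x ^ 2) := Real.abs_le_sqrt (by linarith)
  have h2 : 1 ≤ (√(1 + x ^ 2) + U * t) / R := by
    rw [le_div_iff₀ hR]
    have : 0 ≤ U * t := by positivity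
    linarith
  linarith

theorem half_le_coneCutoff {R U t T x n : ℝ} (hR : 0 < R) (hU : 0 ≤ U) (ht : t ≤ T)
    (hx : |x| ≤ n) (h : 2 * (1 + n + U * T) ≤ R) : 1 / 2 ≤ coneCutoff R U t x := by
  refine le_max_of_le_right ?_
  have h1 : √(1 + x ^ 2) ≤ 1 + |x| := by
    rw [Real.sqrt_le_left (by positivity)]
    nlinarith [abs_nonneg x, sq_abs x]
  have h2 : (√(1 + x ^ 2) + U * t) / R ≤ 1 / 2 := by
    rw [div_le_iff₀ hR]
    have : U * t ≤ U * T := by gcongr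
    linarith
  linarith

theorem continuous_coneCutoff (R U : ℝ) : Continuous fun z : ℝ × ℝ => coneCutoff R U z.1 z.2 := by
  unfold coneCutoff; fun_prop

/-- The slope of `coneCutoff` in `x` on its support. -/
noncomputable def coneSlope (R x : ℝ) : ℝ := -(x / √(1 + x ^ 2)) / R

theorem abs_coneSlope_le {R : ℝ} (hR : 0 < R) (x : ℝ) : |coneSlope R x| ≤ 1 / R := by
  have h1 : |x| ≤ √(1 + x ^ 2) := Real.abs_le_sqrt (by linarith)
  have h2 : 0 < √(1 + x ^ 2) := by positivity
  rw [coneSlope, abs_div, abs_neg, abs_div, abs_of_pos h2, abs_of_pos hR]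
  gcongr
  rwa [div_le_one h2]

theorem continuous_coneSlope (R : ℝ) : Continuous (coneSlope R) := by
  unfold coneSlope
  have : ∀ x : ℝ, √(1 + x ^ 2) ≠ 0 := fun x => by positivity
  fun_prop (disch := assumption)

theorem hasDerivAt_coneCutoff_sq_x (R U t x : ℝ) :
    HasDerivAt (fun y => coneCutoff R U t y ^ 2) (2 * coneCutoff R U t x * coneSlope R x) x := by
  have h0 : (1 : ℝ) + x ^ 2 ≠ 0 := by positivity
  have h1 : HasDerivAt (fun y : ℝ => 1 - (√(1 + y ^ 2) + U * t) / R) (coneSlope R x) x := by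
    have := (((((hasDerivAt_pow 2 x).const_add 1).sqrt h0).add_const (U * t)).div_const R).const_sub 1
    refine this.congr_deriv ?_
    unfold coneSlope
    have : √(1 + x ^ 2) ≠ 0 := by positivity
    field_simp
    norm_num
  exact (hasDerivAt_max_zero_sq _).comp x h1

theorem hasDerivAt_coneCutoff_sq_t (R U t x : ℝ) :
    HasDerivAt (fun s => coneCutoff R U s x ^ 2) (2 * coneCutoff R U t x * (-(U / R))) t := by
  have h1 : HasDerivAt (fun s : ℝ => 1 - (√(1 + x ^ 2) + U * s) / R) (-(U / R)) t := by
    have := ((((hasDerivAt_id t).const_mul U).const_add (√(1 + x ^ 2))).div_const R).const_sub 1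
    simpa using this
  exact (hasDerivAt_max_zero_sq _).comp t h1

/-- The pointwise inequality behind the energy estimate. -/
theorem energy_remainder_le {γ ε r u rx ux rb ub rb' ub' K C U y e g R A : ℝ} (hγ : 1 < γ)
    (hr : 0 < r) (hb : 0 < rb) (hε : 0 < ε) (hR : 0 < R) (he0 : 0 ≤ e) (he1 : e ≤ 1)
    (hy0 : 0 ≤ y) (hy1 : y ≤ 1) (hg : |g| ≤ 1 / R) (hu : |u| ≤ U) (hA : |u - ub| ≤ A)
    (hC : 0 ≤ C)
    (hs : energySource γ ε r u rx ux rb ub rb' ub' ≤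
      -(ε / 2 * ux ^ 2) - ε * (gasKappa γ * γ) * (r ^ (γ - 3) * rx ^ 2)
        + K * energyDensity γ ε r u rx rb ub + C) :
    energyDensity γ ε r u rx rb ub * (-K * (e * y ^ 2) + e * (2 * y * (-(U / R))))
      - e * (2 * y * g) * energyFlux γ ε r u rx ux rb ub
      + e * y ^ 2 * energySource γ ε r u rx ux rb ub rb' ub' ≤
    -(e * y ^ 2 * (ε / 4 * ux ^ 2 + ε * (gasKappa γ * γ) * (r ^ (γ - 3) * rx ^ 2)))
      + C + 2 / R * |pressureFlux γ r u rb ub| + 4 * ε * A ^ 2 / R ^ 2 := by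
  have hE := relInternalEnergy_nonneg hγ hr hb
  have h1 : e * y ^ 2 * energySource γ ε r u rx ux rb ub rb' ub' ≤ e * y ^ 2 *
      (-(ε / 2 * ux ^ 2) - ε * (gasKappa γ * γ) * (r ^ (γ - 3) * rx ^ 2)
        + K * energyDensity γ ε r u rx rb ub + C) :=
    mul_le_mul_of_nonneg_left hs (by positivity)
  have h2 : e * y ^ 2 * C ≤ C := by
    have : e * y ^ 2 ≤ 1 := mul_le_one₀ he1 (by positivity) (pow_le_one₀ hy0 hy1)
    nlinarith
  have hgu : |g * u| ≤ U / R := by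
    rw [abs_mul]
    calc |g| * |u| ≤ 1 / R * U := mul_le_mul hg hu (abs_nonneg _) (by positivity)
      _ = U / R := by ring
  -- The convective flux is at most |u| ≤ U times the energy density, so the loss caused by a cone
  -- shrinking with speed U absorbs it.
  have h3 : e * (2 * y * g) * (1 / 2 * (r * u) * ((u - ub) ^ 2 + (u + ε * rx / r ^ 2 - ub) ^ 2))
      ≤ energyDensity γ ε r u rx rb ub * (e * (2 * y * (U / R))) := by
    unfold energyDensity
    set W := (u - ub) ^ 2 + (u + ε * rx / r ^ 2 - ub) ^ 2 with hW
    have hW0 : 0 ≤ W := by positivity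
    have e1 : e * (2 * y * g) * (1 / 2 * (r * u) * W) = (g * u) * (e * y * r * W) := by ring
    have e2 : (g * u) * (e * y * r * W) ≤ U / R * (e * y * r * W) :=
      mul_le_mul_of_nonneg_right ((le_abs_self _).trans hgu) (by positivity)
    have hUR : 0 ≤ U / R := (abs_nonneg _).trans hgu
    have e3 : 0 ≤ 2 * relInternalEnergy γ r rb * (e * (2 * y * (U / R))) := by positivity
    rw [e1]
    refine e2.trans ?_
    rw [hW]
    linarith
  have h4 : e * (2 * y * g) * pressureFlux γ r u rb ub ≤ 2 / R * |pressureFlux γ r u rb ub| := by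
    have e1 : |e * (2 * y * g)| ≤ 2 / R := by
      rw [abs_mul, abs_mul, abs_mul, abs_of_nonneg he0, abs_of_nonneg hy0, abs_two]
      have : e * (2 * y * |g|) ≤ 1 * (2 * 1 * (1 / R)) := by gcongr
      calc _ ≤ _ := this
        _ = 2 / R := by ring
    calc _ ≤ |e * (2 * y * g) * pressureFlux γ r u rb ub| := le_abs_self _
      _ = |e * (2 * y * g)| * |pressureFlux γ r u rb ub| := abs_mul _ _
      _ ≤ _ := by gcongr
  -- Young's inequality spends half of the dissipation ε/2 · u_x² on the viscous flux; this is why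
  -- ε/4 remains.
  have h5 : -(e * (2 * y * g) * (ε * ((u - ub) * ux))) ≤
      e * y ^ 2 * (ε / 4 * ux ^ 2) + 4 * ε * A ^ 2 / R ^ 2 := by
    have hg2 : g ^ 2 ≤ 1 / R ^ 2 := by
      have := sq_le_sq' (by linarith [(abs_le.1 hg).1]) (abs_le.1 hg).2
      rwa [div_pow, one_pow] at this
    have hA2 : (u - ub) ^ 2 ≤ A ^ 2 := sq_le_sq' (by linarith [(abs_le.1 hA).1]) (abs_le.1 hA).2
    have e1 : -(e * (2 * y * g) * (ε * ((u - ub) * ux))) ≤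
        e * ε * (1 / 4 * (y ^ 2 * ux ^ 2) + 4 * (g ^ 2 * (u - ub) ^ 2)) := by
      have := mul_nonneg (mul_nonneg he0 hε.le) (sq_nonneg (1 / 2 * (y * ux) + 2 * (g * (u - ub))))
      linarith
    have e2 : e * ε * (4 * (g ^ 2 * (u - ub) ^ 2)) ≤ 1 * ε * (4 * (1 / R ^ 2 * A ^ 2)) := by
      gcongr
    have e3 : 1 * ε * (4 * (1 / R ^ 2 * A ^ 2)) = 4 * ε * A ^ 2 / R ^ 2 := by ring
    linarith
  have h6 : e * (2 * y * g) * energyFlux γ ε r u rx ux rb ub =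
      -(e * (2 * y * g) * (1 / 2 * (r * u) * ((u - ub) ^ 2 + (u + ε * rx / r ^ 2 - ub) ^ 2)))
      - e * (2 * y * g) * pressureFlux γ r u rb ub + e * (2 * y * g) * (ε * ((u - ub) * ux)) := by
    unfold energyFlux; ring
  rw [h6]
  generalize energyDensity γ ε r u rx rb ub = G at *
  linarith

theorem intervalIntegral_indicator_const_le {R L C : ℝ} (hR : 0 ≤ R) (hL : 0 ≤ L) (hC : 0 ≤ C) :
    ∫ x in -R..R, (Icc (-L) L).indicator (fun _ => C) x ≤ 2 * L * C := by
  rw [intervalIntegral.integral_of_le (by linarith)]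
  have hi : Integrable ((Icc (-L) L).indicator fun _ => C) :=
    (integrable_indicator_iff measurableSet_Icc).2 (integrableOn_const (by simp))
  refine (setIntegral_le_integral hi (Eventually.of_forall fun x => ?_)).trans ?_
  · exact indicator_nonneg (fun _ _ => hC) x
  · rw [integral_indicator_const _ measurableSet_Icc]
    simp only [Measure.real, Real.volume_Icc, smul_eq_mul]
    rw [ENNReal.toReal_ofReal (by linarith)]
    linarith

theorem intervalIntegrable_indicator_const (R L C : ℝ) :
    IntervalIntegrable ((Icc (-L) L).indicator fun _ => C) volume (-R) R :=
  ((integrable_indicator_iff measurableSet_Icc).2 (integrableOn_const (by simp))).intervalIntegrable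

theorem tendsto_pressureFlux_zero {γ : ℝ} {rb ub : ℝ} (hb : 0 < rb) {δ : ℝ} (hδ : 0 < δ) :
    ∃ η > 0, ∀ r u, |r - rb| < η → |u - ub| < η → |pressureFlux γ r u rb ub| < δ := by
  have hc : ContinuousAt (fun z : ℝ × ℝ => pressureFlux γ z.1 z.2 rb ub) (rb, ub) := by
    have h1 : ∀ p : ℝ, ContinuousAt (fun z : ℝ × ℝ => z.1 ^ p) (rb, ub) := fun p =>
      continuousAt_fst.rpow_const (Or.inl hb.ne')
    unfold pressureFlux
    exact (((((h1 _).sub continuousAt_const).const_mul _).const_mul 2).mul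
      (continuousAt_fst.mul continuousAt_snd)).sub
      ((((h1 γ).sub continuousAt_const).const_mul _).const_mul (2 * ub))
  obtain ⟨η, hη, h⟩ := Metric.continuousAt_iff.1 hc δ hδ
  refine ⟨η, hη, fun r u h1 h2 => ?_⟩
  have := h (x := (r, u)) (by
    rw [Prod.dist_eq]
    exact max_lt h1 h2)
  simpa [pressureFlux, Real.dist_eq] using this

/-- M and X depend on the flow, hence on ε. This is harmless: the cutoff contributes a factor 2/R,
which makes the part with M small once R is large, while the part with δ, integrated over length 2R,
costs 4δ for every R. -/
theorem ViscousFlow.pressureFlux_decay {γ ε ρl ρr ul ur : ℝ} {r u rx rxx ux uxx : ℝ → ℝ → ℝ}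
    (h : ViscousFlow γ ε ρl ρr ul ur r u rx rxx ux uxx) (hρl : 0 < ρl) (hρr : 0 < ρr)
    {ρbar ubar ρbar' ubar' : ℝ → ℝ} {L a B : ℝ} (hp : ProfileBounds ρbar ubar ρbar' ubar' L a B)
    (hl : ∀ x, x ≤ -L → ρbar x = ρl ∧ ubar x = ul) (hr : ∀ x, L ≤ x → ρbar x = ρr ∧ ubar x = ur)
    (T : ℝ) {δ : ℝ} (hδ : 0 < δ) :
    ∃ M X : ℝ, 0 ≤ M ∧ 0 ≤ X ∧ ∀ t ∈ Icc 0 T, ∀ x,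
      |pressureFlux γ (r t x) (u t x) (ρbar x) (ubar x)| ≤ δ + (Icc (-X) X).indicator (fun _ => M) x := by
  have hR : ∀ δ > 0, ∃ X : ℝ, ∀ t ∈ Icc 0 T, ∀ x, X ≤ x →
      |pressureFlux γ (r t x) (u t x) (ρbar x) (ubar x)| < δ := by
    intro δ hδ
    obtain ⟨η, hη, h1⟩ := tendsto_pressureFlux_zero (γ := γ) (ub := ur) hρr hδ
    obtain ⟨X, hX⟩ := h.right T η hη
    refine ⟨max X L, fun t ht x hx => ?_⟩
    rw [(hr x ((le_max_right _ _).trans hx)).1, (hr x ((le_max_right _ _).trans hx)).2]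
    have := hX t ht x ((le_max_left _ _).trans hx)
    exact h1 _ _ this.1 this.2
  have hL : ∀ δ > 0, ∃ X : ℝ, ∀ t ∈ Icc 0 T, ∀ x, x ≤ X →
      |pressureFlux γ (r t x) (u t x) (ρbar x) (ubar x)| < δ := by
    intro δ hδ
    obtain ⟨η, hη, h1⟩ := tendsto_pressureFlux_zero (γ := γ) (ub := ul) hρl hδ
    obtain ⟨X, hX⟩ := h.left T η hη
    refine ⟨min X (-L), fun t ht x hx => ?_⟩
    rw [(hl x (hx.trans (min_le_right _ _))).1, (hl x (hx.trans (min_le_right _ _))).2]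
    have := hX t ht x (hx.trans (min_le_left _ _))
    exact h1 _ _ this.1 this.2
  have hρc : Continuous ρbar := continuous_iff_continuousAt.2 fun x => (hp.der_rho x).continuousAt
  have huc : Continuous ubar := continuous_iff_continuousAt.2 fun x => (hp.der_u x).continuousAt
  have hc : Continuous fun z : ℝ × ℝ =>
      pressureFlux γ (r z.1 z.2) (u z.1 z.2) (ρbar z.2) (ubar z.2) :=
    continuous_pressureFlux h.cont_r h.cont_u (hρc.comp continuous_snd) (huc.comp continuous_snd)
      (fun z => h.pos _ _) (fun z => hp.a_pos.trans_le (hp.rho_lower _))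
  obtain ⟨M, hM⟩ := bounded_of_continuous_of_ends (a := 0) (b := 0) (T := T) hc
    (by simpa using hR 1 one_pos) (by simpa using hL 1 one_pos)
  obtain ⟨X, hX⟩ := hR δ hδ
  obtain ⟨Y, hY⟩ := hL δ hδ
  refine ⟨max M 0, |X| + |Y|, le_max_right _ _, by positivity, fun t ht x => ?_⟩
  by_cases hx : x ∈ Icc (-(|X| + |Y|)) (|X| + |Y|)
  · rw [indicator_of_mem hx]
    exact (hM t ht x).trans (by linarith [le_max_left M 0])
  · rw [indicator_of_notMem hx, add_zero]
    rcases not_and_or.1 hx with hx | hx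
    · exact (hY t ht x (by linarith [neg_abs_le Y, abs_nonneg X])).le
    · exact (hX t ht x (by linarith [le_abs_self X, abs_nonneg Y])).le

theorem continuous_slice {f : ℝ → ℝ → ℝ} (hf : Continuous fun z : ℝ × ℝ => f z.1 z.2) (t : ℝ) :
    Continuous (f t) :=
  hf.comp (by fun_prop : Continuous fun x : ℝ => ((t, x) : ℝ × ℝ))

theorem continuous_integral_slice {f : ℝ → ℝ → ℝ} (hf : Continuous fun z : ℝ × ℝ => f z.1 z.2)
    (a b : ℝ) : Continuous fun t => ∫ x in a..b, f t x :=
  intervalIntegral.continuous_parametric_intervalIntegral_of_continuous' hf a b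

set_option maxHeartbeats 1000000 in
/-- The localized energy estimate, uniform in the viscosity. -/
theorem ViscousFlow.energy_estimate {γ ε ρl ρr ul ur : ℝ} {r u rx rxx ux uxx : ℝ → ℝ → ℝ}
    (h : ViscousFlow γ ε ρl ρr ul ur r u rx rxx ux uxx) (hγ : 1 < γ) (hε : 0 < ε)
    (hρl : 0 < ρl) (hρr : 0 < ρr)
    {ρbar ubar ρbar' ubar' : ℝ → ℝ} {L a B : ℝ} (hp : ProfileBounds ρbar ubar ρbar' ubar' L a B)
    (hl : ∀ x, x ≤ -L → ρbar x = ρl ∧ ubar x = ul) (hr : ∀ x, L ≤ x → ρbar x = ρr ∧ ubar x = ur)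
    {K C : ℝ} (hK : 0 ≤ K) (hC : 0 ≤ C)
    (hs : ∀ x r u rx ux : ℝ, 0 < r →
      energySource γ ε r u rx ux (ρbar x) (ubar x) (ρbar' x) (ubar' x) ≤
        -(ε / 2 * ux ^ 2) - ε * (gasKappa γ * γ) * (r ^ (γ - 3) * rx ^ 2)
        + K * energyDensity γ ε r u rx (ρbar x) (ubar x) + (Icc (-L) L).indicator (fun _ => C) x)
    {D : ℝ} (hD : ∀ R, 0 < R →
      ∫ x in -R..R, energyDensity γ ε (r 0 x) (u 0 x) (rx 0 x) (ρbar x) (ubar x) ≤ D)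
    {T τ n : ℝ} (hτ : τ ∈ Icc 0 T) (hn : 0 ≤ n) :
    Real.exp (-(K * T)) / 4 *
      ((∫ x in -n..n, energyDensity γ ε (r τ x) (u τ x) (rx τ x) (ρbar x) (ubar x)) +
        ∫ t in (0 : ℝ)..τ, ∫ x in -n..n,
          (ε / 4 * ux t x ^ 2 + ε * (gasKappa γ * γ) * (r t x ^ (γ - 3) * rx t x ^ 2)))
      ≤ D + 2 * L * C * T + 1 := by
  have hT : 0 ≤ T := hτ.1.trans hτ.2
  have hρc : Continuous ρbar := continuous_iff_continuousAt.2 fun x => (hp.der_rho x).continuousAt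
  have huc : Continuous ubar := continuous_iff_continuousAt.2 fun x => (hp.der_u x).continuousAt
  have hb0 : ∀ x, 0 < ρbar x := fun x => hp.a_pos.trans_le (hp.rho_lower x)
  have cρ : Continuous fun z : ℝ × ℝ => ρbar z.2 := hρc.comp continuous_snd
  have cu : Continuous fun z : ℝ × ℝ => ubar z.2 := huc.comp continuous_snd
  have cρ' : Continuous fun z : ℝ × ℝ => ρbar' z.2 := hp.cont_rho'.comp continuous_snd
  have cu' : Continuous fun z : ℝ × ℝ => ubar' z.2 := hp.cont_u'.comp continuous_snd
  set G : ℝ → ℝ → ℝ := fun t x => energyDensity γ ε (r t x) (u t x) (rx t x) (ρbar x) (ubar x)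
    with hGd
  set Φ : ℝ → ℝ → ℝ := fun t x =>
    energyFlux γ ε (r t x) (u t x) (rx t x) (ux t x) (ρbar x) (ubar x) with hΦd
  set Φ' : ℝ → ℝ → ℝ := fun t x => energyFluxDeriv γ ε (r t x) (u t x) (rx t x) (rxx t x) (ux t x)
    (uxx t x) (ρbar x) (ubar x) (ρbar' x) (ubar' x) with hΦ'd
  set S : ℝ → ℝ → ℝ := fun t x => energySource γ ε (r t x) (u t x) (rx t x) (ux t x)
    (ρbar x) (ubar x) (ρbar' x) (ubar' x) with hSd
  set Z : ℝ → ℝ → ℝ := fun t x =>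
    ε / 4 * ux t x ^ 2 + ε * (gasKappa γ * γ) * (r t x ^ (γ - 3) * rx t x ^ 2) with hZd
  have cG : Continuous fun z : ℝ × ℝ => G z.1 z.2 :=
    continuous_energyDensity h.cont_r h.cont_u h.cont_rx cρ cu (fun z => h.pos _ _) (fun z => hb0 _)
  have cΦ : Continuous fun z : ℝ × ℝ => Φ z.1 z.2 :=
    continuous_energyFlux h.cont_r h.cont_u h.cont_rx h.cont_ux cρ cu (fun z => h.pos _ _)
      (fun z => hb0 _)
  have cΦ' : Continuous fun z : ℝ × ℝ => Φ' z.1 z.2 :=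
    continuous_energyFluxDeriv h.cont_r h.cont_u h.cont_rx h.cont_rxx h.cont_ux h.cont_uxx cρ cu
      cρ' cu' (fun z => h.pos _ _) (fun z => hb0 _)
  have cS : Continuous fun z : ℝ × ℝ => S z.1 z.2 :=
    continuous_energySource h.cont_r h.cont_u h.cont_rx h.cont_ux cρ cu cρ' cu'
      (fun z => h.pos _ _) (fun z => hb0 _)
  have cZ : Continuous fun z : ℝ × ℝ => Z z.1 z.2 := by
    have h1 := h.cont_r.rpow_const (p := γ - 3) fun z => Or.inl (h.pos z.1 z.2).ne'
    have h2 := h.cont_ux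
    have h3 := h.cont_rx
    exact ((h2.pow 2).const_mul _).add ((h1.mul (h3.pow 2)).const_mul _)
  have hk := gasKappa_pos hγ
  have hγ0 : 0 < γ := by linarith
  have hZ0 : ∀ t x, 0 ≤ Z t x := fun t x => by
    have := Real.rpow_nonneg (h.pos t x).le (γ - 3)
    positivity
  have hG0 : ∀ t x, 0 ≤ G t x := fun t x => energyDensity_nonneg hγ (h.pos t x) (hb0 x)
  -- bounds on [0, T]
  obtain ⟨U₀, hU₀⟩ := h.bound T
  set U := |U₀| with hU
  have hU' : ∀ t ∈ Icc 0 T, ∀ x, |u t x| ≤ U := fun t ht x =>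
    ((hU₀ t ht x).2).trans (le_abs_self _)
  set A := U + B with hA
  have hA' : ∀ t ∈ Icc 0 T, ∀ x, |u t x - ubar x| ≤ A := fun t ht x =>
    (abs_sub _ _).trans (add_le_add (hU' t ht x) (hp.u_bound x))
  -- With this δ the integrated error 4δT is at most 1/2, whatever the radius.
  obtain ⟨M, X, hM, hX, hF⟩ := h.pressureFlux_decay hρl hρr hp hl hr T
    (δ := 1 / (8 * (T + 1))) (by positivity)
  set δ := 1 / (8 * (T + 1)) with hδ
  -- the radius
  set R : ℝ := 2 * (1 + n + U * T) + 1 + 2 * (T * (4 * X * M + 8 * ε * A ^ 2)) with hR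
  have hU0 : 0 ≤ U := abs_nonneg _
  have hR1 : 1 ≤ R := by
    have h1 := mul_nonneg hU0 hT
    have h2 := mul_nonneg hT (by positivity : 0 ≤ 4 * X * M + 8 * ε * A ^ 2)
    linarith
  have hR0 : 0 < R := by linarith
  have hRn : 2 * (1 + n + U * T) ≤ R := by
    have := mul_nonneg hT (by positivity : 0 ≤ 4 * X * M + 8 * ε * A ^ 2)
    linarith
  have hnR : n ≤ R := by linarith [mul_nonneg hU0 hT]
  set y : ℝ → ℝ → ℝ := coneCutoff R U with hy
  have cy : Continuous fun z : ℝ × ℝ => y z.1 z.2 := continuous_coneCutoff R U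
  set g : ℝ → ℝ := coneSlope R with hg
  have cg : Continuous fun z : ℝ × ℝ => g z.2 := (continuous_coneSlope R).comp continuous_snd
  -- Integrating factor in place of Gronwall's lemma: its derivative -K e cancels the term K times
  -- the energy from the source.
  set e : ℝ → ℝ := fun t => Real.exp (-(K * t)) with he
  have ce : Continuous e := by rw [he]; fun_prop
  have ce' : Continuous fun z : ℝ × ℝ => e z.1 := ce.comp continuous_fst
  have hder : ∀ t, HasDerivAt e (-K * e t) t := fun t => by
    have h1 : HasDerivAt (fun s : ℝ => -(K * s)) (-(K * 1)) t := ((hasDerivAt_id t).const_mul K).neg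
    refine h1.exp.congr_deriv ?_
    simp only [he]; ring
  -- the evolution of the weighted energy
  set F' : ℝ → ℝ → ℝ := fun t x =>
    (Φ' t x + S t x) * (e t * y t x ^ 2) +
      G t x * ((-K * e t) * y t x ^ 2 + e t * (2 * y t x * (-(U / R)))) with hF'd
  have hFder : ∀ t x, 0 < t → HasDerivAt (fun s => G s x * (e s * y s x ^ 2)) (F' t x) t := by
    intro t x ht
    exact (h.hasDerivAt_energyDensity hγ (ubar x) (ρbar' x) (ubar' x) (hb0 x) x ht).mul
      ((hder t).mul (hasDerivAt_coneCutoff_sq_t R U t x))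
  have cF' : Continuous fun z : ℝ × ℝ => F' z.1 z.2 := by
    exact ((cΦ'.add cS).mul (ce'.mul (cy.pow 2))).add
      (cG.mul (((continuous_const.mul ce').mul (cy.pow 2)).add
        (ce'.mul ((continuous_const.mul cy).mul continuous_const))))
  have hint := integral_sub_eq_integral_of_hasDerivAt (F := fun t x => G t x * (e t * y t x ^ 2))
    (cG.mul (ce'.mul (cy.pow 2))) cF' hFder hτ.1 (-R) R
  -- the flux integrates to zero
  set Ψ' : ℝ → ℝ → ℝ := fun t x =>
    (e t * (2 * y t x * g x)) * Φ t x + (e t * y t x ^ 2) * Φ' t x with hΨ'd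
  have cΨ' : Continuous fun z : ℝ × ℝ => Ψ' z.1 z.2 :=
    ((ce'.mul ((continuous_const.mul cy).mul cg)).mul cΦ).add ((ce'.mul (cy.pow 2)).mul cΦ')
  have hΨ : ∀ t, 0 ≤ t → ∫ x in -R..R, Ψ' t x = 0 := by
    intro t ht
    have h1 : ∀ x, HasDerivAt (fun x => (e t * y t x ^ 2) * Φ t x) (Ψ' t x) x := fun x =>
      ((hasDerivAt_coneCutoff_sq_x R U t x).const_mul (e t)).mul
        (hasDerivAt_energyFlux hγ (h.pos t x) (hb0 x) (h.r_x t x) (h.rx_x t x) (h.u_x t x)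
          (h.ux_x t x) (hp.der_rho x) (hp.der_u x))
    rw [intervalIntegral.integral_eq_sub_of_hasDerivAt (fun x _ => h1 x)
      ((continuous_slice cΨ' t).intervalIntegrable _ _)]
    have h2 : y t R = 0 := coneCutoff_eq_zero hR0 hU0 ht (le_abs_self R)
    have h3 : y t (-R) = 0 := coneCutoff_eq_zero hR0 hU0 ht (by rw [abs_neg]; exact le_abs_self R)
    rw [h2, h3]; ring
  -- pointwise bound
  set H : ℝ → ℝ := fun x => (Icc (-L) L).indicator (fun _ => C) x
    + 2 / R * (δ + (Icc (-X) X).indicator (fun _ => M) x) + 4 * ε * A ^ 2 / R ^ 2 with hHd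
  have he1 : ∀ t, 0 ≤ t → e t ≤ 1 := fun t ht => by
    rw [he]; exact Real.exp_le_one_iff.2 (by have := mul_nonneg hK ht; linarith)
  have hpt : ∀ t ∈ Icc 0 τ, ∀ x, F' t x ≤ Ψ' t x - e t * y t x ^ 2 * Z t x + H x := by
    intro t ht x
    have htT : t ∈ Icc 0 T := ⟨ht.1, ht.2.trans hτ.2⟩
    have h1 : G t x * (-K * (e t * y t x ^ 2) + e t * (2 * y t x * (-(U / R))))
        - e t * (2 * y t x * g x) * Φ t x + e t * y t x ^ 2 * S t x ≤
        -(e t * y t x ^ 2 * Z t x) + (Icc (-L) L).indicator (fun _ => C) x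
          + 2 / R * |pressureFlux γ (r t x) (u t x) (ρbar x) (ubar x)| + 4 * ε * A ^ 2 / R ^ 2 :=
      energy_remainder_le (U := U) (e := e t) (y := y t x) (g := g x) (R := R) (A := A)
      hγ (h.pos t x) (hb0 x) hε hR0 (Real.exp_pos _).le
      (he1 t ht.1) (coneCutoff_nonneg R U t x) (coneCutoff_le_one hR0 hU0 ht.1 x)
      (abs_coneSlope_le hR0 x) (hU' t htT x) (hA' t htT x)
      (C := (Icc (-L) L).indicator (fun _ => C) x)
      (indicator_nonneg (fun _ _ => hC) x) (hs x (r t x) (u t x) (rx t x) (ux t x) (h.pos t x))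
    have h2 := mul_le_mul_of_nonneg_left (hF t htT x) (by positivity : 0 ≤ 2 / R)
    have e1 : F' t x = Ψ' t x + (G t x * (-K * (e t * y t x ^ 2) + e t * (2 * y t x * (-(U / R))))
      - e t * (2 * y t x * g x) * Φ t x + e t * y t x ^ 2 * S t x) := by
      rw [hF'd, hΨ'd]; ring
    rw [e1]
    simp only [hHd]
    linarith
  have hHi : IntervalIntegrable H volume (-R) R :=
    ((intervalIntegrable_indicator_const R L C).add
      ((intervalIntegrable_const.add (intervalIntegrable_indicator_const R X M)).const_mul _)).add
      intervalIntegrable_const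
  have hHint : T * ∫ x in -R..R, H x ≤ 2 * L * C * T + 1 := by
    have e1 : ∫ x in -R..R, H x = (∫ x in -R..R, (Icc (-L) L).indicator (fun _ => C) x)
        + 2 / R * (2 * R * δ + ∫ x in -R..R, (Icc (-X) X).indicator (fun _ => M) x)
        + 2 * R * (4 * ε * A ^ 2 / R ^ 2) := by
      simp only [hHd]
      rw [intervalIntegral.integral_add, intervalIntegral.integral_add,
        intervalIntegral.integral_const_mul, intervalIntegral.integral_add,
        intervalIntegral.integral_const, intervalIntegral.integral_const, smul_eq_mul, smul_eq_mul]
      · ring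
      · exact intervalIntegrable_const
      · exact intervalIntegrable_indicator_const R X M
      · exact intervalIntegrable_indicator_const R L C
      · exact (intervalIntegrable_const.add (intervalIntegrable_indicator_const R X M)).const_mul _
      · exact (intervalIntegrable_indicator_const R L C).add
          ((intervalIntegrable_const.add (intervalIntegrable_indicator_const R X M)).const_mul _)
      · exact intervalIntegrable_const
    have e2 := intervalIntegral_indicator_const_le hR0.le hp.L_pos.le hC
    have e3 := intervalIntegral_indicator_const_le hR0.le hX hM
    have e4 : ∫ x in -R..R, H x ≤ 2 * L * C + 2 / R * (2 * R * δ + 2 * X * M)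
        + 2 * R * (4 * ε * A ^ 2 / R ^ 2) := by
      rw [e1]; gcongr
    have e5 : 2 * L * C + 2 / R * (2 * R * δ + 2 * X * M) + 2 * R * (4 * ε * A ^ 2 / R ^ 2)
        = 2 * L * C + 4 * δ + (4 * X * M + 8 * ε * A ^ 2) / R := by
      field_simp; ring
    have e6 : T * (4 * δ) ≤ 1 / 2 := by
      rw [hδ]; field_simp; linarith
    -- The last summand of R is made for this: R ≥ 2T(4XM + 8εA²). So R depends on ε but the final
    -- bound does not.
    have e7 : T * ((4 * X * M + 8 * ε * A ^ 2) / R) ≤ 1 / 2 := by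
      rw [← mul_div_assoc, div_le_iff₀ hR0]
      nlinarith [mul_nonneg hU0 hT]
    have e8 := mul_le_mul_of_nonneg_left (e4.trans e5.le) hT
    linarith
  -- integrate
  set W : ℝ → ℝ → ℝ := fun t x => e t * y t x ^ 2 * Z t x with hWd
  have cW : Continuous fun z : ℝ × ℝ => W z.1 z.2 := (ce'.mul (cy.pow 2)).mul cZ
  have hin : ∀ t ∈ Icc 0 τ, ∫ x in -R..R, F' t x ≤ -(∫ x in -R..R, W t x) + ∫ x in -R..R, H x := by
    intro t ht
    have cPW : Continuous fun x => Ψ' t x - W t x := (continuous_slice cΨ' t).sub (continuous_slice cW t)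
    have h1 : ∫ x in -R..R, F' t x ≤ ∫ x in -R..R, (Ψ' t x - W t x + H x) := by
      refine intervalIntegral.integral_mono_on (by linarith)
        ((continuous_slice cF' t).intervalIntegrable _ _)
        ((cPW.intervalIntegrable _ _).add hHi)
        fun x _ => hpt t ht x
    rw [intervalIntegral.integral_add
        (cPW.intervalIntegrable _ _) hHi,
      intervalIntegral.integral_sub ((continuous_slice cΨ' t).intervalIntegrable _ _)
        ((continuous_slice cW t).intervalIntegrable _ _), hΨ t ht.1] at h1
    linarith
  have hout : ∫ t in (0 : ℝ)..τ, ∫ x in -R..R, F' t x ≤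
      -(∫ t in (0 : ℝ)..τ, ∫ x in -R..R, W t x) + τ * ∫ x in -R..R, H x := by
    have cWi : Continuous fun t => -∫ x in -R..R, W t x := (continuous_integral_slice cW (-R) R).neg
    have h1 : ∫ t in (0 : ℝ)..τ, ∫ x in -R..R, F' t x ≤
        ∫ t in (0 : ℝ)..τ, (-(∫ x in -R..R, W t x) + ∫ x in -R..R, H x) :=
      intervalIntegral.integral_mono_on hτ.1
        ((continuous_integral_slice cF' (-R) R).intervalIntegrable _ _)
        ((cWi.add continuous_const).intervalIntegrable _ _) hin
    rw [intervalIntegral.integral_add (cWi.intervalIntegrable _ _) intervalIntegrable_const,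
      intervalIntegral.integral_neg, intervalIntegral.integral_const, smul_eq_mul, sub_zero] at h1
    exact h1
  have hH0 : 0 ≤ ∫ x in -R..R, H x := by
    refine intervalIntegral.integral_nonneg (by linarith) fun x _ => ?_
    have h1 : 0 ≤ (Icc (-L) L).indicator (fun _ => C) x := indicator_nonneg (fun _ _ => hC) x
    have h2 : 0 ≤ (Icc (-X) X).indicator (fun _ => M) x := indicator_nonneg (fun _ _ => hM) x
    have h3 : 0 ≤ δ := by positivity
    simp only [hHd]
    positivity
  have hH1 : τ * ∫ x in -R..R, H x ≤ 2 * L * C * T + 1 :=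
    (mul_le_mul_of_nonneg_right hτ.2 hH0).trans hHint
  have cGw : ∀ t, Continuous fun x => G t x * (e t * y t x ^ 2) := fun t =>
    (continuous_slice cG t).mul (continuous_const.mul ((continuous_slice cy t).pow 2))
  have hinit : ∫ x in -R..R, G 0 x * (e 0 * y 0 x ^ 2) ≤ D := by
    refine le_trans (intervalIntegral.integral_mono_on (by linarith) ?_ ?_ ?_) (hD R hR0)
    · exact (cGw 0).intervalIntegrable _ _
    · exact (continuous_slice cG 0).intervalIntegrable _ _
    · intro x _
      have h1 : e 0 * y 0 x ^ 2 ≤ 1 := mul_le_one₀ (he1 0 le_rfl) (by positivity)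
        (pow_le_one₀ (coneCutoff_nonneg R U 0 x) (coneCutoff_le_one hR0 hU0 le_rfl x))
      exact mul_le_of_le_one_right (hG0 0 x) h1
  -- lower bounds for the weights
  have hexp : ∀ t ∈ Icc 0 τ, ∀ x ∈ Icc (-n) n, Real.exp (-(K * T)) / 4 ≤ e t * y t x ^ 2 := by
    intro t ht x hx
    have h1 : 1 / 2 ≤ y t x := half_le_coneCutoff hR0 hU0 (ht.2.trans hτ.2) (abs_le.2 hx) hRn
    have h2 : 1 / 4 ≤ y t x ^ 2 := by nlinarith
    have h3 : Real.exp (-(K * T)) ≤ e t := by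
      rw [he]; exact Real.exp_le_exp.2 (by
        have := mul_le_mul_of_nonneg_left (ht.2.trans hτ.2) hK
        linarith)
    calc Real.exp (-(K * T)) / 4 = Real.exp (-(K * T)) * (1 / 4) := by ring
      _ ≤ e t * y t x ^ 2 := mul_le_mul h3 h2 (by norm_num) (Real.exp_pos _).le
  have hrest : ∀ {f : ℝ → ℝ} {f' : ℝ → ℝ} (c : ℝ), Continuous f → Continuous f' →
      (∀ x ∈ Icc (-n) n, c * f x ≤ f' x) → (∀ x, 0 ≤ f' x) →
      c * ∫ x in -n..n, f x ≤ ∫ x in -R..R, f' x := by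
    intro f f' c cf cf' h1 h2
    rw [← intervalIntegral.integral_const_mul]
    refine (intervalIntegral.integral_mono_on (by linarith) ((cf.const_mul c).intervalIntegrable _ _)
      (cf'.intervalIntegrable _ _) h1).trans ?_
    exact intervalIntegral.integral_mono_interval (by linarith) (by linarith) hnR
      (Eventually.of_forall h2) (cf'.intervalIntegrable _ _)
  have hfin1 : Real.exp (-(K * T)) / 4 * ∫ x in -n..n, G τ x ≤
      ∫ x in -R..R, G τ x * (e τ * y τ x ^ 2) := by
    refine hrest _ (continuous_slice cG τ) (cGw τ)
      (fun x hx => ?_) (fun x => ?_)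
    · rw [mul_comm]
      exact mul_le_mul_of_nonneg_left (hexp τ ⟨hτ.1, le_rfl⟩ x hx) (hG0 τ x)
    · have := hG0 τ x
      have := (Real.exp_pos (-(K * τ))).le
      positivity
  have hfin2 : Real.exp (-(K * T)) / 4 * ∫ t in (0 : ℝ)..τ, ∫ x in -n..n, Z t x ≤
      ∫ t in (0 : ℝ)..τ, ∫ x in -R..R, W t x := by
    rw [← intervalIntegral.integral_const_mul]
    refine intervalIntegral.integral_mono_on hτ.1
      (((continuous_integral_slice cZ _ _).const_mul _).intervalIntegrable _ _)
      ((continuous_integral_slice cW _ _).intervalIntegrable _ _) fun t ht => ?_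
    refine hrest _ (continuous_slice cZ t) (continuous_slice cW t) (fun x hx => ?_) (fun x => ?_)
    · exact mul_le_mul_of_nonneg_right (hexp t ht x hx) (hZ0 t x)
    · have := hZ0 t x
      have := (Real.exp_pos (-(K * t))).le
      exact mul_nonneg (mul_nonneg this (sq_nonneg _)) (hZ0 t x)
  rw [mul_add]
  linarith

/-! ### Bounds on boxes that do not depend on the viscosity -/

/-- Bounds on a flow over the box `[0, N] × [-N, N]` that do not depend on the viscosity. -/
structure FlowBounds (γ ε N C : ℝ) (r u rx ux : ℝ → ℝ → ℝ) : Prop where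
  mass : ∀ t ∈ Icc 0 N, ∫ x in -N..N, r t x ≤ C
  power : ∀ t ∈ Icc 0 N, ∫ x in -N..N, r t x ^ γ ≤ C
  kinetic : ∀ t ∈ Icc 0 N, ∫ x in -N..N, r t x * u t x ^ 2 ≤ C
  gradient : ∀ t ∈ Icc 0 N, ∫ x in -N..N, ε ^ 2 * (rx t x ^ 2 / r t x ^ 3) ≤ C
  dissipation_u : ∫ t in (0 : ℝ)..N, ∫ x in -N..N, ε * ux t x ^ 2 ≤ C
  dissipation_r : ∫ t in (0 : ℝ)..N, ∫ x in -N..N, ε * (r t x ^ (γ - 3) * rx t x ^ 2) ≤ C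

/-- From (a + w)² ≤ 2a² + 2w² with w = ερ_x/ρ² and ρw² = ε²ρ_x²/ρ³: the energy density is at most
three times the relative mechanical energy plus the weighted gradient term. The integrand is
nonnegative, so the whole line dominates every interval. -/
theorem HasDataBounds.energyDensity_integral_le {γ ε : ℝ} {ρbar ubar : ℝ → ℝ} {E₀ E₁ M₀ : ℝ}
    {ρ₀ u₀ : ℝ → ℝ} (h : HasDataBounds γ ε ρbar ubar E₀ E₁ M₀ ρ₀ u₀) (hγ : 1 < γ)
    (hb : ∀ x, 0 < ρbar x)
    (hc : Continuous fun x => energyDensity γ ε (ρ₀ x) (u₀ x) (deriv ρ₀ x) (ρbar x) (ubar x))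
    {R : ℝ} (hR : 0 < R) :
    ∫ x in -R..R, energyDensity γ ε (ρ₀ x) (u₀ x) (deriv ρ₀ x) (ρbar x) (ubar x)
      ≤ 3 * E₀ + E₁ := by
  obtain ⟨c, hc0, hcρ⟩ := h.lower
  have hpos : ∀ x, 0 < ρ₀ x := fun x => hc0.trans_le (hcρ x)
  set f : ℝ → ℝ := fun x =>
    1 / 2 * ρ₀ x * (u₀ x - ubar x) ^ 2 + relInternalEnergy γ (ρ₀ x) (ρbar x) with hf
  set g : ℝ → ℝ := fun x => deriv ρ₀ x ^ 2 / ρ₀ x ^ 3 with hg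
  have hfi : Integrable f := h.energy_integrable
  have hgi : Integrable g := h.gradient_integrable
  have hi : Integrable fun x => 3 * f x + ε ^ 2 * g x := (hfi.const_mul 3).add (hgi.const_mul _)
  have hE : ∀ x, 0 ≤ relInternalEnergy γ (ρ₀ x) (ρbar x) := fun x =>
    relInternalEnergy_nonneg hγ (hpos x) (hb x)
  have hle : ∀ x, energyDensity γ ε (ρ₀ x) (u₀ x) (deriv ρ₀ x) (ρbar x) (ubar x) ≤
      3 * f x + ε ^ 2 * g x := by
    intro x
    have h1 := hE x
    have hp := hpos x
    simp only [hf, hg, energyDensity]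
    have e1 : ε ^ 2 * (deriv ρ₀ x ^ 2 / ρ₀ x ^ 3) = ρ₀ x * (ε * deriv ρ₀ x / ρ₀ x ^ 2) ^ 2 := by
      field_simp
    rw [e1]
    have e2 := mul_nonneg hp.le (sq_nonneg ((u₀ x - ubar x) - ε * deriv ρ₀ x / ρ₀ x ^ 2))
    generalize ε * deriv ρ₀ x / ρ₀ x ^ 2 = w at *
    nlinarith
  have hnn : ∀ x, 0 ≤ 3 * f x + ε ^ 2 * g x := fun x => by
    have h1 := hE x
    have hp := hpos x
    simp only [hf, hg]
    positivity
  calc _ ≤ ∫ x in -R..R, (3 * f x + ε ^ 2 * g x) :=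
        intervalIntegral.integral_mono_on (by linarith) (hc.intervalIntegrable _ _)
          hi.intervalIntegrable fun x _ => hle x
    _ ≤ ∫ x, (3 * f x + ε ^ 2 * g x) := by
        rw [intervalIntegral.integral_of_le (by linarith)]
        exact setIntegral_le_integral hi (Eventually.of_forall hnn)
    _ = 3 * (∫ x, f x) + ε ^ 2 * ∫ x, g x := by
        rw [integral_add (hfi.const_mul 3) (hgi.const_mul _), integral_const_mul,
          integral_const_mul]
    _ ≤ 3 * E₀ + E₁ := by
        have h1 : ∫ x, f x ≤ E₀ := h.energy_le
        have h2 : ε ^ 2 * ∫ x, g x ≤ E₁ := h.gradient_le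
        linarith

/-- All six bounds are read off from the energy estimate on the box. Relative internal energy
controls ρ^γ, which in turn controls ρ. The two velocities u and u + ερ_x/ρ² are square integrable
with weight ρ relative to the bounded ū, hence so is their difference; this is the bound on
ε²ρ_x²/ρ³. -/
theorem exists_flowBounds {γ : ℝ} (hγ : 1 < γ) {ε₀ : ℝ}
    {ρl ρr ul ur : ℝ} (hρl : 0 < ρl) (hρr : 0 < ρr) {ρbar ubar : ℝ → ℝ}
    (hbar : IsReferenceProfile ρl ρr ul ur ρbar ubar) (E₀ E₁ M₀ : ℝ) {N : ℝ} (hN : 0 < N) :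
    ∃ C : ℝ, ∀ ε ∈ Ioc 0 ε₀, ∀ (ρ₀ u₀ : ℝ → ℝ) (r u rx rxx ux uxx : ℝ → ℝ → ℝ),
      HasDataBounds γ ε ρbar ubar E₀ E₁ M₀ ρ₀ u₀ → (∀ x, r 0 x = ρ₀ x) → (∀ x, u 0 x = u₀ x) →
      ViscousFlow γ ε ρl ρr ul ur r u rx rxx ux uxx → FlowBounds γ ε N C r u rx ux := by
  obtain ⟨L, a, B, hp, hl, hr⟩ := hbar.exists_bounds hρl hρr
  obtain ⟨K, C₀, hK, hC₀, hs⟩ := hp.exists_energySource_le hγ ε₀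
  obtain ⟨c, hc, hcE⟩ := exists_rpow_le_relInternalEnergy hγ hp.B_pos
  have hk := gasKappa_pos hγ
  have hγ0 : 0 < γ := by linarith
  have hB := hp.B_pos
  set q : ℝ := Real.exp (-(K * N)) / 4 with hq
  have hq0 : 0 < q := by positivity
  set D : ℝ := (3 * E₀ + E₁ + 2 * L * C₀ * N + 1) / q with hD
  set P : ℝ := c * (2 * N + D) with hP
  have hb0 : ∀ x, 0 < ρbar x := fun x => hp.a_pos.trans_le (hp.rho_lower x)
  have hρc : Continuous ρbar := continuous_iff_continuousAt.2 fun x => (hp.der_rho x).continuousAt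
  have huc : Continuous ubar := continuous_iff_continuousAt.2 fun x => (hp.der_u x).continuousAt
  -- Absolute values make every summand nonnegative, so each of the six bounds follows by dropping
  -- the other summands.
  refine ⟨|P| + (2 * N + |P|) + (4 * |D| + 2 * B ^ 2 * (2 * N + |P|)) + 8 * |D| + 4 * |D|
    + |D| / (gasKappa γ * γ), fun ε hε ρ₀ u₀ r u rx rxx ux uxx hd hr0 hu0 h => ?_⟩
  have hε0 := hε.1
  set G : ℝ → ℝ → ℝ := fun t x => energyDensity γ ε (r t x) (u t x) (rx t x) (ρbar x) (ubar x)
    with hGd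
  have cG : Continuous fun z : ℝ × ℝ => G z.1 z.2 :=
    continuous_energyDensity h.cont_r h.cont_u h.cont_rx (hρc.comp continuous_snd)
      (huc.comp continuous_snd) (fun z => h.pos _ _) (fun z => hb0 _)
  have hinit : ∀ R, 0 < R →
      ∫ x in -R..R, energyDensity γ ε (r 0 x) (u 0 x) (rx 0 x) (ρbar x) (ubar x)
        ≤ 3 * E₀ + E₁ := by
    intro R hR
    have e1 : r 0 = ρ₀ := funext hr0
    have e2 : ∀ x, rx 0 x = deriv ρ₀ x := fun x => by rw [← e1]; exact (h.r_x 0 x).deriv.symm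
    have hc0 : Continuous fun x =>
        energyDensity γ ε (ρ₀ x) (u₀ x) (deriv ρ₀ x) (ρbar x) (ubar x) := by
      have := continuous_slice cG 0
      simpa only [hGd, hr0, hu0, e2] using this
    simp only [hr0, hu0, e2]
    exact hd.energyDensity_integral_le hγ hb0 hc0 hR
  set Z : ℝ → ℝ → ℝ := fun t x =>
    ε / 4 * ux t x ^ 2 + ε * (gasKappa γ * γ) * (r t x ^ (γ - 3) * rx t x ^ 2) with hZd
  have crp : ∀ p : ℝ, Continuous fun z : ℝ × ℝ => r z.1 z.2 ^ p := fun p =>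
    h.cont_r.rpow_const fun z => Or.inl (h.pos z.1 z.2).ne'
  have cD1 : Continuous fun z : ℝ × ℝ => ε * ux z.1 z.2 ^ 2 := (h.cont_ux.pow 2).const_mul ε
  have cD2 : Continuous fun z : ℝ × ℝ => ε * (r z.1 z.2 ^ (γ - 3) * rx z.1 z.2 ^ 2) :=
    ((crp _).mul (h.cont_rx.pow 2)).const_mul ε
  have cZ : Continuous fun z : ℝ × ℝ => Z z.1 z.2 := by
    have h2 := h.cont_ux
    have h3 := h.cont_rx
    exact ((h2.pow 2).const_mul _).add (((crp _).mul (h3.pow 2)).const_mul _)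
  have hrp0 : ∀ (t x p : ℝ), 0 ≤ r t x ^ p := fun t x p => Real.rpow_nonneg (h.pos t x).le p
  have hZ0 : ∀ t x, 0 ≤ Z t x := fun t x => by
    have := hrp0 t x (γ - 3)
    positivity
  have hG0 : ∀ t x, 0 ≤ G t x := fun t x => energyDensity_nonneg hγ (h.pos t x) (hb0 x)
  have hNN : -N ≤ N := by linarith
  have hmain : ∀ τ ∈ Icc 0 N, (∫ x in -N..N, G τ x) +
      (∫ t in (0 : ℝ)..τ, ∫ x in -N..N, Z t x) ≤ D := by
    intro τ hτ
    rw [hD, le_div_iff₀ hq0, mul_comm]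
    exact h.energy_estimate hγ hε0 hρl hρr hp hl hr hK hC₀ (hs ε hε) hinit hτ hN.le
  have hZint : ∀ τ, 0 ≤ τ → 0 ≤ ∫ t in (0 : ℝ)..τ, ∫ x in -N..N, Z t x := fun τ hτ =>
    intervalIntegral.integral_nonneg hτ fun t _ =>
      intervalIntegral.integral_nonneg hNN fun x _ => hZ0 t x
  have hGint : ∀ τ ∈ Icc 0 N, ∫ x in -N..N, G τ x ≤ D := fun τ hτ => by
    have := hmain τ hτ
    have := hZint τ hτ.1
    linarith
  have hZle : ∫ t in (0 : ℝ)..N, ∫ x in -N..N, Z t x ≤ D := by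
    have h1 := hmain N ⟨hN.le, le_rfl⟩
    have h2 : 0 ≤ ∫ x in -N..N, G N x := intervalIntegral.integral_nonneg hNN fun x _ => hG0 N x
    linarith
  have hD0 : D ≤ |D| := le_abs_self D
  have hP0 : P ≤ |P| := le_abs_self P
  have hDn := abs_nonneg D
  have hPn := abs_nonneg P
  have hq1 : 0 ≤ |D| / (gasKappa γ * γ) := by positivity
  have hBP : 0 ≤ 2 * B ^ 2 * (2 * N + |P|) := by positivity
  -- pointwise consequences of the energy bound
  have hEG : ∀ t x, 2 * relInternalEnergy γ (r t x) (ρbar x) ≤ G t x := fun t x => by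
    have := (h.pos t x).le
    simp only [hGd, energyDensity]
    have : 0 ≤ 1 / 2 * r t x * (u t x - ubar x) ^ 2 := by positivity
    have : 0 ≤ 1 / 2 * r t x * (u t x + ε * rx t x / r t x ^ 2 - ubar x) ^ 2 := by positivity
    linarith
  have hpw : ∀ t x, r t x ^ γ ≤ c * (1 + G t x / 2) := fun t x =>
    (hcE _ _ (hb0 x) (hp.rho_upper x) (h.pos t x)).trans
      (mul_le_mul_of_nonneg_left (by linarith [hEG t x]) hc.le)
  have hkinG : ∀ t x, r t x * (u t x - ubar x) ^ 2 ≤ 2 * G t x ∧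
      r t x * (u t x + ε * rx t x / r t x ^ 2 - ubar x) ^ 2 ≤ 2 * G t x := fun t x => by
    have h0 := (h.pos t x).le
    have h1 := relInternalEnergy_nonneg hγ (h.pos t x) (hb0 x)
    have h2 : 0 ≤ r t x * (u t x - ubar x) ^ 2 := by positivity
    have h3 : 0 ≤ r t x * (u t x + ε * rx t x / r t x ^ 2 - ubar x) ^ 2 := by positivity
    simp only [hGd, energyDensity]
    constructor <;> linarith
  have int_mono : ∀ {f g : ℝ → ℝ}, Continuous f → Continuous g → (∀ x, f x ≤ g x) →
      ∫ x in -N..N, f x ≤ ∫ x in -N..N, g x := fun hf hg hfg =>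
    intervalIntegral.integral_mono_on hNN (hf.intervalIntegrable _ _) (hg.intervalIntegrable _ _)
      fun x _ => hfg x
  have cr := h.cont_r
  have cu := h.cont_u
  have hpower : ∀ t ∈ Icc 0 N, ∫ x in -N..N, r t x ^ γ ≤ |P| := by
    intro t ht
    have cGt := continuous_slice cG t
    refine (int_mono (continuous_slice (f := fun t x => r t x ^ γ) (crp γ) t)
      (g := fun x => c * (1 + G t x / 2)) (by fun_prop) (hpw t)).trans ?_
    rw [intervalIntegral.integral_const_mul, intervalIntegral.integral_add intervalIntegrable_const
      ((cGt.div_const 2).intervalIntegrable _ _), intervalIntegral.integral_div,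
      intervalIntegral.integral_const, smul_eq_mul]
    have h1 : c * ((N - -N) * 1 + (∫ x in -N..N, G t x) / 2) ≤ c * (2 * N + |D| / 2) :=
      mul_le_mul_of_nonneg_left (by linarith [hGint t ht]) hc.le
    have h0 : 0 ≤ ∫ x in -N..N, G t x := intervalIntegral.integral_nonneg hNN fun x _ => hG0 t x
    have hDD : 0 ≤ D := h0.trans (hGint t ht)
    rw [abs_of_nonneg hDD] at h1
    have h2 : c * (2 * N + D / 2) ≤ P := mul_le_mul_of_nonneg_left (by linarith) hc.le
    linarith
  have hmass : ∀ t ∈ Icc 0 N, ∫ x in -N..N, r t x ≤ 2 * N + |P| := by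
    intro t ht
    have cg := continuous_slice (f := fun t x => r t x ^ γ) (crp γ) t
    refine (int_mono (continuous_slice cr t) (g := fun x => 1 + r t x ^ γ)
      (continuous_const.add cg) fun x => le_one_add_rpow hγ.le (h.pos t x).le).trans ?_
    rw [intervalIntegral.integral_add intervalIntegrable_const (cg.intervalIntegrable _ _),
      intervalIntegral.integral_const, smul_eq_mul]
    linarith [hpower t ht]
  constructor
  · intro t ht
    have := hmass t ht
    linarith
  · intro t ht
    have := hpower t ht
    linarith
  · intro t ht
    have cGt := continuous_slice cG t
    have crt := continuous_slice cr t
    have cut := continuous_slice cu t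
    have h1 := int_mono (f := fun x => r t x * u t x ^ 2)
      (g := fun x => 4 * G t x + 2 * B ^ 2 * r t x) (by fun_prop) (by fun_prop) (fun x => by
        have h1 := (hkinG t x).1
        have h2 : ubar x ^ 2 ≤ B ^ 2 :=
          sq_le_sq' (abs_le.1 (hp.u_bound x)).1 (abs_le.1 (hp.u_bound x)).2
        have h3 := mul_le_mul_of_nonneg_left h2 (h.pos t x).le
        have h4 := mul_nonneg (h.pos t x).le (sq_nonneg (u t x - 2 * ubar x))
        linarith)
    refine h1.trans ?_
    rw [intervalIntegral.integral_add ((cGt.const_mul 4).intervalIntegrable _ _)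
      ((crt.const_mul _).intervalIntegrable _ _), intervalIntegral.integral_const_mul,
      intervalIntegral.integral_const_mul]
    have h2 := mul_le_mul_of_nonneg_left (hmass t ht) (by positivity : 0 ≤ 2 * B ^ 2)
    have h3 := hGint t ht
    linarith
  · intro t ht
    have cGt := continuous_slice cG t
    have crt := continuous_slice cr t
    have crxt := continuous_slice h.cont_rx t
    have h1 := int_mono (f := fun x => ε ^ 2 * (rx t x ^ 2 / r t x ^ 3)) (g := fun x => 8 * G t x)
      (by fun_prop (disch := exact fun z => (pow_pos (h.pos t z) _).ne')) (by fun_prop) (fun x => by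
        have hp0 := h.pos t x
        have h1 := hkinG t x
        have e1 : ε ^ 2 * (rx t x ^ 2 / r t x ^ 3) = r t x * (ε * rx t x / r t x ^ 2) ^ 2 := by
          field_simp
        rw [e1]
        have h2 := h1.1
        have h3 := h1.2
        generalize ε * rx t x / r t x ^ 2 = w at *
        have h4 := mul_nonneg hp0.le (sq_nonneg (w + 2 * (u t x - ubar x)))
        linarith)
    refine h1.trans ?_
    rw [intervalIntegral.integral_const_mul]
    have h3 := hGint t ht
    linarith
  · have h1 : ∫ t in (0 : ℝ)..N, ∫ x in -N..N, ε * ux t x ^ 2 ≤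
        ∫ t in (0 : ℝ)..N, 4 * ∫ x in -N..N, Z t x := by
      refine intervalIntegral.integral_mono_on hN.le
        ((continuous_integral_slice (f := fun t x => ε * ux t x ^ 2) cD1 _ _).intervalIntegrable _ _)
        (((continuous_integral_slice cZ _ _).const_mul 4).intervalIntegrable _ _) fun t _ => ?_
      rw [← intervalIntegral.integral_const_mul]
      refine int_mono (continuous_slice (f := fun t x => ε * ux t x ^ 2) cD1 t)
        ((continuous_slice cZ t).const_mul 4) fun x => ?_
      have := hrp0 t x (γ - 3)
      have : 0 ≤ ε * (gasKappa γ * γ) * (r t x ^ (γ - 3) * rx t x ^ 2) := by positivity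
      simp only [hZd]
      linarith
    rw [intervalIntegral.integral_const_mul] at h1
    linarith
  · have hkg : 0 < gasKappa γ * γ := by positivity
    have h1 : ∫ t in (0 : ℝ)..N, ∫ x in -N..N, ε * (r t x ^ (γ - 3) * rx t x ^ 2) ≤
        ∫ t in (0 : ℝ)..N, (1 / (gasKappa γ * γ)) * ∫ x in -N..N, Z t x := by
      refine intervalIntegral.integral_mono_on hN.le
        ((continuous_integral_slice (f := fun t x => ε * (r t x ^ (γ - 3) * rx t x ^ 2))
          cD2 _ _).intervalIntegrable _ _)
        (((continuous_integral_slice cZ _ _).const_mul _).intervalIntegrable _ _) fun t _ => ?_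
      rw [← intervalIntegral.integral_const_mul]
      refine int_mono (continuous_slice (f := fun t x => ε * (r t x ^ (γ - 3) * rx t x ^ 2)) cD2 t)
        ((continuous_slice cZ t).const_mul _) fun x => ?_
      have h2 : 0 ≤ 1 / (gasKappa γ * γ) * (ε / 4 * ux t x ^ 2) := by positivity
      have h3 : 1 / (gasKappa γ * γ) * (ε * (gasKappa γ * γ) * (r t x ^ (γ - 3) * rx t x ^ 2)) =
          ε * (r t x ^ (γ - 3) * rx t x ^ 2) := by field_simp
      simp only [hZd]
      rw [mul_add, h3]
      linarith
    rw [intervalIntegral.integral_const_mul] at h1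
    have h4 : 1 / (gasKappa γ * γ) * ∫ t in (0 : ℝ)..N, ∫ x in -N..N, Z t x ≤
        1 / (gasKappa γ * γ) * |D| := mul_le_mul_of_nonneg_left (by linarith) (by positivity)
    have h5 : 1 / (gasKappa γ * γ) * |D| = |D| / (gasKappa γ * γ) := by ring
    linarith

/-! ### Higher integrability of the density -/

/-- The equation integrated in time represents the integral as a primitive of a continuous function,
so the fundamental theorem of calculus replaces differentiation under the integral sign. -/
theorem hasDerivAt_integral_of_evolution {F F' : ℝ → ℝ → ℝ}
    (hF : Continuous fun z : ℝ × ℝ => F z.1 z.2) (hF' : Continuous fun z : ℝ × ℝ => F' z.1 z.2)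
    (h : ∀ t x, 0 < t → HasDerivAt (fun s => F s x) (F' t x) t) (a b : ℝ) {t : ℝ} (ht : 0 < t) :
    HasDerivAt (fun s => ∫ x in a..b, F s x) (∫ x in a..b, F' t x) t := by
  have h1 : HasDerivAt (fun s => (∫ x in a..b, F 0 x) + ∫ τ in (0 : ℝ)..s, ∫ x in a..b, F' τ x)
      (∫ x in a..b, F' t x) t :=
    (((continuous_integral_slice hF' a b).integral_hasStrictDerivAt 0 t).hasDerivAt).const_add _
  refine h1.congr_of_eventuallyEq ?_
  filter_upwards [Ioi_mem_nhds ht] with s hs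
  rw [← integral_sub_eq_integral_of_hasDerivAt hF hF' h (le_of_lt hs) a b]
  ring

/-- A compactly supported weight that is at least `1` on `[-(b-1), b-1]`. -/
noncomputable def bumpWeight (b x : ℝ) : ℝ := max 0 (b ^ 2 - x ^ 2) ^ 2

/-- The derivative of `bumpWeight`. -/
noncomputable def bumpWeightDeriv (b x : ℝ) : ℝ := 2 * max 0 (b ^ 2 - x ^ 2) * (-(2 * x))

theorem hasDerivAt_bumpWeight (b x : ℝ) : HasDerivAt (bumpWeight b) (bumpWeightDeriv b x) x := by
  have h1 : HasDerivAt (fun y : ℝ => b ^ 2 - y ^ 2) (-(2 * x)) x := by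
    simpa using (hasDerivAt_pow 2 x).const_sub (b ^ 2)
  exact (hasDerivAt_max_zero_sq _).comp x h1

theorem exists_bumpWeight_bound (b : ℝ) : ∃ A, 0 ≤ A ∧ ∀ x ∈ Icc (-b) b,
    bumpWeight b x ≤ A ∧ |bumpWeightDeriv b x| ≤ A := by
  have c1 : Continuous (bumpWeight b) := by unfold bumpWeight; fun_prop
  have c2 : Continuous (bumpWeightDeriv b) := by unfold bumpWeightDeriv; fun_prop
  obtain ⟨A, hA⟩ := (isCompact_Icc (a := -b) (b := b)).exists_bound_of_continuousOn c1.continuousOn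
  obtain ⟨A', hA'⟩ := (isCompact_Icc (a := -b) (b := b)).exists_bound_of_continuousOn c2.continuousOn
  refine ⟨max 0 (max A A'), le_max_left _ _, fun x hx => ⟨?_, ?_⟩⟩
  · exact (le_abs_self _).trans ((hA x hx).trans ((le_max_left _ _).trans (le_max_right _ _)))
  · exact (hA' x hx).trans ((le_max_right _ _).trans (le_max_right _ _))

theorem ViscousFlow.momentum_t {γ ε ρl ρr ul ur : ℝ} {r u rx rxx ux uxx : ℝ → ℝ → ℝ}
    (h : ViscousFlow γ ε ρl ρr ul ur r u rx rxx ux uxx) {t : ℝ} (x : ℝ) (ht : 0 < t) :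
    HasDerivAt (fun s => r s x * u s x)
      (-(rx t x * u t x ^ 2 + r t x * (2 * u t x * ux t x)
        + gasKappa γ * (γ * r t x ^ (γ - 1) * rx t x) - ε * uxx t x)) t := by
  refine ((h.r_t t x ht).mul (h.u_t t x ht)).congr_deriv ?_
  have hr := (h.pos t x).ne'
  rw [rpow_sub_one_eq (h.pos t x)]
  field_simp
  ring

theorem ViscousFlow.momentumFlux_x {γ ε ρl ρr ul ur : ℝ} {r u rx rxx ux uxx : ℝ → ℝ → ℝ}
    (h : ViscousFlow γ ε ρl ρr ul ur r u rx rxx ux uxx) (t x : ℝ) :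
    HasDerivAt (fun y => r t y * u t y ^ 2 + gasKappa γ * r t y ^ γ - ε * ux t y)
      (rx t x * u t x ^ 2 + r t x * (2 * u t x * ux t x)
        + gasKappa γ * (γ * r t x ^ (γ - 1) * rx t x) - ε * uxx t x) x := by
  have h1 := ((h.r_x t x).mul ((h.u_x t x).pow 2)).add
    (((h.r_x t x).rpow_const (p := γ) (Or.inl (h.pos t x).ne')).const_mul (gasKappa γ))
  refine (h1.sub ((h.ux_x t x).const_mul ε)).congr_deriv ?_
  simp only [Pi.pow_apply]
  push_cast
  ring

set_option maxHeartbeats 1000000 in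
/-- The identity behind the higher integrability of the density. -/
theorem ViscousFlow.integral_pressure_identity {γ ε ρl ρr ul ur : ℝ}
    {r u rx rxx ux uxx : ℝ → ℝ → ℝ}
    (h : ViscousFlow γ ε ρl ρr ul ur r u rx rxx ux uxx) {b : ℝ} (hb : 0 ≤ b) :
    ∃ M J : ℝ → ℝ → ℝ, Continuous (fun z : ℝ × ℝ => M z.1 z.2) ∧
      Continuous (fun z : ℝ × ℝ => J z.1 z.2) ∧
      (∀ t x, M t x = ∫ y in -b..x, r t y * u t y * bumpWeight b y) ∧
      (∀ t x, J t x = ∫ y in -b..x, (r t y * u t y ^ 2 + gasKappa γ * r t y ^ γ - ε * ux t y)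
        * bumpWeightDeriv b y) ∧
      (∫ x in -b..b, r b x * bumpWeight b x * M b x)
        - (∫ x in -b..b, r 0 x * bumpWeight b x * M 0 x) =
      ∫ t in (0 : ℝ)..b, ∫ x in -b..b, (M t x * bumpWeightDeriv b x * (r t x * u t x)
        + ε * (r t x * ux t x) * bumpWeight b x ^ 2 + r t x * bumpWeight b x * J t x
        - gasKappa γ * (r t x * r t x ^ γ) * bumpWeight b x ^ 2) := by
  have cw : Continuous (bumpWeight b) := by unfold bumpWeight; fun_prop
  have cw' : Continuous (bumpWeightDeriv b) := by unfold bumpWeightDeriv; fun_prop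
  have cwz : Continuous fun z : ℝ × ℝ => bumpWeight b z.2 := cw.comp continuous_snd
  have cwz' : Continuous fun z : ℝ × ℝ => bumpWeightDeriv b z.2 := cw'.comp continuous_snd
  have w0 : bumpWeight b b = 0 := by simp [bumpWeight]
  have w1 : bumpWeight b (-b) = 0 := by simp [bumpWeight]
  have cr := h.cont_r
  have cu := h.cont_u
  have crx := h.cont_rx
  have cux := h.cont_ux
  have cuxx := h.cont_uxx
  have crg : Continuous fun z : ℝ × ℝ => r z.1 z.2 ^ γ :=
    cr.rpow_const fun z => Or.inl (h.pos z.1 z.2).ne'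
  have crg1 : Continuous fun z : ℝ × ℝ => r z.1 z.2 ^ (γ - 1) :=
    cr.rpow_const fun z => Or.inl (h.pos z.1 z.2).ne'
  set w := bumpWeight b with hw
  set w' := bumpWeightDeriv b with hw'
  set m : ℝ → ℝ → ℝ := fun t y => r t y * u t y * w y with hm
  set j : ℝ → ℝ → ℝ := fun t y => r t y * u t y ^ 2 + gasKappa γ * r t y ^ γ - ε * ux t y with hj
  set j' : ℝ → ℝ → ℝ := fun t x => rx t x * u t x ^ 2 + r t x * (2 * u t x * ux t x)
        + gasKappa γ * (γ * r t x ^ (γ - 1) * rx t x) - ε * uxx t x with hj'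
  have cm : Continuous fun z : ℝ × ℝ => m z.1 z.2 := (cr.mul cu).mul cwz
  have cj : Continuous fun z : ℝ × ℝ => j z.1 z.2 :=
    ((cr.mul (cu.pow 2)).add (crg.const_mul _)).sub (cux.const_mul ε)
  have cj' : Continuous fun z : ℝ × ℝ => j' z.1 z.2 :=
    (((crx.mul (cu.pow 2)).add (cr.mul ((cu.const_mul 2).mul cux))).add
      (((crg1.const_mul γ).mul crx).const_mul _)).sub (cuxx.const_mul ε)
  set M : ℝ → ℝ → ℝ := fun t x => ∫ y in -b..x, m t y with hM
  set J : ℝ → ℝ → ℝ := fun t x => ∫ y in -b..x, j t y * w' y with hJ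
  have cM : Continuous fun z : ℝ × ℝ => M z.1 z.2 :=
    intervalIntegral.continuous_parametric_primitive_of_continuous cm
  have cJ : Continuous fun z : ℝ × ℝ => J z.1 z.2 :=
    intervalIntegral.continuous_parametric_primitive_of_continuous (f := fun t y => j t y * w' y)
      (cj.mul cwz')
  refine ⟨M, J, cM, cJ, fun _ _ => rfl, fun _ _ => rfl, ?_⟩
  -- The weight vanishes at -b, so integrating the momentum equation from -b to x leaves only the
  -- flux at x, which will produce ρ p, and the term J from the derivative of the weight.
  have hMt : ∀ t x, 0 < t → HasDerivAt (fun s => M s x) (-(j t x * w x) + J t x) t := by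
    intro t x ht
    have h1 := hasDerivAt_integral_of_evolution (F := m) (F' := fun t y => -(j' t y) * w y) cm
      (cj'.neg.mul cwz) (fun t y ht => (h.momentum_t y ht).mul_const (w y)) (-b) x ht
    refine h1.congr_deriv ?_
    have h2 : ∫ y in -b..x, (j' t y * w y + j t y * w' y) = j t x * w x - j t (-b) * w (-b) :=
      intervalIntegral.integral_eq_sub_of_hasDerivAt
        (fun y _ => (h.momentumFlux_x t y).mul (hasDerivAt_bumpWeight b y))
        ((((continuous_slice cj' t).mul cw).add
          ((continuous_slice cj t).mul cw')).intervalIntegrable _ _)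
    have i1 : IntervalIntegrable (fun y => j' t y * w y) volume (-b) x :=
      ((continuous_slice cj' t).mul cw).intervalIntegrable _ _
    have i2 : IntervalIntegrable (fun y => j t y * w' y) volume (-b) x :=
      ((continuous_slice cj t).mul cw').intervalIntegrable _ _
    rw [intervalIntegral.integral_add i1 i2, w1] at h2
    have h3 : ∫ y in -b..x, -(j' t y) * w y = -∫ y in -b..x, j' t y * w y := by
      rw [← intervalIntegral.integral_neg]
      simp only [neg_mul]
    rw [h3]
    simp only [hJ]
    linarith
  have hMx : ∀ t x, HasDerivAt (M t) (m t x) x := fun t x =>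
    ((continuous_slice cm t).integral_hasStrictDerivAt (-b) x).hasDerivAt
  set Fp : ℝ → ℝ → ℝ := fun t x => -(rx t x * u t x + r t x * ux t x) * w x * M t x
    + r t x * w x * (-(j t x * w x) + J t x) with hFp
  have cFp : Continuous fun z : ℝ × ℝ => Fp z.1 z.2 :=
    (((((crx.mul cu).add (cr.mul cux)).neg.mul cwz).mul cM)).add
      ((cr.mul cwz).mul ((cj.mul cwz).neg.add cJ))
  have hint := integral_sub_eq_integral_of_hasDerivAt (F := fun t x => r t x * w x * M t x)
    (F' := Fp) ((cr.mul cwz).mul cM) cFp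
    (fun t x ht => ((h.r_t t x ht).mul_const (w x)).mul (hMt t x ht)) hb (-b) b
  rw [hint]
  refine intervalIntegral.integral_congr fun t _ => ?_
  -- Q is the x-derivative of M w ρu and integrates to zero. Adding it removes (ρu)_x and cancels
  -- the terms ρ²u²w², so that -ρ p w² is the only term of order ρ^(γ+1) left.
  set Q : ℝ → ℝ := fun x => m t x * (w x * (r t x * u t x))
    + M t x * (w' x * (r t x * u t x) + w x * (rx t x * u t x + r t x * ux t x)) with hQ
  have c1 := continuous_slice cr t
  have c2 := continuous_slice cu t
  have c3 := continuous_slice crx t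
  have c4 := continuous_slice cux t
  have c5 := continuous_slice cM t
  have c6 := continuous_slice cm t
  have c7 := continuous_slice cFp t
  have c8 := continuous_slice cJ t
  have c9 := continuous_slice (f := fun t x => r t x ^ γ) crg t
  have cQ : Continuous Q := by simp only [hQ]; fun_prop
  have hQ0 : ∫ x in -b..b, Q x = 0 := by
    rw [intervalIntegral.integral_eq_sub_of_hasDerivAt
      (f := fun x => M t x * (w x * (r t x * u t x)))
      (fun x _ => (hMx t x).mul ((hasDerivAt_bumpWeight b x).mul ((h.r_x t x).mul (h.u_x t x))))
      (cQ.intervalIntegrable _ _)]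
    rw [w0, w1]; ring
  change ∫ x in -b..b, Fp t x = _
  rw [← add_zero (∫ x in -b..b, Fp t x), ← hQ0, ← intervalIntegral.integral_add
    (c7.intervalIntegrable _ _) (cQ.intervalIntegrable _ _)]
  refine intervalIntegral.integral_congr fun x _ => ?_
  simp only [hFp, hQ, hj, hm]
  ring

/-- Above R = (e/k)^(1/(γ-1)) the higher power wins; below R the square is bounded. With k half of
the pressure coefficient this pays for the ρ² that comes from ε ρ u_x. -/
theorem exists_mul_sq_le_rpow {γ : ℝ} (hγ : 1 < γ) {k : ℝ} (hk : 0 < k) (e : ℝ) (he : 0 ≤ e) :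
    ∃ A : ℝ, 0 ≤ A ∧ ∀ r : ℝ, 0 < r → e * r ^ 2 ≤ k * (r * r ^ γ) + A := by
  set R : ℝ := (e / k) ^ (1 / (γ - 1)) with hR
  have h1 : 0 < γ - 1 := by linarith
  have hR0 : 0 ≤ R := Real.rpow_nonneg (by positivity) _
  have hRp : R ^ (γ - 1) = e / k := by
    rw [hR, ← Real.rpow_mul (by positivity), one_div, inv_mul_cancel₀ h1.ne', Real.rpow_one]
  refine ⟨e * R ^ 2, by positivity, fun r hr => ?_⟩
  have hp := Real.rpow_pos_of_pos hr γ
  rcases le_total r R with h | h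
  · have : r ^ 2 ≤ R ^ 2 := by gcongr
    have := mul_le_mul_of_nonneg_left this he
    have : 0 ≤ k * (r * r ^ γ) := by positivity
    linarith
  · have h2 : e / k ≤ r ^ (γ - 1) := hRp ▸ Real.rpow_le_rpow hR0 h h1.le
    have h3 : r ^ γ = r ^ (γ - 1) * r := by rw [← Real.rpow_add_one hr.ne']; ring_nf
    rw [div_le_iff₀ hk] at h2
    rw [h3]
    have h4 := mul_le_mul_of_nonneg_right h2 (sq_nonneg r)
    have : 0 ≤ e * R ^ 2 := by positivity
    linarith

theorem one_le_bumpWeight {N x : ℝ} (hN : 0 ≤ N) (hx : x ∈ Icc (-N) N) :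
    1 ≤ bumpWeight (N + 1) x := by
  have h1 : x ^ 2 ≤ N ^ 2 := sq_le_sq' hx.1 hx.2
  have h2 : 1 ≤ (N + 1) ^ 2 - x ^ 2 := by nlinarith
  unfold bumpWeight
  rw [max_eq_right (by linarith)]
  nlinarith

set_option maxHeartbeats 1000000 in
/-- Higher integrability of the density, uniform in the viscosity. -/
theorem exists_integral_rpow_succ_le {γ : ℝ} (hγ : 1 < γ) {ε₀ : ℝ} (C : ℝ) {N : ℝ} (hN : 0 < N) :
    ∃ C' : ℝ, ∀ ε ∈ Ioc 0 ε₀, ∀ (ρl ρr ul ur : ℝ) (r u rx rxx ux uxx : ℝ → ℝ → ℝ),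
      ViscousFlow γ ε ρl ρr ul ur r u rx rxx ux uxx → FlowBounds γ ε (N + 1) C r u rx ux →
      ∫ t in (0 : ℝ)..N, ∫ x in -N..N, r t x * r t x ^ γ ≤ C' := by
  have hk := gasKappa_pos hγ
  set k := gasKappa γ with hkd
  -- The computation runs on the box of size N + 1; on the inner box of size N the weight is at
  -- least 1.
  set b : ℝ := N + 1 with hb
  have hb0 : 0 < b := by linarith
  have hbb : -b ≤ b := by linarith
  obtain ⟨A, hA, hwA⟩ := exists_bumpWeight_bound b
  obtain ⟨S, hS, hrS⟩ := exists_mul_sq_le_rpow hγ (half_pos hk) |ε₀| (abs_nonneg _)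
  set D : ℝ := 2 * (A * C * (A * C)) + (b * (A * C * (A * C)) + A ^ 2 * C + 2 * b * b * (A ^ 2 * S)
    + A * C * (A * (b * (C + k * C + 2 * b * |ε₀|) + C))) with hD
  refine ⟨D / (k / 2), fun ε hε ρl ρr ul ur r u rx rxx ux uxx h hB => ?_⟩
  have hε0 := hε.1
  have hε1 : ε ≤ |ε₀| := hε.2.trans (le_abs_self _)
  obtain ⟨M, J, cM, cJ, hM, hJ, hid⟩ := h.integral_pressure_identity hb0.le
  have cw : Continuous (bumpWeight b) := by unfold bumpWeight; fun_prop
  have cw' : Continuous (bumpWeightDeriv b) := by unfold bumpWeightDeriv; fun_prop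
  have cwz : Continuous fun z : ℝ × ℝ => bumpWeight b z.2 := cw.comp continuous_snd
  have cwz' : Continuous fun z : ℝ × ℝ => bumpWeightDeriv b z.2 := cw'.comp continuous_snd
  have hw0 : ∀ x, 0 ≤ bumpWeight b x := fun x => sq_nonneg _
  set w := bumpWeight b with hw
  set w' := bumpWeightDeriv b with hw'
  have cr := h.cont_r
  have cu := h.cont_u
  have cux := h.cont_ux
  have crg : Continuous fun z : ℝ × ℝ => r z.1 z.2 ^ γ :=
    cr.rpow_const fun z => Or.inl (h.pos z.1 z.2).ne'
  have crt : ∀ t, Continuous (r t) := continuous_slice cr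
  have cut : ∀ t, Continuous (u t) := continuous_slice cu
  have cuxt : ∀ t, Continuous (ux t) := continuous_slice cux
  have cMt : ∀ t, Continuous (M t) := continuous_slice cM
  have cJt : ∀ t, Continuous (J t) := continuous_slice cJ
  have crgt : ∀ t, Continuous fun x => r t x ^ γ := continuous_slice (f := fun t x => r t x ^ γ) crg
  have hr0 : ∀ t x, 0 ≤ r t x := fun t x => (h.pos t x).le
  have hrg0 : ∀ t x, 0 ≤ r t x ^ γ := fun t x => Real.rpow_nonneg (hr0 t x) γ
  have int_mono : ∀ {f g : ℝ → ℝ}, Continuous f → Continuous g → (∀ x ∈ Icc (-b) b, f x ≤ g x) →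
      ∫ x in -b..b, f x ≤ ∫ x in -b..b, g x := fun hf hg hfg =>
    intervalIntegral.integral_mono_on hbb (hf.intervalIntegrable _ _) (hg.intervalIntegrable _ _)
      hfg
  have hC : 0 ≤ C := (intervalIntegral.integral_nonneg hbb fun x _ => hr0 0 x).trans
    (hB.mass 0 ⟨le_rfl, hb0.le⟩)
  -- momentum in `L¹`
  have hmom : ∀ t ∈ Icc 0 b, ∫ x in -b..b, |r t x * u t x| ≤ C := by
    intro t ht
    have c1 := crt t
    have c2 := cut t
    have h1 := int_mono (f := fun x => |r t x * u t x|)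
      (g := fun x => (r t x + r t x * u t x ^ 2) / 2) (by fun_prop) (by fun_prop) (fun x _ => by
        rw [abs_mul, abs_of_nonneg (hr0 t x)]
        have h2 := mul_nonneg (hr0 t x) (sq_nonneg (|u t x| - 1))
        rw [← sq_abs (u t x)]
        linarith)
    refine h1.trans ?_
    have i2 : IntervalIntegrable (fun x => r t x * u t x ^ 2) volume (-b) b :=
      (c1.mul (c2.pow 2)).intervalIntegrable _ _
    rw [intervalIntegral.integral_div, intervalIntegral.integral_add (c1.intervalIntegrable _ _) i2]
    linarith [hB.mass t ht, hB.kinetic t ht]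
  have prim : ∀ {f g : ℝ → ℝ}, Continuous f → Continuous g → (∀ x ∈ Icc (-b) b, |f x| ≤ g x) →
      ∀ x ∈ Icc (-b) b, |∫ y in -b..x, f y| ≤ ∫ y in -b..b, g y := by
    intro f g cf cg hfg x hx
    refine (intervalIntegral.abs_integral_le_integral_abs hx.1).trans ?_
    refine (intervalIntegral.integral_mono_on hx.1 (cf.abs.intervalIntegrable _ _)
      (cg.intervalIntegrable _ _) fun y hy => hfg y ⟨hy.1, hy.2.trans hx.2⟩).trans ?_
    have h1 : ∀ y ∈ Icc (-b) b, 0 ≤ g y := fun y hy => (abs_nonneg _).trans (hfg y hy)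
    rw [← intervalIntegral.integral_add_adjacent_intervals (cg.intervalIntegrable (-b) x)
      (cg.intervalIntegrable x b)]
    have := intervalIntegral.integral_nonneg (μ := volume) hx.2 fun y hy => h1 y ⟨hx.1.trans hy.1, hy.2⟩
    linarith
  have hMb : ∀ t ∈ Icc 0 b, ∀ x ∈ Icc (-b) b, |M t x| ≤ A * C := by
    intro t ht x hx
    have c1 := crt t
    have c2 := cut t
    rw [hM]
    refine (prim (f := fun y => r t y * u t y * w y) (g := fun y => A * |r t y * u t y|)
      (by fun_prop) (by fun_prop) (fun y hy => ?_) x hx).trans ?_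
    · rw [abs_mul, mul_comm, abs_of_nonneg (hw0 y)]
      exact mul_le_mul_of_nonneg_right (hwA y hy).1 (abs_nonneg _)
    · rw [intervalIntegral.integral_const_mul]
      exact mul_le_mul_of_nonneg_left (hmom t ht) hA
  set V : ℝ → ℝ := fun t => ∫ x in -b..b, ε * ux t x ^ 2 with hV
  have cV : Continuous V :=
    continuous_integral_slice (f := fun t x => ε * ux t x ^ 2) ((cux.pow 2).const_mul ε) _ _
  have hVint : ∫ t in (0 : ℝ)..b, V t ≤ C := hB.dissipation_u
  -- Since |εu_x| ≤ |ε₀| + εu_x², J is bounded uniformly in x by a function of t whose integral in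
  -- time is bounded through the dissipation.
  have hJb : ∀ t ∈ Icc 0 b, ∀ x ∈ Icc (-b) b, |J t x| ≤ A * (C + k * C + 2 * b * |ε₀| + V t) := by
    intro t ht x hx
    have c1 := crt t
    have c2 := cut t
    have c3 := cuxt t
    have c4 := crgt t
    rw [hJ]
    refine (prim (f := fun y => (r t y * u t y ^ 2 + k * r t y ^ γ - ε * ux t y) * w' y)
      (g := fun y => A * (r t y * u t y ^ 2 + k * r t y ^ γ + |ε₀| + ε * ux t y ^ 2))
      (by fun_prop) (by fun_prop) (fun y hy => ?_) x hx).trans ?_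
    · rw [abs_mul, mul_comm]
      refine mul_le_mul (hwA y hy).2 ?_ (abs_nonneg _) hA
      have h1 : 0 ≤ r t y * u t y ^ 2 := mul_nonneg (hr0 t y) (sq_nonneg _)
      have h2 : 0 ≤ k * r t y ^ γ := mul_nonneg hk.le (hrg0 t y)
      have h3 := mul_nonneg hε0.le (sq_nonneg (ux t y - 1))
      have h4 := mul_nonneg hε0.le (sq_nonneg (ux t y + 1))
      have h5 := mul_nonneg hε0.le (sq_nonneg (ux t y))
      rw [abs_le]; constructor <;> nlinarith
    · have i1 : IntervalIntegrable (fun y => r t y * u t y ^ 2) volume (-b) b :=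
        (c1.mul (c2.pow 2)).intervalIntegrable _ _
      have i2 : IntervalIntegrable (fun y => k * r t y ^ γ) volume (-b) b :=
        (c4.const_mul k).intervalIntegrable _ _
      have i3 : IntervalIntegrable (fun y => ε * ux t y ^ 2) volume (-b) b :=
        ((c3.pow 2).const_mul ε).intervalIntegrable _ _
      rw [intervalIntegral.integral_const_mul, intervalIntegral.integral_add
        ((i1.add i2).add intervalIntegrable_const) i3,
        intervalIntegral.integral_add (i1.add i2) intervalIntegrable_const,
        intervalIntegral.integral_add i1 i2, intervalIntegral.integral_const,
        intervalIntegral.integral_const_mul, smul_eq_mul]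
      refine mul_le_mul_of_nonneg_left ?_ hA
      have h1 := hB.kinetic t ht
      have h2 := mul_le_mul_of_nonneg_left (hB.power t ht) hk.le
      have h3 : (∫ x in -b..b, ε * ux t x ^ 2) = V t := rfl
      rw [h3]
      linarith
  -- boundary terms in time
  have hbd : ∀ t ∈ Icc 0 b, |∫ x in -b..b, r t x * w x * M t x| ≤ A * C * (A * C) := by
    intro t ht
    have c1 := crt t
    have c5 := cMt t
    refine (intervalIntegral.abs_integral_le_integral_abs hbb).trans ?_
    refine (int_mono (g := fun x => A * (A * C) * r t x) (by fun_prop) (by fun_prop)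
      fun x hx => ?_).trans ?_
    · rw [abs_mul, abs_mul, abs_of_nonneg (hr0 t x), abs_of_nonneg (hw0 x)]
      have h1 := mul_le_mul (hwA x hx).1 (hMb t ht x hx) (abs_nonneg _) hA
      have := mul_le_mul_of_nonneg_left h1 (hr0 t x)
      linarith
    · rw [intervalIntegral.integral_const_mul]
      have := mul_le_mul_of_nonneg_left (hB.mass t ht) (by positivity : 0 ≤ A * (A * C))
      linarith
  -- the space-time integrals
  set P : ℝ → ℝ := fun t => ∫ x in -b..b, k / 2 * (r t x * r t x ^ γ) * w x ^ 2 with hP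
  have cP : Continuous P := continuous_integral_slice
    (f := fun t x => k / 2 * (r t x * r t x ^ γ) * w x ^ 2)
    (((cr.mul crg).const_mul _).mul (cwz.pow 2)) _ _
  have hslice : ∀ t ∈ Icc 0 b, ∫ x in -b..b, (M t x * w' x * (r t x * u t x)
        + ε * (r t x * ux t x) * w x ^ 2 + r t x * w x * J t x
        - k * (r t x * r t x ^ γ) * w x ^ 2) ≤
      A * C * (A * C) + A ^ 2 * V t + 2 * b * (A ^ 2 * S)
        + A * C * (A * (C + k * C + 2 * b * |ε₀| + V t)) - P t := by
    intro t ht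
    have c1 := crt t
    have c2 := cut t
    have c3 := cuxt t
    have c4 := crgt t
    have c5 := cMt t
    have c6 := cJt t
    set E := C + k * C + 2 * b * |ε₀| + V t with hE
    have hV0 : 0 ≤ V t := intervalIntegral.integral_nonneg hbb fun x _ =>
      mul_nonneg hε0.le (sq_nonneg _)
    have hE0 : 0 ≤ E := by positivity
    refine (int_mono (g := fun x => A * (A * C) * |r t x * u t x| + A ^ 2 * (ε * ux t x ^ 2)
      + A ^ 2 * S + A * (A * E) * r t x - k / 2 * (r t x * r t x ^ γ) * w x ^ 2)
      (by fun_prop) (by fun_prop) fun x hx => ?_).trans ?_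
    · have a1 : M t x * w' x * (r t x * u t x) ≤ A * (A * C) * |r t x * u t x| := by
        refine (le_abs_self _).trans ?_
        rw [abs_mul, abs_mul]
        refine mul_le_mul_of_nonneg_right ?_ (abs_nonneg _)
        rw [mul_comm]
        exact mul_le_mul (hwA x hx).2 (hMb t ht x hx) (abs_nonneg _) hA
      have hw2 : w x ^ 2 ≤ A ^ 2 := pow_le_pow_left₀ (hw0 x) (hwA x hx).1 2
      have a2 : ε * (r t x * ux t x) * w x ^ 2 ≤ A ^ 2 * (ε * ux t x ^ 2) + A ^ 2 * S
          + k / 2 * (r t x * r t x ^ γ) * w x ^ 2 := by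
        have b1 : ε * (r t x * ux t x) ≤ ε * ux t x ^ 2 + |ε₀| * r t x ^ 2 := by
          have b2 := mul_nonneg hε0.le (sq_nonneg (ux t x - r t x))
          have b3 := mul_le_mul_of_nonneg_right hε1 (sq_nonneg (r t x))
          have b4 := mul_nonneg hε0.le (sq_nonneg (ux t x))
          have b5 := mul_nonneg hε0.le (sq_nonneg (r t x))
          linarith
        have b2 := hrS (r t x) (h.pos t x)
        have b3 : ε * (r t x * ux t x) ≤ ε * ux t x ^ 2 + S + k / 2 * (r t x * r t x ^ γ) := by
          linarith
        have b4 := mul_le_mul_of_nonneg_right b3 (sq_nonneg (w x))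
        have b5 : 0 ≤ ε * ux t x ^ 2 + S := by positivity
        have b6 := mul_le_mul_of_nonneg_left hw2 b5
        linarith
      have a3 : r t x * w x * J t x ≤ A * (A * E) * r t x := by
        have b1 := mul_le_mul (hwA x hx).1 (hJb t ht x hx) (abs_nonneg _) hA
        have b2 : w x * J t x ≤ w x * |J t x| := mul_le_mul_of_nonneg_left (le_abs_self _) (hw0 x)
        have b3 := mul_le_mul_of_nonneg_left (b2.trans b1) (hr0 t x)
        linarith
      linarith
    · have i1 : IntervalIntegrable (fun x => A * (A * C) * |r t x * u t x|) volume (-b) b :=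
        Continuous.intervalIntegrable (by fun_prop) _ _
      have i2 : IntervalIntegrable (fun x => A ^ 2 * (ε * ux t x ^ 2)) volume (-b) b :=
        Continuous.intervalIntegrable (by fun_prop) _ _
      have i3 : IntervalIntegrable (fun x => A * (A * E) * r t x) volume (-b) b :=
        Continuous.intervalIntegrable (by fun_prop) _ _
      have i4 : IntervalIntegrable (fun x => k / 2 * (r t x * r t x ^ γ) * w x ^ 2) volume (-b) b :=
        Continuous.intervalIntegrable (by fun_prop) _ _
      rw [intervalIntegral.integral_sub (((i1.add i2).add intervalIntegrable_const).add i3) i4,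
        intervalIntegral.integral_add ((i1.add i2).add intervalIntegrable_const) i3,
        intervalIntegral.integral_add (i1.add i2) intervalIntegrable_const,
        intervalIntegral.integral_add i1 i2, intervalIntegral.integral_const,
        intervalIntegral.integral_const_mul, intervalIntegral.integral_const_mul,
        intervalIntegral.integral_const_mul, intervalIntegral.integral_const_mul, smul_eq_mul]
      have a1 := mul_le_mul_of_nonneg_left (hmom t ht) (by positivity : 0 ≤ A * (A * C))
      have a2 := mul_le_mul_of_nonneg_left (hB.mass t ht) (by positivity : 0 ≤ A * (A * E))
      have a3 : (ε * ∫ x in -b..b, ux t x ^ 2) = V t :=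
        (intervalIntegral.integral_const_mul _ _).symm
      have a4 : (∫ x in -b..b, k / 2 * (r t x * r t x ^ γ) * w x ^ 2) = P t := rfl
      rw [a3, a4]
      linarith
  have hPint : ∫ t in (0 : ℝ)..b, P t ≤ D := by
    set q : ℝ → ℝ := fun t => ∫ x in -b..b, (M t x * w' x * (r t x * u t x)
        + ε * (r t x * ux t x) * w x ^ 2 + r t x * w x * J t x
        - k * (r t x * r t x ^ γ) * w x ^ 2) with hq
    have cq : Continuous q := continuous_integral_slice
      (f := fun t x => M t x * w' x * (r t x * u t x)
        + ε * (r t x * ux t x) * w x ^ 2 + r t x * w x * J t x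
        - k * (r t x * r t x ^ γ) * w x ^ 2)
      (((((cM.mul cwz').mul (cr.mul cu)).add (((cr.mul cux).const_mul ε).mul (cwz.pow 2))).add
        ((cr.mul cwz).mul cJ)).sub (((cr.mul crg).const_mul k).mul (cwz.pow 2))) _ _
    have h1 : ∫ t in (0 : ℝ)..b, q t ≤ ∫ t in (0 : ℝ)..b, ((A * C * (A * C) + 2 * b * (A ^ 2 * S)
        + A * C * (A * (C + k * C + 2 * b * |ε₀|))) + (A ^ 2 + A * C * A) * V t - P t) := by
      refine intervalIntegral.integral_mono_on hb0.le (cq.intervalIntegrable _ _)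
        (Continuous.intervalIntegrable (by fun_prop) _ _) fun t ht => ?_
      have := hslice t ht
      simp only [hq]
      linarith
    have iV : IntervalIntegrable (fun t => (A ^ 2 + A * C * A) * V t) volume 0 b :=
      (cV.const_mul _).intervalIntegrable _ _
    rw [intervalIntegral.integral_sub (intervalIntegrable_const.add iV) (cP.intervalIntegrable _ _),
      intervalIntegral.integral_add intervalIntegrable_const iV, intervalIntegral.integral_const,
      intervalIntegral.integral_const_mul, smul_eq_mul] at h1
    have h2 := (abs_le.1 (hbd b ⟨hb0.le, le_rfl⟩)).1
    have h3 := (abs_le.1 (hbd 0 ⟨le_rfl, hb0.le⟩)).2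
    have h4 := mul_le_mul_of_nonneg_left hVint (by positivity : 0 ≤ A ^ 2 + A * C * A)
    have h5 : (∫ x in -b..b, r b x * w x * M b x) - (∫ x in -b..b, r 0 x * w x * M 0 x)
      = ∫ t in (0 : ℝ)..b, q t := hid
    rw [hD]
    linarith
  -- restrict to the smaller box
  rw [le_div_iff₀ (by positivity), mul_comm, ← intervalIntegral.integral_const_mul]
  have hP0 : ∀ t, 0 ≤ P t := fun t => intervalIntegral.integral_nonneg hbb fun x _ => by
    have := hr0 t x
    have := hrg0 t x
    positivity
  have hNb : N ≤ b := by linarith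
  refine le_trans ?_ ((intervalIntegral.integral_mono_interval le_rfl hN.le hNb
    (Eventually.of_forall hP0) (cP.intervalIntegrable _ _)).trans hPint)
  refine intervalIntegral.integral_mono_on hN.le
    (((continuous_integral_slice (f := fun t x => r t x * r t x ^ γ) (cr.mul crg) _ _).const_mul
      _).intervalIntegrable _ _) (cP.intervalIntegrable _ _) fun t _ => ?_
  have c1 := crt t
  have c4 := crgt t
  rw [← intervalIntegral.integral_const_mul]
  refine (intervalIntegral.integral_mono_on (g := fun x => k / 2 * (r t x * r t x ^ γ) * w x ^ 2)
    (by linarith) (Continuous.intervalIntegrable (by fun_prop) _ _)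
    (Continuous.intervalIntegrable (by fun_prop) _ _) fun x hx => ?_).trans
    (intervalIntegral.integral_mono_interval (by linarith) (by linarith) hNb
      (Eventually.of_forall fun x => ?_) (Continuous.intervalIntegrable (by fun_prop) _ _))
  · have h1 := one_le_bumpWeight hN.le hx
    have h2 : 1 ≤ w x ^ 2 := one_le_pow₀ h1
    have h3 : 0 ≤ k / 2 * (r t x * r t x ^ γ) := by
      have := hr0 t x
      have := hrg0 t x
      positivity
    exact le_mul_of_one_le_right h3 h2
  · have := hr0 t x
    have := hrg0 t x
    simp only [Pi.zero_apply]
    positivity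

open scoped Interval in
/-- Pointwise bound on the density at positive viscosity. -/
theorem ViscousFlow.density_le {γ ε ρl ρr ul ur : ℝ} {r u rx rxx ux uxx : ℝ → ℝ → ℝ}
    (h : ViscousFlow γ ε ρl ρr ul ur r u rx rxx ux uxx) {N C : ℝ} (hN : 0 < N)
    (hB : FlowBounds γ ε N C r u rx ux) {d : ℝ} (hd : 0 < d) (hε : d ≤ ε) {t x : ℝ}
    (ht : t ∈ Icc 0 N) (hx : x ∈ Icc (-N) N) :
    r t x ≤ Real.exp ((C + C / d ^ 2) / 2) * C / (2 * N) := by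
  have hNN : -N ≤ N := by linarith
  have crt := continuous_slice h.cont_r t
  have crxt := continuous_slice h.cont_rx t
  have hp := h.pos t
  have hp3 : ∀ y, r t y ^ 3 ≠ 0 := fun y => (pow_pos (hp y) 3).ne'
  have hp1 : ∀ y, r t y ≠ 0 := fun y => (hp y).ne'
  have cq : Continuous fun y => rx t y ^ 2 / r t y ^ 3 := by fun_prop (disch := assumption)
  have cl : Continuous fun y => rx t y / r t y := by fun_prop (disch := assumption)
  set Λ := (C + C / d ^ 2) / 2 with hΛ
  have hgrad : ∫ y in -N..N, rx t y ^ 2 / r t y ^ 3 ≤ C / d ^ 2 := by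
    have h1 := hB.gradient t ht
    rw [intervalIntegral.integral_const_mul] at h1
    have h2 : 0 ≤ ∫ y in -N..N, rx t y ^ 2 / r t y ^ 3 :=
      intervalIntegral.integral_nonneg hNN fun y _ => by have := hp y; positivity
    rw [le_div_iff₀ (by positivity), mul_comm]
    exact (mul_le_mul_of_nonneg_right (by gcongr) h2).trans h1
  -- Since |ρ_x/ρ| ≤ (ρ + ρ_x²/ρ³)/2, mass and weighted gradient bound the total variation of log ρ.
  -- Values of ρ at two points of the interval are therefore comparable.
  have hvar : ∫ y in -N..N, |rx t y / r t y| ≤ Λ := by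
    have h1 : ∫ y in -N..N, |rx t y / r t y| ≤
        ∫ y in -N..N, (r t y + rx t y ^ 2 / r t y ^ 3) / 2 := by
      refine intervalIntegral.integral_mono_on hNN (cl.abs.intervalIntegrable _ _)
        (((crt.add cq).div_const 2).intervalIntegrable _ _) fun y _ => ?_
      have hy := hp y
      have e1 : rx t y ^ 2 / r t y ^ 3 = (rx t y / r t y) ^ 2 / r t y := by field_simp
      rw [e1, ← sq_abs (rx t y / r t y)]
      generalize |rx t y / r t y| = s
      have e2 : (r t y + s ^ 2 / r t y) / 2 - s = (r t y - s) ^ 2 / (2 * r t y) := by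
        field_simp; ring
      have : 0 ≤ (r t y - s) ^ 2 / (2 * r t y) := by positivity
      linarith
    rw [intervalIntegral.integral_div, intervalIntegral.integral_add (crt.intervalIntegrable _ _)
      (cq.intervalIntegrable _ _)] at h1
    have := hB.mass t ht
    linarith
  have hcmp : ∀ y ∈ Icc (-N) N, r t x ≤ Real.exp Λ * r t y := by
    intro y hy
    have h1 : ∫ z in y..x, rx t z / r t z = Real.log (r t x) - Real.log (r t y) :=
      intervalIntegral.integral_eq_sub_of_hasDerivAt (fun z _ => (h.r_x t z).log (hp1 z))
        (cl.intervalIntegrable _ _)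
    have h2 : |∫ z in y..x, rx t z / r t z| ≤ Λ := by
      have h3 : |∫ z in y..x, rx t z / r t z| ≤ |∫ z in y..x, ‖rx t z / r t z‖| :=
        intervalIntegral.norm_integral_le_abs_integral_norm (f := fun z => rx t z / r t z)
      have hsub : Ι y x ⊆ Ι (-N) N := by
        rw [uIoc_of_le hNN]
        intro z hz
        rcases le_total y x with hyx | hyx
        · rw [uIoc_of_le hyx] at hz
          exact ⟨hy.1.trans_lt hz.1, hz.2.trans hx.2⟩
        · rw [uIoc_of_ge hyx] at hz
          exact ⟨hx.1.trans_lt hz.1, hz.2.trans hy.2⟩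
      have h4 := intervalIntegral.abs_integral_mono_interval (μ := volume) hsub
        (Eventually.of_forall fun z => abs_nonneg (rx t z / r t z)) (cl.abs.intervalIntegrable _ _)
      rw [abs_of_nonneg (intervalIntegral.integral_nonneg hNN fun z _ => abs_nonneg _)] at h4
      exact h3.trans (h4.trans hvar)
    rw [h1] at h2
    have h3 := (abs_le.1 h2).2
    have h4 : Real.log (r t x) ≤ Λ + Real.log (r t y) := by linarith
    have h5 := Real.exp_le_exp.2 h4
    rwa [Real.exp_log (hp x), Real.exp_add, Real.exp_log (hp y)] at h5
  -- Integrating the comparison in y replaces the unknown value ρ(y) by the mass.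
  have hfin : ∫ _ in -N..N, r t x ≤ ∫ y in -N..N, Real.exp Λ * r t y :=
    intervalIntegral.integral_mono_on hNN intervalIntegrable_const
      ((crt.const_mul _).intervalIntegrable _ _) hcmp
  rw [intervalIntegral.integral_const, intervalIntegral.integral_const_mul, smul_eq_mul] at hfin
  have h6 := mul_le_mul_of_nonneg_left (hB.mass t ht) (Real.exp_pos Λ).le
  rw [le_div_iff₀ (by positivity)]
  linarith

/-! ### Weighted means along segments -/

/-- `∫ h(τ) g(b + c τ) dτ`. -/
noncomputable def kernelMean (h g : ℝ → ℝ) (b c : ℝ) : ℝ := ∫ τ, h τ * g (b + c * τ)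

theorem integrable_kernelMean {h g : ℝ → ℝ} {G : ℝ} (hh : Integrable h) (hg : Continuous g)
    (hG : ∀ x, |g x| ≤ G) (b c : ℝ) : Integrable fun τ => h τ * g (b + c * τ) := by
  have h1 : AEStronglyMeasurable (fun τ => g (b + c * τ)) volume :=
    (hg.comp (by fun_prop)).aestronglyMeasurable
  exact hh.mul_bdd h1 (Eventually.of_forall fun τ => hG _)

theorem continuous_kernelMean {h g : ℝ → ℝ} {G : ℝ} (hh : Integrable h) (hg : Continuous g)
    (hG : ∀ x, |g x| ≤ G) : Continuous fun p : ℝ × ℝ => kernelMean h g p.1 p.2 := by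
  refine continuous_of_dominated (bound := fun τ => |h τ| * G)
    (fun p => (integrable_kernelMean hh hg hG p.1 p.2).aestronglyMeasurable)
    (fun p => Eventually.of_forall fun τ => ?_) (hh.abs.mul_const G)
    (Eventually.of_forall fun τ => ?_)
  · rw [norm_mul, Real.norm_eq_abs, Real.norm_eq_abs]
    exact mul_le_mul_of_nonneg_left (hG _) (abs_nonneg _)
  · exact continuous_const.mul (hg.comp (by fun_prop))

theorem abs_kernelMean_le {h g : ℝ → ℝ} {G : ℝ} (hh : Integrable h)
    (hG : ∀ x, |g x| ≤ G) (b c : ℝ) : |kernelMean h g b c| ≤ G * ∫ τ, |h τ| := by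
  rw [← integral_const_mul, ← Real.norm_eq_abs]
  refine norm_integral_le_of_norm_le (hh.abs.const_mul G) (Eventually.of_forall fun τ => ?_)
  rw [norm_mul, Real.norm_eq_abs, Real.norm_eq_abs, mul_comm]
  exact mul_le_mul_of_nonneg_right (hG _) (abs_nonneg _)

/-- Dominated differentiation in the pair (b, c) with majorant G'(|h| + |τh|), then the chain rule.
Each derivative in c brings one more factor τ into the weight. -/
theorem hasDerivAt_kernelMean {h g g' : ℝ → ℝ} {G G' : ℝ} (hh : Integrable h)
    (hh1 : Integrable fun τ => τ * h τ) (hg : ∀ x, HasDerivAt g (g' x) x) (hg' : Continuous g')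
    (hG : ∀ x, |g x| ≤ G) (hG' : ∀ x, |g' x| ≤ G') {b c : ℝ → ℝ} {b' c' s : ℝ}
    (hb : HasDerivAt b b' s) (hc : HasDerivAt c c' s) :
    HasDerivAt (fun y => kernelMean h g (b y) (c y))
      (b' * kernelMean h g' (b s) (c s) + c' * kernelMean (fun τ => τ * h τ) g' (b s) (c s)) s := by
  have hgc : Continuous g := continuous_iff_continuousAt.2 fun x => (hg x).continuousAt
  set F' : ℝ × ℝ → ℝ → (ℝ × ℝ →L[ℝ] ℝ) := fun p τ => (h τ * g' (p.1 + p.2 * τ)) •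
    ContinuousLinearMap.fst ℝ ℝ ℝ + (τ * h τ * g' (p.1 + p.2 * τ)) • ContinuousLinearMap.snd ℝ ℝ ℝ
    with hF'
  have hi1 := fun p : ℝ × ℝ => integrable_kernelMean hh hg' hG' p.1 p.2
  have hi2 := fun p : ℝ × ℝ => integrable_kernelMean hh1 hg' hG' p.1 p.2
  have hF'i : ∀ p, Integrable (F' p) := fun p => by
    have := ((hi1 p).smul_const (ContinuousLinearMap.fst ℝ ℝ ℝ)).add
      ((hi2 p).smul_const (ContinuousLinearMap.snd ℝ ℝ ℝ))
    exact this
  have key : HasFDerivAt (fun p : ℝ × ℝ => ∫ τ, h τ * g (p.1 + p.2 * τ))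
      (∫ τ, F' (b s, c s) τ) (b s, c s) := by
    refine hasFDerivAt_integral_of_dominated_of_fderiv_le (s := univ)
      (bound := fun τ => G' * (|h τ| + |τ * h τ|)) univ_mem
      (Eventually.of_forall fun p =>
        (integrable_kernelMean hh hgc hG p.1 p.2).aestronglyMeasurable)
      (integrable_kernelMean hh hgc hG _ _) (hF'i _).aestronglyMeasurable
      (Eventually.of_forall fun τ p _ => ?_) ((hh.abs.add hh1.abs).const_mul G')
      (Eventually.of_forall fun τ p _ => ?_)
    · have h1 : ‖(h τ * g' (p.1 + p.2 * τ)) • ContinuousLinearMap.fst ℝ ℝ ℝ‖ ≤ G' * |h τ| := by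
        rw [norm_smul, norm_mul, Real.norm_eq_abs, Real.norm_eq_abs]
        have := ContinuousLinearMap.norm_fst_le ℝ ℝ ℝ
        calc _ ≤ |h τ| * |g' (p.1 + p.2 * τ)| * 1 := by gcongr
          _ ≤ |h τ| * G' * 1 := by gcongr; exact hG' _
          _ = G' * |h τ| := by ring
      have h2 : ‖(τ * h τ * g' (p.1 + p.2 * τ)) • ContinuousLinearMap.snd ℝ ℝ ℝ‖ ≤
          G' * |τ * h τ| := by
        rw [norm_smul, norm_mul, Real.norm_eq_abs, Real.norm_eq_abs]
        have := ContinuousLinearMap.norm_snd_le ℝ ℝ ℝ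
        calc _ ≤ |τ * h τ| * |g' (p.1 + p.2 * τ)| * 1 := by gcongr
          _ ≤ |τ * h τ| * G' * 1 := by gcongr; exact hG' _
          _ = G' * |τ * h τ| := by ring
      exact (norm_add_le _ _).trans (by linarith)
    · have h1 : HasFDerivAt (fun p : ℝ × ℝ => p.1 + p.2 * τ)
          (ContinuousLinearMap.fst ℝ ℝ ℝ + τ • ContinuousLinearMap.snd ℝ ℝ ℝ) p :=
        hasFDerivAt_fst.add (hasFDerivAt_snd.mul_const τ)
      have h2 := ((hg (p.1 + p.2 * τ)).comp_hasFDerivAt p h1).const_mul (h τ)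
      refine h2.congr_fderiv ?_
      simp only [hF']
      ext <;> simp <;> ring
  have h3 := key.comp_hasDerivAt s (hb.prodMk hc)
  refine h3.congr_deriv ?_
  rw [ContinuousLinearMap.integral_apply (hF'i _)]
  have e : ∀ τ, F' (b s, c s) τ (b', c') = b' * (h τ * g' (b s + c s * τ))
      + c' * (τ * h τ * g' (b s + c s * τ)) := by
    intro τ
    simp [hF']
    ring
  simp_rw [e]
  have i1 : Integrable fun τ => b' * (h τ * g' (b s + c s * τ)) := (hi1 (b s, c s)).const_mul b'
  have i2 : Integrable fun τ => c' * (τ * h τ * g' (b s + c s * τ)) :=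
    (hi2 (b s, c s)).const_mul c'
  rw [integral_add i1 i2, integral_const_mul, integral_const_mul]
  rfl

/-! ### The weight of the entropy kernel -/

/-- The profile `(1 - τ²)_+^λ` of the entropy kernel. -/
noncomputable def kernelWeight (l τ : ℝ) : ℝ := posPartPow (1 - τ ^ 2) l

theorem kernelWeight_eq_zero {l τ : ℝ} (h : τ ∉ Ioo (-1 : ℝ) 1) : kernelWeight l τ = 0 := by
  unfold kernelWeight posPartPow
  rw [if_neg]
  intro h1
  exact h (abs_lt.1 ((sq_lt_one_iff_abs_lt_one τ).1 (by linarith)))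

theorem kernelWeight_of_mem {l τ : ℝ} (h : τ ∈ Ioo (-1 : ℝ) 1) :
    kernelWeight l τ = (1 - τ ^ 2) ^ l := by
  unfold kernelWeight posPartPow
  rw [if_pos]
  have := (sq_lt_one_iff_abs_lt_one τ).2 (abs_lt.2 h)
  linarith

theorem kernelWeight_nonneg (l τ : ℝ) : 0 ≤ kernelWeight l τ := by
  unfold kernelWeight posPartPow
  split_ifs with h
  · exact Real.rpow_nonneg h.le l
  · exact le_rfl

theorem measurable_kernelWeight (l : ℝ) : Measurable (kernelWeight l) := by
  unfold kernelWeight posPartPow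
  refine Measurable.ite (measurableSet_lt measurable_const (by fun_prop)) (by fun_prop)
    measurable_const

/-- For l ≤ 0, write 1 - τ² = (1 - τ)(1 + τ): one factor is at least 1 on each half of the interval,
so the weight is below the power of the other factor, integrable because l > -1. For l ≥ 0 it is
bounded by 1. -/
theorem integrable_kernelWeight {l : ℝ} (hl : -1 < l) : Integrable (kernelWeight l) := by
  have h1 : IntervalIntegrable (fun τ : ℝ => 1 + (1 - τ) ^ l + (1 + τ) ^ l) volume (-1) 1 := by
    have a1 : IntervalIntegrable (fun x : ℝ => x ^ l) volume 0 2 :=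
      intervalIntegral.intervalIntegrable_rpow' hl
    have a2 := a1.comp_sub_left 1
    have a3 := a1.comp_add_left 1
    norm_num at a2 a3
    exact (intervalIntegrable_const.add a2.symm).add a3
  have h2 : IntegrableOn (kernelWeight l) (Ioo (-1) 1) := by
    have h3 : IntegrableOn (fun τ : ℝ => 1 + (1 - τ) ^ l + (1 + τ) ^ l) (Ioo (-1) 1) :=
      ((intervalIntegrable_iff_integrableOn_Ioc_of_le (by norm_num)).1 h1).mono_set Ioo_subset_Ioc_self
    refine Integrable.mono' h3 (measurable_kernelWeight l).aestronglyMeasurable ?_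
    refine (ae_restrict_iff' measurableSet_Ioo).2 (Eventually.of_forall fun τ hτ => ?_)
    rw [Real.norm_of_nonneg (kernelWeight_nonneg l τ), kernelWeight_of_mem hτ]
    have p1 : 0 < 1 - τ := by linarith [hτ.2]
    have p2 : 0 < 1 + τ := by linarith [hτ.1]
    have e : (1 - τ ^ 2) = (1 - τ) * (1 + τ) := by ring
    have q1 := Real.rpow_nonneg p1.le l
    have q2 := Real.rpow_nonneg p2.le l
    rcases le_total 0 l with hl0 | hl0
    · have : (1 - τ ^ 2) ^ l ≤ 1 := Real.rpow_le_one (by rw [e]; positivity)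
        (by nlinarith [sq_nonneg τ]) hl0
      linarith
    · rw [e, Real.mul_rpow p1.le p2.le]
      rcases le_total 0 τ with h0 | h0
      · have : (1 + τ) ^ l ≤ 1 := Real.rpow_le_one_of_one_le_of_nonpos (by linarith) hl0
        nlinarith
      · have : (1 - τ) ^ l ≤ 1 := Real.rpow_le_one_of_one_le_of_nonpos (by linarith) hl0
        nlinarith
  rw [← integrableOn_univ]
  refine h2.of_forall_sdiff_eq_zero MeasurableSet.univ fun τ hτ => kernelWeight_eq_zero hτ.2

theorem integrable_mul_of_support {h : ℝ → ℝ} (hh : Integrable h)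
    (hs : ∀ τ, τ ∉ Ioo (-1 : ℝ) 1 → h τ = 0) : Integrable fun τ => τ * h τ := by
  refine hh.mono (continuous_id.aestronglyMeasurable.mul hh.aestronglyMeasurable)
    (Eventually.of_forall fun τ => ?_)
  by_cases h1 : τ ∈ Ioo (-1 : ℝ) 1
  · rw [norm_mul]
    exact mul_le_of_le_one_left (norm_nonneg _) (abs_lt.2 h1).le
  · simp [hs τ h1]

/-- Since 2λ > -1, this makes the weight of the entropy kernel square integrable, which the decay of
the means needs. -/
theorem kernelWeight_sq (l τ : ℝ) : kernelWeight l τ ^ 2 = kernelWeight (2 * l) τ := by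
  unfold kernelWeight posPartPow
  split_ifs with h
  · rw [← Real.rpow_natCast, ← Real.rpow_mul h.le]; ring_nf
  · norm_num

/-! ### Representation of the weak entropy pairs -/

theorem gasLambda_gt {γ : ℝ} (hγ : 1 < γ) : -(1 / 2) < gasLambda γ := by
  unfold gasLambda
  rw [lt_div_iff₀ (by linarith)]
  linarith

theorem gasTheta_pos {γ : ℝ} (hγ : 1 < γ) : 0 < gasTheta γ := by
  unfold gasTheta; linarith

theorem gasTheta_mul_gasLambda {γ : ℝ} (hγ : 1 < γ) :
    2 * gasTheta γ * gasLambda γ = 1 - gasTheta γ := by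
  unfold gasTheta gasLambda
  have : γ - 1 ≠ 0 := by linarith
  field_simp
  ring

theorem gasKappa_mul {γ : ℝ} (hγ : 1 < γ) : gasKappa γ * γ = gasTheta γ ^ 2 := by
  unfold gasTheta gasKappa
  have : γ ≠ 0 := by linarith
  field_simp
  norm_num

theorem posPartPow_mul {k : ℝ} (hk : 0 < k) (y l : ℝ) :
    posPartPow (k * y) l = k ^ l * posPartPow y l := by
  unfold posPartPow
  by_cases h : 0 < y
  · rw [if_pos h, if_pos (by positivity), Real.mul_rpow hk.le h.le]
  · rw [if_neg h, if_neg (by rw [mul_pos_iff_of_pos_left hk]; exact h), mul_zero]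

/-- The substitution v = ρ^θ τ extracts ρ^(2θλ) = ρ^(1-θ) from the kernel; together with the
Jacobian ρ^θ exactly one power of ρ appears. -/
theorem entropyKernel_scale {γ r : ℝ} (hγ : 1 < γ) (hr : 0 < r) (τ : ℝ) :
    r ^ gasTheta γ * entropyKernel γ r (r ^ gasTheta γ * τ) =
      r * kernelWeight (gasLambda γ) τ := by
  have e1 : r ^ (2 * gasTheta γ) = (r ^ gasTheta γ) ^ 2 := by
    rw [← Real.rpow_natCast, ← Real.rpow_mul hr.le]; ring_nf
  have e2 : r ^ (2 * gasTheta γ) - (r ^ gasTheta γ * τ) ^ 2 = r ^ (2 * gasTheta γ) * (1 - τ ^ 2) := by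
    rw [e1]; ring
  rw [entropyKernel, e2, posPartPow_mul (Real.rpow_pos_of_pos hr _), ← Real.rpow_mul hr.le,
    ← mul_assoc, ← Real.rpow_add hr, gasTheta_mul_gasLambda hγ]
  norm_num [kernelWeight]

theorem integral_eq_mul_integral_affine (F : ℝ → ℝ) (b : ℝ) {c : ℝ} (hc : 0 < c) :
    ∫ s, F s = c * ∫ τ, F (b + c * τ) := by
  have h1 := MeasureTheory.Measure.integral_comp_mul_left (fun s => F (b + s)) c
  rw [h1, integral_add_left_eq_self F b, abs_of_pos (inv_pos.2 hc), smul_eq_mul,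
    mul_inv_cancel_left₀ hc.ne']

theorem weakEntropy_eq {γ r : ℝ} (hγ : 1 < γ) (hr : 0 < r) (ψ : ℝ → ℝ) (u : ℝ) :
    weakEntropy γ ψ r (r * u) =
      r * kernelMean (kernelWeight (gasLambda γ)) ψ u (r ^ gasTheta γ) := by
  have hc : 0 < r ^ gasTheta γ := Real.rpow_pos_of_pos hr _
  rw [weakEntropy, mul_div_cancel_left₀ u hr.ne', integral_eq_mul_integral_affine _ u hc,
    ← integral_const_mul, kernelMean, ← integral_const_mul]
  congr 1
  funext τ
  rw [add_sub_cancel_left, ← mul_assoc, entropyKernel_scale hγ hr, mul_assoc]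

theorem weakEntropyFlux_eq {γ r : ℝ} (hγ : 1 < γ) (hr : 0 < r) {ψ : ℝ → ℝ} (hψ : Continuous ψ)
    {G : ℝ} (hG : ∀ x, |ψ x| ≤ G) (u : ℝ) :
    weakEntropyFlux γ ψ r (r * u) =
      r * (u * kernelMean (kernelWeight (gasLambda γ)) ψ u (r ^ gasTheta γ) + gasTheta γ *
        r ^ gasTheta γ * kernelMean (fun τ => τ * kernelWeight (gasLambda γ) τ) ψ u
          (r ^ gasTheta γ)) := by
  have hc : 0 < r ^ gasTheta γ := Real.rpow_pos_of_pos hr _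
  have hw : Integrable (kernelWeight (gasLambda γ)) :=
    integrable_kernelWeight (by linarith [gasLambda_gt hγ])
  have hw1 := integrable_mul_of_support hw fun τ => kernelWeight_eq_zero
  rw [weakEntropyFlux, mul_div_cancel_left₀ u hr.ne', integral_eq_mul_integral_affine _ u hc,
    ← integral_const_mul, kernelMean, kernelMean, ← integral_const_mul, ← integral_const_mul,
    ← integral_add ((integrable_kernelMean hw hψ hG _ _).const_mul _)
      ((integrable_kernelMean hw1 hψ hG _ _).const_mul _), ← integral_const_mul]
  congr 1
  funext τ
  rw [add_sub_cancel_left]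
  have := entropyKernel_scale hγ hr τ
  linear_combination (gasTheta γ * (u + r ^ gasTheta γ * τ) + (1 - gasTheta γ) * u) *
    ψ (u + r ^ gasTheta γ * τ) * this

/-- Integration by parts against (1 - τ²)^(λ+1), which vanishes at τ = ±1 and has derivative -2(λ+1)
τ (1 - τ²)^λ. The factor on the left is 2θ(λ+1) = 1 + θ. This relation is what makes η and q an
entropy pair. -/
theorem kernelMean_parts {γ : ℝ} (hγ : 1 < γ) {ψ ψ' : ℝ → ℝ} {G G' : ℝ}
    (hψ : ∀ x, HasDerivAt ψ (ψ' x) x) (hψ' : Continuous ψ') (hG : ∀ x, |ψ x| ≤ G)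
    (hG' : ∀ x, |ψ' x| ≤ G') (b c : ℝ) :
    (1 + gasTheta γ) * kernelMean (fun τ => τ * kernelWeight (gasLambda γ) τ) ψ b c =
      gasTheta γ * c * (kernelMean (kernelWeight (gasLambda γ)) ψ' b c
        - kernelMean (fun τ => τ * (τ * kernelWeight (gasLambda γ) τ)) ψ' b c) := by
  have hl := gasLambda_gt hγ
  set l := gasLambda γ with hld
  have hψc : Continuous ψ := continuous_iff_continuousAt.2 fun x => (hψ x).continuousAt
  have hw : Integrable (kernelWeight l) := integrable_kernelWeight (by linarith)
  have hw1 := integrable_mul_of_support hw fun τ => kernelWeight_eq_zero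
  have hw2 := integrable_mul_of_support hw1 fun τ hτ => by rw [kernelWeight_eq_zero hτ, mul_zero]
  have i0 := integrable_kernelMean hw hψ' hG' b c
  have i1 := integrable_kernelMean hw1 hψc hG b c
  have i2 := integrable_kernelMean hw2 hψ' hG' b c
  set D : ℝ → ℝ := fun τ => -(2 * (l + 1)) * (τ * kernelWeight l τ * ψ (b + c * τ))
    + c * (kernelWeight l τ * ψ' (b + c * τ) - τ * (τ * kernelWeight l τ) * ψ' (b + c * τ)) with hD
  have iD : Integrable D := (i1.const_mul _).add ((i0.sub i2).const_mul c)
  have h0 : ∫ τ in (-1 : ℝ)..1, D τ = 0 := by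
    rw [intervalIntegral.integral_eq_sub_of_hasDerivAt_of_le (by norm_num)
      (f := fun τ => (1 - τ ^ 2) ^ (l + 1) * ψ (b + c * τ)) _ _ iD.intervalIntegrable]
    · norm_num [Real.zero_rpow (by linarith : l + 1 ≠ 0)]
    · refine Continuous.continuousOn (Continuous.mul ?_ (hψc.comp (by fun_prop)))
      exact (by fun_prop : Continuous fun τ : ℝ => 1 - τ ^ 2).rpow_const
        fun τ => Or.inr (by linarith)
    · intro τ hτ
      have hp : 0 < 1 - τ ^ 2 := by
        have := (sq_lt_one_iff_abs_lt_one τ).2 (abs_lt.2 hτ)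
        linarith
      have d1 : HasDerivAt (fun τ : ℝ => 1 - τ ^ 2) (-(2 * τ)) τ := by
        simpa using (hasDerivAt_pow 2 τ).const_sub 1
      have d2 : HasDerivAt (fun τ : ℝ => b + c * τ) c τ := by
        simpa using ((hasDerivAt_id τ).const_mul c).const_add b
      refine ((d1.rpow_const (p := l + 1) (Or.inl hp.ne')).mul ((hψ _).comp τ d2)).congr_deriv ?_
      simp only [hD, Function.comp]
      rw [kernelWeight_of_mem hτ, Real.rpow_add_one hp.ne', add_sub_cancel_right]
      ring
  have h1 : ∫ τ in (-1 : ℝ)..1, D τ = ∫ τ, D τ := by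
    rw [intervalIntegral.integral_of_le (by norm_num)]
    refine setIntegral_eq_integral_of_forall_compl_eq_zero fun τ hτ => ?_
    have : kernelWeight l τ = 0 := kernelWeight_eq_zero fun h => hτ (Ioo_subset_Ioc_self h)
    simp [hD, this]
  have j1 : Integrable fun τ => -(2 * (l + 1)) * (τ * kernelWeight l τ * ψ (b + c * τ)) :=
    i1.const_mul _
  have j2 : Integrable fun τ => c * (kernelWeight l τ * ψ' (b + c * τ)
      - τ * (τ * kernelWeight l τ) * ψ' (b + c * τ)) := (i0.sub i2).const_mul c
  rw [h1] at h0
  simp only [hD] at h0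
  rw [integral_add j1 j2, integral_const_mul, integral_const_mul, integral_sub i0 i2] at h0
  have h2 := gasTheta_mul_gasLambda hγ
  rw [← hld] at h2
  unfold kernelMean
  linear_combination (-gasTheta γ) * h0 - h2 * ∫ τ, τ * kernelWeight l τ * ψ (b + c * τ)

/-- If |u| > R + c, then u + cτ stays outside the support of g for all |τ| < 1 and the mean is zero.
So a factor u may always be traded for R + c. -/
theorem abs_mul_kernelMean_le {h g : ℝ → ℝ} (hs : ∀ τ, τ ∉ Ioo (-1 : ℝ) 1 → h τ = 0) {R : ℝ}
    (hR : ∀ x, R < |x| → g x = 0) {u c : ℝ} (hc : 0 ≤ c) :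
    |u * kernelMean h g u c| ≤ (R + c) * |kernelMean h g u c| := by
  rw [abs_mul]
  by_cases hu : |u| ≤ R + c
  · exact mul_le_mul_of_nonneg_right hu (abs_nonneg _)
  · have : kernelMean h g u c = 0 := by
      unfold kernelMean
      rw [integral_eq_zero_of_ae (Eventually.of_forall fun τ => ?_)]
      by_cases hτ : τ ∈ Ioo (-1 : ℝ) 1
      · have h1 : |c * τ| ≤ c := by
          rw [abs_mul, abs_of_nonneg hc]
          exact mul_le_of_le_one_right hc (abs_lt.2 hτ).le
        have h2 : |u| - |c * τ| ≤ |u + c * τ| := by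
          have := abs_sub_abs_le_abs_sub u (-(c * τ))
          rwa [abs_neg, sub_neg_eq_add] at this
        simp [hR (u + c * τ) (by linarith)]
      · simp [hs τ hτ]
    simp [this]

/-- In the variable τ the function g lives on an interval of length 2R/c², on which |h| ≤ h²/c + c.
With c² = ρ^θ the means decay like ρ^(-θ/2); this gain makes q² of lower order than ρ^(γ+1). -/
theorem abs_kernelMean_decay {h g : ℝ → ℝ} (hh2 : Integrable fun τ => h τ ^ 2)
    {R G : ℝ} (hR0 : 0 ≤ R) (hG : ∀ x, |g x| ≤ G) (hR : ∀ x, R < |x| → g x = 0) {u c : ℝ}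
    (hc : 0 < c) :
    |kernelMean h g u (c ^ 2)| ≤ G * ((∫ τ, h τ ^ 2) + 2 * R) / c := by
  have hG0 : 0 ≤ G := (abs_nonneg _).trans (hG 0)
  set S : Set ℝ := Icc ((-R - u) / c ^ 2) ((R - u) / c ^ 2) with hS
  have hind : Integrable (S.indicator fun _ => (1 : ℝ)) :=
    (integrable_indicator_iff measurableSet_Icc).2 (integrableOn_const (by simp))
  have hvol : ∫ τ, S.indicator (fun _ => (1 : ℝ)) τ = 2 * R / c ^ 2 := by
    rw [integral_indicator_const _ measurableSet_Icc, smul_eq_mul, mul_one, Measure.real,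
      Real.volume_Icc, ENNReal.toReal_ofReal]
    · ring
    · rw [← sub_div]; apply div_nonneg <;> nlinarith [sq_nonneg c]
  have hb : |kernelMean h g u (c ^ 2)| ≤
      ∫ τ, G * (h τ ^ 2 / c + c * S.indicator (fun _ => (1 : ℝ)) τ) := by
    rw [← Real.norm_eq_abs]
    refine norm_integral_le_of_norm_le (((hh2.div_const c).add (hind.const_mul c)).const_mul G)
      (Eventually.of_forall fun τ => ?_)
    rw [norm_mul, Real.norm_eq_abs, Real.norm_eq_abs]
    by_cases hτ : τ ∈ S
    · rw [indicator_of_mem hτ, mul_one, mul_comm]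
      refine mul_le_mul (hG _) ?_ (abs_nonneg _) hG0
      rw [div_add' _ _ _ hc.ne', le_div_iff₀ hc]
      nlinarith [sq_nonneg (|h τ| - c), sq_abs (h τ), abs_nonneg (h τ)]
    · have : g (u + c ^ 2 * τ) = 0 := by
        refine hR _ ?_
        by_contra hcon
        apply hτ
        have h1 := abs_le.1 (not_lt.1 hcon)
        have hc2 : 0 < c ^ 2 := by positivity
        constructor
        · rw [div_le_iff₀ hc2]; linarith [h1.1]
        · rw [le_div_iff₀ hc2]; linarith [h1.2]
      rw [this, abs_zero, mul_zero, indicator_of_notMem hτ]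
      positivity
  refine hb.trans (le_of_eq ?_)
  rw [integral_const_mul, integral_add (hh2.div_const c) (hind.const_mul c), integral_div,
    integral_const_mul, hvol]
  field_simp

/-! ### The entropy pair along a flow -/

/-- The entropy `f`, the entropy flux `g` and the derivative `e` of the entropy in the momentum,
along a flow: their regularity, the entropy balance law, and bounds with a constant `A`. -/
structure EntropyFlow (γ ε A : ℝ) (r rx ux uxx f g e ex fx gx : ℝ → ℝ → ℝ) : Prop where
  cont_f : Continuous fun z : ℝ × ℝ => f z.1 z.2
  cont_g : Continuous fun z : ℝ × ℝ => g z.1 z.2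
  cont_e : Continuous fun z : ℝ × ℝ => e z.1 z.2
  cont_ex : Continuous fun z : ℝ × ℝ => ex z.1 z.2
  cont_fx : Continuous fun z : ℝ × ℝ => fx z.1 z.2
  cont_gx : Continuous fun z : ℝ × ℝ => gx z.1 z.2
  f_x : ∀ t x, HasDerivAt (f t) (fx t x) x
  g_x : ∀ t x, HasDerivAt (g t) (gx t x) x
  e_x : ∀ t x, HasDerivAt (e t) (ex t x) x
  f_t : ∀ t x, 0 < t → HasDerivAt (fun s => f s x) (-gx t x + ε * uxx t x * e t x) t
  e_le : ∀ t x, |e t x| ≤ A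
  ex_le : ∀ t x, ex t x ^ 2 ≤ A * (ux t x ^ 2 + r t x ^ (γ - 3) * rx t x ^ 2)
  growth : ∀ t x, f t x ^ 2 + g t x ^ 2 ≤ A * (r t x ^ 2 * (1 + r t x ^ gasTheta γ))
  gradient : ∀ t x, fx t x ^ 2 + gx t x ^ 2 ≤
    A * (((1 + r t x) * (1 + r t x ^ gasTheta γ) ^ 2) ^ 2 * (rx t x ^ 2 + ux t x ^ 2))

theorem exists_bound_of_hasCompactSupport {g : ℝ → ℝ} (hg : Continuous g)
    (hc : HasCompactSupport g) : ∃ G R : ℝ, 0 ≤ R ∧ 0 ≤ G ∧ (∀ x, |g x| ≤ G) ∧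
      ∀ x, R < |x| → g x = 0 := by
  obtain ⟨G, hG⟩ := hc.exists_bound_of_continuous hg
  obtain ⟨R, hR⟩ := hc.isCompact.isBounded.subset_closedBall 0
  refine ⟨G, max R 0, le_max_right _ _, (norm_nonneg _).trans (hG 0), hG, fun x hx => ?_⟩
  by_contra h
  have := hR (subset_tsupport g h)
  rw [mem_closedBall_zero_iff, Real.norm_eq_abs] at this
  exact absurd (this.trans (le_max_left _ _)) (not_le.2 hx)

theorem exists_derivs_of_contDiff_two {ψ : ℝ → ℝ} (hψ : ContDiff ℝ 2 ψ)
    (hψc : HasCompactSupport ψ) :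
    ∃ ψ' ψ'' : ℝ → ℝ, ∃ G R : ℝ, 0 ≤ R ∧ 0 ≤ G ∧ Continuous ψ'' ∧
      (∀ x, HasDerivAt ψ (ψ' x) x) ∧ (∀ x, HasDerivAt ψ' (ψ'' x) x) ∧
      (∀ x, |ψ x| ≤ G) ∧ (∀ x, |ψ' x| ≤ G) ∧ (∀ x, |ψ'' x| ≤ G) ∧
      (∀ x, R < |x| → ψ x = 0) ∧ ∀ x, R < |x| → ψ' x = 0 := by
  have h1 : ContDiff ℝ 1 (deriv ψ) := ((contDiff_succ_iff_deriv (n := 1)).1 hψ).2.2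
  have h2 : Continuous (deriv (deriv ψ)) := h1.continuous_deriv le_rfl
  obtain ⟨G0, R0, p0, q0, b0, c0⟩ := exists_bound_of_hasCompactSupport hψ.continuous hψc
  obtain ⟨G1, R1, p1, q1, b1, c1⟩ := exists_bound_of_hasCompactSupport h1.continuous hψc.deriv
  obtain ⟨G2, R2, p2, q2, b2, c2⟩ := exists_bound_of_hasCompactSupport h2 hψc.deriv.deriv
  refine ⟨deriv ψ, deriv (deriv ψ), G0 + G1 + G2, R0 + R1, by positivity, by positivity, h2,
    fun x => (hψ.differentiable (by norm_num) x).hasDerivAt,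
    fun x => (h1.differentiable (by norm_num) x).hasDerivAt,
    fun x => (b0 x).trans (by linarith), fun x => (b1 x).trans (by linarith),
    fun x => (b2 x).trans (by linarith), fun x hx => c0 x (by linarith),
    fun x hx => c1 x (by linarith)⟩

section algebra

variable {r u c D rx ux θ H0 H1 P0 P1 P2 : ℝ}

/-- In this section of algebra c is ρ^θ and D is ρ^(θ-1); `H0`, `H1` are the means of ψ against w
and τw, and `P0`, `P1`, `P2` those of ψ' against w, τw and τ²w. The possibly singular factor D
occurs only multiplied by r, and D r = c. -/
theorem abs_entropyGradient_le {C : ℝ} (hr : 0 < r) (hc : 0 < c) (hD : c = D * r) (h0 : |H0| ≤ C)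
    (h1 : |P0| ≤ C) (h2 : |P1| ≤ C) (hθ : 0 < θ) :
    |rx * H0 + r * (ux * P0 + θ * D * rx * P1)| ≤
      C * (1 + θ) * ((1 + r) * (1 + c) ^ 2) * (|rx| + |ux|) := by
  have hC : 0 ≤ C := (abs_nonneg _).trans h0
  have e1 : rx * H0 + r * (ux * P0 + θ * D * rx * P1) =
      rx * H0 + r * (ux * P0) + θ * c * (rx * P1) := by rw [hD]; ring
  rw [e1]
  have a1 : |rx * H0| ≤ |rx| * C := by
    rw [abs_mul]; exact mul_le_mul_of_nonneg_left h0 (abs_nonneg _)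
  have a2 : |r * (ux * P0)| ≤ r * (|ux| * C) := by
    rw [abs_mul, abs_mul, abs_of_pos hr]; gcongr
  have a3 : |θ * c * (rx * P1)| ≤ θ * c * (|rx| * C) := by
    rw [abs_mul, abs_mul rx, abs_of_pos (mul_pos hθ hc)]; gcongr
  have b1 : 1 ≤ (1 + r) * (1 + c) ^ 2 := by
    have : 0 ≤ r + (1 + r) * (2 * c + c ^ 2) := by positivity
    linarith
  have b2 : r ≤ (1 + r) * (1 + c) ^ 2 := by
    have : 0 ≤ 1 + (1 + r) * (2 * c + c ^ 2) := by positivity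
    linarith
  have b3 : c ≤ (1 + r) * (1 + c) ^ 2 := by
    have : 0 ≤ 1 + c + c ^ 2 + r * (1 + c) ^ 2 := by positivity
    linarith
  set W := (1 + r) * (1 + c) ^ 2
  have k1 : |rx| * C * 1 ≤ |rx| * C * W := by gcongr
  have k2 : |ux| * C * r ≤ |ux| * C * W := by gcongr
  have k3 : |rx| * C * θ * c ≤ |rx| * C * θ * W := by gcongr
  have k4 : 0 ≤ |ux| * C * θ * W := by positivity
  calc _ ≤ |rx| * C + r * (|ux| * C) + θ * c * (|rx| * C) :=
        (abs_add_three _ _ _).trans (by linarith)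
    _ ≤ _ := by nlinarith

/-- Every factor u is traded for R + c through the compact supports, so that the bound contains the
density but not the velocity. -/
theorem abs_fluxGradient_le {C R Q0 : ℝ} (hr : 0 < r) (hc : 0 < c) (hD : c = D * r) (hR : 0 ≤ R)
    (hu0 : |u * H0| ≤ (R + c) * |H0|) (hup0 : |u * P0| ≤ (R + c) * |P0|)
    (hup1 : |u * P1| ≤ (R + c) * |P1|)
    (h0 : |H0| ≤ C) (h1 : |H1| ≤ C) (k0 : |P0| ≤ C) (k1 : |P1| ≤ C) (k2 : |P2| ≤ C)
    (hθ : 0 < θ) (hQ : Q0 = rx * (u * H0 + θ * c * H1) + r * (ux * H0 + u * (ux * P0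
      + θ * D * rx * P1) + (θ * (θ * D * rx) * H1 + θ * c * (ux * P1 + θ * D * rx * P2)))) :
    |Q0| ≤ C * (1 + R) * (1 + θ) ^ 2 * ((1 + r) * (1 + c) ^ 2) * (|rx| + |ux|) := by
  have hC : 0 ≤ C := (abs_nonneg _).trans h0
  have hRc : 0 ≤ R + c := by positivity
  have hu0' : |u * H0| ≤ (R + c) * C := hu0.trans (by gcongr)
  have hup0' : |u * P0| ≤ (R + c) * C := hup0.trans (by gcongr)
  have hup1' : |u * P1| ≤ (R + c) * C := hup1.trans (by gcongr)
  have e1 : Q0 = rx * (u * H0 + θ * c * H1 + θ * c * (u * P1) + θ * θ * c * H1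
      + θ * θ * c * c * P2) + ux * (r * H0 + r * (u * P0) + θ * (r * c) * P1) := by
    rw [hQ, hD]; ring
  have a1 : |u * H0 + θ * c * H1 + θ * c * (u * P1) + θ * θ * c * H1 + θ * θ * c * c * P2| ≤
      (R + c) * C + θ * c * C + θ * c * ((R + c) * C) + θ * θ * c * C + θ * θ * c * c * C := by
    have s1 : |θ * c * H1| ≤ θ * c * C := by
      rw [abs_mul, abs_of_pos (mul_pos hθ hc)]; gcongr
    have s2 : |θ * c * (u * P1)| ≤ θ * c * ((R + c) * C) := by
      rw [abs_mul (θ * c), abs_of_pos (mul_pos hθ hc)]; gcongr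
    have s3 : |θ * θ * c * H1| ≤ θ * θ * c * C := by
      rw [abs_mul, abs_of_pos (by positivity)]; gcongr
    have s4 : |θ * θ * c * c * P2| ≤ θ * θ * c * c * C := by
      rw [abs_mul, abs_of_pos (by positivity)]; gcongr
    refine (abs_add_le _ _).trans (add_le_add ((abs_add_le _ _).trans (add_le_add ?_ s3)) s4)
    exact (abs_add_three _ _ _).trans (by linarith)
  have a2 : |r * H0 + r * (u * P0) + θ * (r * c) * P1| ≤
      r * C + r * ((R + c) * C) + θ * (r * c) * C := by
    refine (abs_add_three _ _ _).trans (add_le_add (add_le_add ?_ ?_) ?_)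
    · rw [abs_mul, abs_of_pos hr]; gcongr
    · rw [abs_mul r, abs_of_pos hr]; gcongr
    · rw [abs_mul, abs_of_pos (by positivity)]; gcongr
  set W := (1 + r) * (1 + c) ^ 2 with hW
  set S := (1 + R) * (1 + θ) ^ 2 with hS
  have w0 : (1 + c) ^ 2 ≤ W := by
    rw [hW]; exact le_mul_of_one_le_left (by positivity) (by linarith)
  have b1 : (R + c) * C + θ * c * C + θ * c * ((R + c) * C) + θ * θ * c * C + θ * θ * c * c * C ≤
      C * S * W := by
    have : (R + c) + θ * c + θ * c * (R + c) + θ * θ * c + θ * θ * c * c ≤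
        S * (1 + c) ^ 2 := by
      rw [hS]
      have : 0 ≤ 1 + c + c ^ 2 + 2 * θ + 3 * θ * c + θ * c ^ 2 + θ ^ 2 + θ ^ 2 * c + R * (2 * c
          + c ^ 2 + 2 * θ + 3 * θ * c + 2 * θ * c ^ 2 + θ ^ 2 + 2 * θ ^ 2 * c + θ ^ 2 * c ^ 2) := by
        positivity
      linarith
    calc _ = C * ((R + c) + θ * c + θ * c * (R + c) + θ * θ * c + θ * θ * c * c) := by ring
      _ ≤ C * (S * (1 + c) ^ 2) := by gcongr
      _ ≤ C * (S * W) := by gcongr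
      _ = _ := by ring
  have b2 : r * C + r * ((R + c) * C) + θ * (r * c) * C ≤ C * S * W := by
    have : 1 + (R + c) + θ * c ≤ S * (1 + c) ^ 2 := by
      rw [hS]
      have : 0 ≤ c + c ^ 2 + 2 * θ + 3 * θ * c + 2 * θ * c ^ 2 + θ ^ 2 + 2 * θ ^ 2 * c
          + θ ^ 2 * c ^ 2 + R * (2 * c + c ^ 2 + 2 * θ * (1 + c) ^ 2 + θ ^ 2 * (1 + c) ^ 2) := by
        positivity
      linarith
    calc _ = C * r * (1 + (R + c) + θ * c) := by ring
      _ ≤ C * (1 + r) * (S * (1 + c) ^ 2) := by gcongr; linarith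
      _ = _ := by rw [hW]; ring
  rw [e1]
  calc _ ≤ |rx| * (C * S * W) + |ux| * (C * S * W) := by
        refine (abs_add_le _ _).trans (add_le_add ?_ ?_)
        · rw [abs_mul]; exact mul_le_mul_of_nonneg_left (a1.trans b1) (abs_nonneg _)
        · rw [abs_mul]; exact mul_le_mul_of_nonneg_left (a2.trans b2) (abs_nonneg _)
    _ = _ := by rw [hS]; ring

theorem sq_le_of_abs_le_mul_add {q B a b : ℝ} (h : |q| ≤ B * (|a| + |b|)) :
    q ^ 2 ≤ 2 * B ^ 2 * (a ^ 2 + b ^ 2) := by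
  have h1 : q ^ 2 ≤ (B * (|a| + |b|)) ^ 2 := by
    rw [← sq_abs q]; exact pow_le_pow_left₀ (abs_nonneg _) h 2
  have h2 : (|a| + |b|) ^ 2 ≤ 2 * (a ^ 2 + b ^ 2) := by
    nlinarith [sq_nonneg (|a| - |b|), sq_abs a, sq_abs b]
  rw [mul_pow] at h1
  nlinarith [sq_nonneg B]

end algebra

/-- Here c² is ρ^θ. The decay of the means turns c²|H| into at most E c, so q/ρ grows like ρ^(θ/2)
and not like ρ^θ. -/
theorem entropyFlux_growth {r u c θ R C E H0 H1 f g : ℝ} (hc : 0 < c) (hθ : 0 < θ)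
    (hR : 0 ≤ R)
    (hu0 : |u * H0| ≤ (R + c ^ 2) * |H0|) (h0 : |H0| ≤ C) (d0 : |H0| ≤ E / c) (d1 : |H1| ≤ E / c)
    (hf : f = r * H0) (hg : g = r * (u * H0 + θ * c ^ 2 * H1)) :
    f ^ 2 + g ^ 2 ≤ (C ^ 2 + 2 * (R * C + (1 + θ) * E) ^ 2) * (r ^ 2 * (1 + c ^ 2)) := by
  have hC : 0 ≤ C := (abs_nonneg _).trans h0
  have hE : 0 ≤ E := by
    have := (abs_nonneg _).trans d0
    by_contra hcon
    exact absurd this (not_le.2 (div_neg_of_neg_of_pos (not_le.1 hcon) hc))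
  have cc : ∀ H : ℝ, |H| ≤ E / c → c ^ 2 * |H| ≤ E * c := fun H hH => by
    rw [le_div_iff₀ hc] at hH
    nlinarith
  have a1 : |u * H0 + θ * c ^ 2 * H1| ≤ R * C + (1 + θ) * E * c := by
    refine (abs_add_le _ _).trans ?_
    have s1 : |θ * c ^ 2 * H1| ≤ θ * (E * c) := by
      rw [abs_mul, abs_of_pos (by positivity), mul_assoc]
      exact mul_le_mul_of_nonneg_left (cc H1 d1) hθ.le
    nlinarith [cc H0 d0, mul_le_mul_of_nonneg_left h0 hR]
  have a2 : R * C + (1 + θ) * E * c ≤ (R * C + (1 + θ) * E) * (1 + c) := by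
    have : 0 ≤ R * C * c := by positivity
    have : 0 ≤ (1 + θ) * E := by positivity
    nlinarith
  have a3 : (u * H0 + θ * c ^ 2 * H1) ^ 2 ≤
      (R * C + (1 + θ) * E) ^ 2 * (2 * (1 + c ^ 2)) := by
    rw [← sq_abs]
    calc _ ≤ ((R * C + (1 + θ) * E) * (1 + c)) ^ 2 :=
          pow_le_pow_left₀ (abs_nonneg _) (a1.trans a2) 2
      _ = (R * C + (1 + θ) * E) ^ 2 * (1 + c) ^ 2 := by ring
      _ ≤ _ := by gcongr; nlinarith [sq_nonneg (c - 1)]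
  have a4 : H0 ^ 2 ≤ C ^ 2 * (1 + c ^ 2) := by
    rw [← sq_abs]
    calc _ ≤ C ^ 2 := pow_le_pow_left₀ (abs_nonneg _) h0 2
      _ ≤ _ := le_mul_of_one_le_right (sq_nonneg _) (by nlinarith [sq_nonneg c])
  rw [hf, hg, mul_pow, mul_pow]
  nlinarith [mul_le_mul_of_nonneg_left a3 (sq_nonneg r), mul_le_mul_of_nonneg_left a4 (sq_nonneg r)]

/-- The algebra behind η_t + q_x = ε u_xx η_m. The pressure coefficient κγ equals θ², D² r is
ρ^(γ-2), and `hp` is the integration by parts that matches the two terms in which ρ_x meets u_x-free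
means. -/
theorem entropy_balance {r u rx ux uxx ε θ κ D c w H0 H1 P0 P1 P2 : ℝ} (hr : 0 < r)
    (hc : c = D * r) (hw : D ^ 2 * r = w) (hκ : κ = θ ^ 2)
    (hp : (1 + θ) * H1 = θ * c * (P0 - P2)) :
    -(rx * u + r * ux) * H0 + r * ((-(u * ux) - κ * w * rx + ε * uxx / r) * P0
      + θ * D * -(rx * u + r * ux) * P1) =
    -(rx * (u * H0 + θ * c * H1) + r * (ux * H0 + u * (ux * P0 + θ * D * rx * P1)
      + (θ * (θ * D * rx) * H1 + θ * c * (ux * P1 + θ * D * rx * P2)))) + ε * uxx * P0 := by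
  have e1 : r * (ε * uxx / r) = ε * uxx := by field_simp
  subst hw hκ hc
  linear_combination P0 * e1 + θ * D * r * rx * hp

set_option maxHeartbeats 1000000 in
/-- The weak entropy pair generated by a compactly supported `C²` function, along a flow. -/
theorem exists_entropyFlow {γ : ℝ} (hγ : 1 < γ) {ψ : ℝ → ℝ} (hψ : ContDiff ℝ 2 ψ)
    (hψc : HasCompactSupport ψ) : ∃ A, 0 < A ∧ ∀ {ε ρl ρr ul ur : ℝ} {r u rx rxx ux uxx : ℝ → ℝ → ℝ},
      ViscousFlow γ ε ρl ρr ul ur r u rx rxx ux uxx → ∃ f g e ex fx gx : ℝ → ℝ → ℝ,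
        EntropyFlow γ ε A r rx ux uxx f g e ex fx gx ∧
        (∀ t x, weakEntropy γ ψ (r t x) (r t x * u t x) = f t x) ∧
        ∀ t x, weakEntropyFlux γ ψ (r t x) (r t x * u t x) = g t x := by
  obtain ⟨ψ', ψ'', G, R, hR, hG, cψ2, dψ, dψ', bψ, bψ', bψ2, sψ, sψ'⟩ :=
    exists_derivs_of_contDiff_two hψ hψc
  have cψ' : Continuous ψ' := continuous_iff_continuousAt.2 fun x => (dψ' x).continuousAt
  have cψ := hψ.continuous
  have hl := gasLambda_gt hγ
  have hθ := gasTheta_pos hγ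
  have hκ := gasKappa_mul hγ
  have hparts := kernelMean_parts hγ dψ cψ' bψ bψ'
  have heq1 := fun {r : ℝ} (hr : 0 < r) u => weakEntropy_eq hγ hr ψ u
  have heq2 := fun {r : ℝ} (hr : 0 < r) u => weakEntropyFlux_eq hγ hr cψ bψ u
  have hγθ : γ = 1 + 2 * gasTheta γ := by unfold gasTheta; ring
  set θ := gasTheta γ
  set a0 : ℝ → ℝ := kernelWeight (gasLambda γ) with ha0
  set a1 : ℝ → ℝ := fun τ => τ * a0 τ with ha1
  set a2 : ℝ → ℝ := fun τ => τ * a1 τ with ha2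
  have s0 : ∀ τ, τ ∉ Ioo (-1 : ℝ) 1 → a0 τ = 0 := fun τ hτ => kernelWeight_eq_zero hτ
  have s1 : ∀ τ, τ ∉ Ioo (-1 : ℝ) 1 → a1 τ = 0 := fun τ hτ => by
    rw [ha1]; simp only; rw [s0 τ hτ, mul_zero]
  have w0 : Integrable a0 := integrable_kernelWeight (by linarith)
  have w1 : Integrable a1 := integrable_mul_of_support w0 s0
  have w2 : Integrable a2 := integrable_mul_of_support w1 s1
  -- This is where λ > -1/2 is needed, and not merely λ > -1.
  have q0 : Integrable fun τ => a0 τ ^ 2 := by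
    simp only [ha0, kernelWeight_sq]
    exact integrable_kernelWeight (by linarith)
  have q1 : Integrable fun τ => a1 τ ^ 2 := by
    have e1 : ∀ τ, a1 τ ^ 2 = τ * (τ * a0 τ ^ 2) := fun τ => by simp only [ha1]; ring
    simp only [e1]
    refine integrable_mul_of_support (integrable_mul_of_support q0 fun τ hτ => ?_) fun τ hτ => ?_
    · rw [s0 τ hτ]; norm_num
    · rw [s0 τ hτ]; norm_num
  set C := G * ((∫ τ, |a0 τ|) + (∫ τ, |a1 τ|) + ∫ τ, |a2 τ|) with hCdef
  have i0 : 0 ≤ ∫ τ, |a0 τ| := integral_nonneg (μ := volume) fun _ => abs_nonneg _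
  have i1 : 0 ≤ ∫ τ, |a1 τ| := integral_nonneg (μ := volume) fun _ => abs_nonneg _
  have i2 : 0 ≤ ∫ τ, |a2 τ| := integral_nonneg (μ := volume) fun _ => abs_nonneg _
  have k0 : 0 ≤ ∫ τ, a0 τ ^ 2 := integral_nonneg (μ := volume) fun _ => sq_nonneg _
  have k1 : 0 ≤ ∫ τ, a1 τ ^ 2 := integral_nonneg (μ := volume) fun _ => sq_nonneg _
  have hC : 0 ≤ C := by positivity
  have bd : ∀ φ : ℝ → ℝ, (∀ x, |φ x| ≤ G) → ∀ b c, |kernelMean a0 φ b c| ≤ C ∧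
      |kernelMean a1 φ b c| ≤ C ∧ |kernelMean a2 φ b c| ≤ C := fun φ hφ b c =>
    ⟨(abs_kernelMean_le w0 hφ b c).trans (mul_le_mul_of_nonneg_left (by linarith) hG),
      (abs_kernelMean_le w1 hφ b c).trans (mul_le_mul_of_nonneg_left (by linarith) hG),
      (abs_kernelMean_le w2 hφ b c).trans (mul_le_mul_of_nonneg_left (by linarith) hG)⟩
  set E := G * ((∫ τ, a0 τ ^ 2) + (∫ τ, a1 τ ^ 2) + 2 * R) with hE
  have hE0 : 0 ≤ E := by positivity
  set A1 := 2 * C ^ 2 * (1 + θ) ^ 2 with hA1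
  set A2 := C ^ 2 + 2 * (R * C + (1 + θ) * E) ^ 2 with hA2
  set A3 := 2 * (C * (1 + θ)) ^ 2 with hA3
  set A4 := 2 * (C * (1 + R) * (1 + θ) ^ 2) ^ 2 with hA4
  have p1 : 0 ≤ A1 := by positivity
  have p2 : 0 ≤ A2 := by positivity
  have p3 : 0 ≤ A3 := by positivity
  have p4 : 0 ≤ A4 := by positivity
  have hE1 : G * ((∫ τ, a0 τ ^ 2) + 2 * R) ≤ E := mul_le_mul_of_nonneg_left (by linarith) hG
  have hE2 : G * ((∫ τ, a1 τ ^ 2) + 2 * R) ≤ E := mul_le_mul_of_nonneg_left (by linarith) hG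
  clear_value C E A1 A2 A3 A4
  refine ⟨1 + C + A1 + A2 + A3 + A4, by positivity, ?_⟩
  intro ε ρl ρr ul ur r u rx rxx ux uxx h
  have hr0 := h.pos
  obtain ⟨P, hP, eP⟩ := exists_continuous_rpow h.cont_r (fun z => hr0 z.1 z.2) θ
  obtain ⟨Q, hQ, eQ⟩ := exists_continuous_rpow h.cont_r (fun z => hr0 z.1 z.2) (θ - 1)
  set c : ℝ → ℝ → ℝ := fun t x => r t x ^ θ with hc
  set D : ℝ → ℝ → ℝ := fun t x => r t x ^ (θ - 1) with hD
  have cr := h.cont_r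
  have cu := h.cont_u
  have crx := h.cont_rx
  have cux := h.cont_ux
  have cc : Continuous fun z : ℝ × ℝ => c z.1 z.2 := by
    have : (fun z : ℝ × ℝ => c z.1 z.2) = P := funext eP
    rw [this]; exact hP
  have cD : Continuous fun z : ℝ × ℝ => D z.1 z.2 := by
    have : (fun z : ℝ × ℝ => D z.1 z.2) = Q := funext eQ
    rw [this]; exact hQ
  have c0 : ∀ t x, 0 < c t x := fun t x => Real.rpow_pos_of_pos (hr0 t x) _
  have cDr : ∀ t x, c t x = D t x * r t x := fun t x => by
    simp only [hc, hD]
    rw [← Real.rpow_add_one (hr0 t x).ne', sub_add_cancel]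
  -- The exponent 2(θ - 1) = γ - 3 is that of the density dissipation, which therefore controls the
  -- part of (η_m)_x that contains ρ_x.
  have hD3 : ∀ t x, D t x ^ 2 = r t x ^ (γ - 3) := fun t x => by
    simp only [hD]
    rw [← Real.rpow_natCast, ← Real.rpow_mul (hr0 t x).le, hγθ]
    congr 1; push_cast; ring
  have hD2 : ∀ t x, D t x ^ 2 * r t x = r t x ^ (γ - 2) := fun t x => by
    rw [hD3, ← Real.rpow_add_one (hr0 t x).ne']; congr 1; ring
  set M : (ℝ → ℝ) → (ℝ → ℝ) → ℝ → ℝ → ℝ := fun a φ t x => kernelMean a φ (u t x) (c t x) with hM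
  have cM : ∀ a φ : ℝ → ℝ, Integrable a → Continuous φ → (∀ x, |φ x| ≤ G) →
      Continuous fun z : ℝ × ℝ => M a φ z.1 z.2 := fun a φ ha hφ hb =>
    (continuous_kernelMean ha hφ hb).comp (cu.prodMk cc)
  have m00 := cM a0 ψ w0 cψ bψ
  have m10 := cM a1 ψ w1 cψ bψ
  have m01 := cM a0 ψ' w0 cψ' bψ'
  have m11 := cM a1 ψ' w1 cψ' bψ'
  have m21 := cM a2 ψ' w2 cψ' bψ'
  have m02 := cM a0 ψ'' w0 cψ2 bψ2
  have m12 := cM a1 ψ'' w1 cψ2 bψ2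
  have c_x : ∀ t x, HasDerivAt (c t) (θ * D t x * rx t x) x := fun t x =>
    ((h.r_x t x).rpow_const (p := θ) (Or.inl (hr0 t x).ne')).congr_deriv (by simp only [hD]; ring)
  have c_t : ∀ t x, 0 < t → HasDerivAt (fun s => c s x)
      (θ * D t x * -(rx t x * u t x + r t x * ux t x)) t := fun t x ht =>
    ((h.r_t t x ht).rpow_const (p := θ) (Or.inl (hr0 t x).ne')).congr_deriv (by simp only [hD]; ring)
  have m00x : ∀ t x, HasDerivAt (M a0 ψ t) (ux t x * M a0 ψ' t x
      + θ * D t x * rx t x * M a1 ψ' t x) x := fun t x =>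
    hasDerivAt_kernelMean w0 w1 dψ cψ' bψ bψ' (h.u_x t x) (c_x t x)
  have m10x : ∀ t x, HasDerivAt (M a1 ψ t) (ux t x * M a1 ψ' t x
      + θ * D t x * rx t x * M a2 ψ' t x) x := fun t x =>
    hasDerivAt_kernelMean w1 w2 dψ cψ' bψ bψ' (h.u_x t x) (c_x t x)
  have m01x : ∀ t x, HasDerivAt (M a0 ψ' t) (ux t x * M a0 ψ'' t x
      + θ * D t x * rx t x * M a1 ψ'' t x) x := fun t x =>
    hasDerivAt_kernelMean w0 w1 dψ' cψ2 bψ' bψ2 (h.u_x t x) (c_x t x)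
  have m00t : ∀ t x, 0 < t → HasDerivAt (fun s => M a0 ψ s x) (
      (-(u t x * ux t x) - gasKappa γ * γ * r t x ^ (γ - 2) * rx t x + ε * uxx t x / r t x)
        * M a0 ψ' t x + θ * D t x * -(rx t x * u t x + r t x * ux t x) * M a1 ψ' t x) t :=
    fun t x ht => hasDerivAt_kernelMean w0 w1 dψ cψ' bψ bψ' (h.u_t t x ht) (c_t t x ht)
  -- The derivative of η in the momentum is the mean of ψ' against w: since u = m/ρ, the factor ρ
  -- cancels.
  refine ⟨fun t x => r t x * M a0 ψ t x,
    fun t x => r t x * (u t x * M a0 ψ t x + θ * c t x * M a1 ψ t x), M a0 ψ',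
    fun t x => ux t x * M a0 ψ'' t x + θ * D t x * rx t x * M a1 ψ'' t x,
    fun t x => rx t x * M a0 ψ t x
      + r t x * (ux t x * M a0 ψ' t x + θ * D t x * rx t x * M a1 ψ' t x),
    fun t x => rx t x * (u t x * M a0 ψ t x + θ * c t x * M a1 ψ t x)
      + r t x * (ux t x * M a0 ψ t x + u t x * (ux t x * M a0 ψ' t x
        + θ * D t x * rx t x * M a1 ψ' t x) + (θ * (θ * D t x * rx t x) * M a1 ψ t x
        + θ * c t x * (ux t x * M a1 ψ' t x + θ * D t x * rx t x * M a2 ψ' t x))),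
    ⟨by fun_prop, by fun_prop, m01, by fun_prop, by fun_prop, by fun_prop, ?_, ?_, m01x, ?_, ?_,
      ?_, ?_, ?_⟩, fun t x => heq1 (hr0 t x) _, fun t x => heq2 (hr0 t x) _⟩
  · exact fun t x => (h.r_x t x).mul (m00x t x)
  · exact fun t x => (h.r_x t x).mul (((h.u_x t x).mul (m00x t x)).add
      (((c_x t x).const_mul θ).mul (m10x t x)))
  · intro t x ht
    exact ((h.r_t t x ht).mul (m00t t x ht)).congr_deriv (entropy_balance (hr0 t x) (cDr t x)
      (hD2 t x) hκ (hparts (u t x) (c t x)))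
  · intro t x
    exact ((bd ψ' bψ' _ _).1).trans (by linarith)
  · intro t x
    have b0 := (bd ψ'' bψ2 (u t x) (c t x)).1
    have b1 := (bd ψ'' bψ2 (u t x) (c t x)).2.1
    have : |ux t x * M a0 ψ'' t x + θ * D t x * rx t x * M a1 ψ'' t x| ≤
        C * (1 + θ) * (|ux t x| + |D t x * rx t x|) := by
      refine (abs_add_le _ _).trans ?_
      rw [abs_mul, abs_mul, mul_assoc θ, abs_mul θ, abs_of_pos hθ]
      have t1 : |ux t x| * |M a0 ψ'' t x| ≤ |ux t x| * C := by gcongr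
      have t2 : θ * |D t x * rx t x| * |M a1 ψ'' t x| ≤ θ * |D t x * rx t x| * C := by gcongr
      have t3 : 0 ≤ C * |D t x * rx t x| := by positivity
      have t4 : 0 ≤ C * θ * |ux t x| := by positivity
      linarith
    have h2 := sq_le_of_abs_le_mul_add this
    rw [mul_pow (D t x), hD3] at h2
    have h3 : 0 ≤ ux t x ^ 2 + r t x ^ (γ - 3) * rx t x ^ 2 :=
      add_nonneg (sq_nonneg _) (mul_nonneg (Real.rpow_nonneg (hr0 t x).le _) (sq_nonneg _))
    refine h2.trans (mul_le_mul_of_nonneg_right ?_ h3)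
    rw [mul_pow, ← mul_assoc]
    linarith
  · intro t x
    have hs : Real.sqrt (c t x) ^ 2 = c t x := Real.sq_sqrt (c0 t x).le
    have hs0 : 0 < Real.sqrt (c t x) := Real.sqrt_pos.2 (c0 t x)
    have hu0 := abs_mul_kernelMean_le s0 sψ (u := u t x) (c0 t x).le
    have d0 := abs_kernelMean_decay q0 hR bψ sψ (u := u t x) hs0
    have d1 := abs_kernelMean_decay q1 hR bψ sψ (u := u t x) hs0
    rw [hs] at d0 d1
    have hr := hr0 t x
    have := entropyFlux_growth (r := r t x) (E := E) (f := r t x * M a0 ψ t x)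
      (g := r t x * (u t x * M a0 ψ t x + θ * c t x * M a1 ψ t x)) hs0 hθ hR
      (by rw [hs]; exact hu0) (bd ψ bψ (u t x) (c t x)).1
      (d0.trans (div_le_div_of_nonneg_right hE1 hs0.le))
      (d1.trans (div_le_div_of_nonneg_right hE2 hs0.le))
      rfl (by rw [hs])
    rw [hs] at this
    have hcx := c0 t x
    exact this.trans (mul_le_mul_of_nonneg_right (by linarith) (by positivity))
  · intro t x
    have hr := hr0 t x
    have hcx := c0 t x
    have bb := bd ψ bψ (u t x) (c t x)
    have bb' := bd ψ' bψ' (u t x) (c t x)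
    have f1 := sq_le_of_abs_le_mul_add (abs_entropyGradient_le (rx := rx t x) (ux := ux t x)
      hr hcx (cDr t x) bb.1 bb'.1 bb'.2.1 hθ)
    have g1 := sq_le_of_abs_le_mul_add (abs_fluxGradient_le (rx := rx t x) (ux := ux t x)
      hr hcx (cDr t x) hR
      (abs_mul_kernelMean_le s0 sψ (u := u t x) hcx.le)
      (abs_mul_kernelMean_le s0 sψ' (u := u t x) hcx.le)
      (abs_mul_kernelMean_le s1 sψ' (u := u t x) hcx.le)
      bb.1 bb.2.1 bb'.1 bb'.2.1 bb'.2.2 hθ rfl)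
    refine (add_le_add f1 g1).trans ?_
    have e1 : 2 * (C * (1 + θ) * ((1 + r t x) * (1 + c t x) ^ 2)) ^ 2 * (rx t x ^ 2 + ux t x ^ 2)
      + 2 * (C * (1 + R) * (1 + θ) ^ 2 * ((1 + r t x) * (1 + c t x) ^ 2)) ^ 2
        * (rx t x ^ 2 + ux t x ^ 2) = (A3 + A4) * (((1 + r t x) * (1 + c t x) ^ 2) ^ 2
        * (rx t x ^ 2 + ux t x ^ 2)) := by rw [hA3, hA4]; ring
    rw [e1]
    exact mul_le_mul_of_nonneg_right (by linarith) (by positivity)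

/-- The entropy pair is square integrable with room to spare compared with the bound for the
power `γ + 1` of the density. -/
theorem exists_sq_mul_one_add_rpow_le {γ : ℝ} (hγ : 1 < γ) {δ : ℝ} (hδ : 0 < δ) :
    ∃ C, 0 ≤ C ∧ ∀ r : ℝ, 0 < r →
      r ^ 2 * (1 + r ^ gasTheta γ) ≤ δ * (r * r ^ γ) + C := by
  have hθ := gasTheta_pos hγ
  have hγθ : γ = 1 + 2 * gasTheta γ := by unfold gasTheta; ring
  set θ := gasTheta γ
  -- For y = ρ^θ above this threshold, 1 + y ≤ 2y ≤ δ y².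
  set c0 : ℝ := max 1 (2 / δ) with hc0
  have h1 : (1 : ℝ) ≤ c0 := le_max_left _ _
  set R := c0 ^ θ⁻¹ with hR
  have hR0 : 0 ≤ R := Real.rpow_nonneg (by linarith) _
  refine ⟨R ^ 2 * (1 + c0), by positivity, fun r hr => ?_⟩
  have hrc : 0 < r ^ θ := Real.rpow_pos_of_pos hr _
  have e1 : r * r ^ γ = r ^ 2 * (r ^ θ) ^ 2 := by
    rw [hγθ, Real.rpow_add hr, Real.rpow_one, ← Real.rpow_natCast (r ^ θ), ← Real.rpow_mul hr.le]
    rw [show θ * ((2 : ℕ) : ℝ) = 2 * θ by push_cast; ring]; ring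
  rw [e1]
  by_cases h : r ^ θ ≤ c0
  · have : r ≤ R := by
      rw [hR, Real.le_rpow_inv_iff_of_pos hr.le (by linarith) hθ]; exact h
    have : r ^ 2 * (1 + r ^ θ) ≤ R ^ 2 * (1 + c0) := by gcongr
    have : 0 ≤ δ * (r ^ 2 * (r ^ θ) ^ 2) := by positivity
    linarith
  · push Not at h
    have h2 : 2 / δ ≤ r ^ θ := (le_max_right _ _).trans h.le
    rw [div_le_iff₀ hδ] at h2
    have h3 : 1 + r ^ θ ≤ δ * (r ^ θ) ^ 2 := by nlinarith
    have h4 : 0 ≤ R ^ 2 * (1 + c0) := by positivity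
    nlinarith [mul_le_mul_of_nonneg_left h3 (sq_nonneg r)]

/-! ### Integration over a rectangle -/

/-- The closed rectangle `[0, N] × [-N, N]`. -/
def stripBox (N : ℝ) : Set (ℝ × ℝ) := Icc 0 N ×ˢ Icc (-N) N

theorem measurableSet_stripBox (N : ℝ) : MeasurableSet (stripBox N) :=
  measurableSet_Icc.prod measurableSet_Icc

theorem integrableOn_stripBox {F : ℝ → ℝ → ℝ} (hF : Continuous fun z : ℝ × ℝ => F z.1 z.2) (N : ℝ) :
    IntegrableOn (fun z : ℝ × ℝ => F z.1 z.2) (stripBox N) :=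
  hF.continuousOn.integrableOn_compact (isCompact_Icc.prod isCompact_Icc)

theorem stripBox_subset {N M : ℝ} (h : N ≤ M) : stripBox N ⊆ stripBox M :=
  prod_mono (Icc_subset_Icc_right h) (Icc_subset_Icc (neg_le_neg h) h)

theorem integral_stripBox_eq {F : ℝ → ℝ → ℝ} (hF : Continuous fun z : ℝ × ℝ => F z.1 z.2) {N : ℝ}
    (hN : 0 ≤ N) :
    ∫ z in stripBox N, F z.1 z.2 = ∫ t in (0 : ℝ)..N, ∫ x in -N..N, F t x := by
  have h1 := integrableOn_stripBox hF N
  rw [stripBox, Measure.volume_eq_prod] at *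
  rw [setIntegral_prod _ h1, intervalIntegral.integral_of_le hN, integral_Icc_eq_integral_Ioc]
  refine integral_congr_ae (Eventually.of_forall fun t => ?_)
  simp only
  rw [intervalIntegral.integral_of_le (by linarith), integral_Icc_eq_integral_Ioc]

theorem integral_stripBox_mono {F G : ℝ → ℝ → ℝ} (hF : Continuous fun z : ℝ × ℝ => F z.1 z.2)
    (hG : Continuous fun z : ℝ × ℝ => G z.1 z.2) {N : ℝ}
    (h : ∀ t x, (t, x) ∈ stripBox N → F t x ≤ G t x) :
    ∫ z in stripBox N, F z.1 z.2 ≤ ∫ z in stripBox N, G z.1 z.2 :=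
  setIntegral_mono_on (integrableOn_stripBox hF N) (integrableOn_stripBox hG N)
    (measurableSet_stripBox N) fun z hz => h z.1 z.2 hz

theorem abs_integral_stripBox_le {F G : ℝ → ℝ → ℝ}
    (hG : Continuous fun z : ℝ × ℝ => G z.1 z.2) {N : ℝ}
    (h : ∀ t x, (t, x) ∈ stripBox N → |F t x| ≤ G t x) :
    |∫ z in stripBox N, F z.1 z.2| ≤ ∫ z in stripBox N, G z.1 z.2 := by
  rw [← Real.norm_eq_abs]
  exact norm_integral_le_of_norm_le (integrableOn_stripBox hG N)
    ((ae_restrict_iff' (measurableSet_stripBox N)).2 (Eventually.of_forall fun z hz => h z.1 z.2 hz))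

theorem integral_stripBox_mono_set {F : ℝ → ℝ → ℝ} (hF : Continuous fun z : ℝ × ℝ => F z.1 z.2)
    (h0 : ∀ t x, 0 ≤ F t x) {N M : ℝ} (h : N ≤ M) :
    ∫ z in stripBox N, F z.1 z.2 ≤ ∫ z in stripBox M, F z.1 z.2 :=
  setIntegral_mono_set (integrableOn_stripBox hF M) (Eventually.of_forall fun z => h0 z.1 z.2)
    (stripBox_subset h).eventuallyLE

theorem integral_stripBox_const {N : ℝ} (hN : 0 ≤ N) (c : ℝ) :
    ∫ _z in stripBox N, c = 2 * N ^ 2 * c := by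
  have := integral_stripBox_eq (F := fun _ _ => c) continuous_const hN
  rw [this]
  simp only [intervalIntegral.integral_const, smul_eq_mul]
  ring

theorem integral_stripBox_time_deriv {F F' : ℝ → ℝ → ℝ}
    (hF : Continuous fun z : ℝ × ℝ => F z.1 z.2) (hF' : Continuous fun z : ℝ × ℝ => F' z.1 z.2)
    (h : ∀ t x, 0 < t → HasDerivAt (fun s => F s x) (F' t x) t) {N : ℝ} (hN : 0 ≤ N)
    (h0 : ∀ x, F 0 x = 0) (h1 : ∀ x, F N x = 0) : ∫ z in stripBox N, F' z.1 z.2 = 0 := by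
  rw [integral_stripBox_eq hF' hN, ← integral_sub_eq_integral_of_hasDerivAt hF hF' h hN]
  simp [h0, h1]

theorem integral_stripBox_space_deriv {F F' : ℝ → ℝ → ℝ}
    (hF' : Continuous fun z : ℝ × ℝ => F' z.1 z.2)
    (h : ∀ t x, HasDerivAt (F t) (F' t x) x) {N : ℝ} (hN : 0 ≤ N)
    (h0 : ∀ t, F t (-N) = 0) (h1 : ∀ t, F t N = 0) : ∫ z in stripBox N, F' z.1 z.2 = 0 := by
  rw [integral_stripBox_eq hF' hN]
  have : ∀ t, ∫ x in -N..N, F' t x = 0 := fun t => by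
    rw [intervalIntegral.integral_eq_sub_of_hasDerivAt (fun x _ => h t x)
      ((continuous_slice hF' t).intervalIntegrable _ _), h0, h1, sub_zero]
  simp [this]

theorem integral_stripBox_shift_le {F : ℝ → ℝ → ℝ} (hF : Continuous fun z : ℝ × ℝ => F z.1 z.2)
    (h0 : ∀ t x, 0 ≤ F t x) {N y : ℝ} (hN : 0 ≤ N) (hy : y ∈ Icc (0 : ℝ) 1) :
    ∫ z in stripBox N, F z.1 (z.2 + y) ≤ ∫ z in stripBox (N + 1), F z.1 z.2 := by
  have c1 : Continuous fun z : ℝ × ℝ => F z.1 (z.2 + y) :=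
    hF.comp (by fun_prop : Continuous fun z : ℝ × ℝ => ((z.1, z.2 + y) : ℝ × ℝ))
  rw [integral_stripBox_eq (F := fun t x => F t (x + y)) c1 hN,
    integral_stripBox_eq hF (by linarith)]
  have h1 : ∀ t, ∫ x in -N..N, F t (x + y) ≤ ∫ x in -(N + 1)..(N + 1), F t x := fun t => by
    rw [intervalIntegral.integral_comp_add_right]
    exact intervalIntegral.integral_mono_interval (by linarith [hy.1]) (by linarith)
      (by linarith [hy.2]) (Eventually.of_forall fun x => h0 t x)
      ((continuous_slice hF t).intervalIntegrable _ _)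
  have c2 := continuous_integral_slice (f := fun t x => F t (x + y)) c1 (-N) N
  have c3 := continuous_integral_slice hF (-(N + 1)) (N + 1)
  refine (intervalIntegral.integral_mono hN (c2.intervalIntegrable _ _)
    (c3.intervalIntegrable _ _) h1).trans ?_
  exact intervalIntegral.integral_mono_interval le_rfl hN (by linarith)
    (Eventually.of_forall fun t => intervalIntegral.integral_nonneg (by linarith)
      fun x _ => h0 t x) (c3.intervalIntegrable _ _)

theorem continuous_integral_translate {F : ℝ → ℝ → ℝ}
    (hF : Continuous fun z : ℝ × ℝ => F z.1 z.2) (h : ℝ) :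
    Continuous fun z : ℝ × ℝ => ∫ y in (0 : ℝ)..h, F z.1 (z.2 + y) := by
  refine intervalIntegral.continuous_parametric_intervalIntegral_of_continuous'
    (f := fun (z : ℝ × ℝ) y => F z.1 (z.2 + y)) ?_ 0 h
  exact hF.comp (by fun_prop : Continuous fun q : (ℝ × ℝ) × ℝ => ((q.1.1, q.1.2 + q.2) : ℝ × ℝ))

/-- Fubini: each shift by at most 1 keeps the rectangle inside the one of size N + 1, and the shifts
fill an interval of length h. -/
theorem integral_stripBox_translate_le {F : ℝ → ℝ → ℝ}
    (hF : Continuous fun z : ℝ × ℝ => F z.1 z.2) (h0 : ∀ t x, 0 ≤ F t x) {N h : ℝ} (hN : 0 ≤ N)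
    (hh : h ∈ Icc (0 : ℝ) 1) :
    ∫ z in stripBox N, (∫ y in (0 : ℝ)..h, F z.1 (z.2 + y)) ≤
      h * ∫ z in stripBox (N + 1), F z.1 z.2 := by
  have c1 : Continuous fun q : ℝ × ℝ × ℝ => F q.2.1 (q.2.2 + q.1) :=
    hF.comp (by fun_prop : Continuous fun q : ℝ × ℝ × ℝ => ((q.2.1, q.2.2 + q.1) : ℝ × ℝ))
  have e1 : ∫ z in stripBox N, (∫ y in (0 : ℝ)..h, F z.1 (z.2 + y)) =
      ∫ y in (0 : ℝ)..h, ∫ z in stripBox N, F z.1 (z.2 + y) := by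
    simp_rw [intervalIntegral.integral_of_le hh.1]
    refine integral_integral_swap ?_
    have : Integrable (fun q : (ℝ × ℝ) × ℝ => F q.1.1 (q.1.2 + q.2))
        (volume.restrict (stripBox N ×ˢ Ioc 0 h)) := by
      refine IntegrableOn.mono_set (t := stripBox N ×ˢ Icc 0 h) ?_
        (prod_mono_right Ioc_subset_Icc_self)
      refine ContinuousOn.integrableOn_compact ?_ ?_
      · exact (isCompact_Icc.prod isCompact_Icc).prod isCompact_Icc
      · exact (hF.comp (by fun_prop : Continuous fun q : (ℝ × ℝ) × ℝ =>
        ((q.1.1, q.1.2 + q.2) : ℝ × ℝ))).continuousOn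
    rwa [Measure.volume_eq_prod, ← Measure.prod_restrict] at this
  rw [e1]
  have c2 : Continuous fun y : ℝ => ∫ z in stripBox N, F z.1 (z.2 + y) :=
    continuous_parametric_integral_of_continuous (f := fun y (z : ℝ × ℝ) => F z.1 (z.2 + y))
      (by exact c1) (isCompact_Icc.prod isCompact_Icc)
  calc _ ≤ ∫ _y in (0 : ℝ)..h, ∫ z in stripBox (N + 1), F z.1 z.2 :=
        intervalIntegral.integral_mono_on hh.1 (c2.intervalIntegrable _ _)
          intervalIntegrable_const fun y hy => integral_stripBox_shift_le hF h0 hN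
            ⟨hy.1, hy.2.trans hh.2⟩
    _ = _ := by simp

/-! ### Testing the entropy balance -/

/-- A continuously differentiable test function in the open rectangle `(0, N) × (-N, N)`, with its
partial derivatives. -/
structure TestJet (N : ℝ) (p pt px : ℝ → ℝ → ℝ) : Prop where
  cont : Continuous fun z : ℝ × ℝ => p z.1 z.2
  cont_t : Continuous fun z : ℝ × ℝ => pt z.1 z.2
  cont_x : Continuous fun z : ℝ × ℝ => px z.1 z.2
  p_t : ∀ t x, HasDerivAt (fun s => p s x) (pt t x) t
  p_x : ∀ t x, HasDerivAt (p t) (px t x) x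
  support : ∀ t x, p t x ≠ 0 → t ∈ Ioo 0 N ∧ x ∈ Ioo (-N) N

namespace TestJet

variable {N : ℝ} {p pt px : ℝ → ℝ → ℝ}

theorem eq_zero (h : TestJet N p pt px) {t x : ℝ} (ht : ¬(t ∈ Ioo 0 N ∧ x ∈ Ioo (-N) N)) :
    p t x = 0 := by
  by_contra hne
  exact ht (h.support t x hne)

theorem integral_mul_time (h : TestJet N p pt px) {F F' : ℝ → ℝ → ℝ}
    (hF : Continuous fun z : ℝ × ℝ => F z.1 z.2) (hF' : Continuous fun z : ℝ × ℝ => F' z.1 z.2)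
    (hd : ∀ t x, 0 < t → HasDerivAt (fun s => F s x) (F' t x) t) (hN : 0 ≤ N) :
    ∫ z in stripBox N, F z.1 z.2 * pt z.1 z.2 = -∫ z in stripBox N, F' z.1 z.2 * p z.1 z.2 := by
  have c0 := h.cont
  have c1 := h.cont_t
  have h1 := integral_stripBox_time_deriv (F := fun t x => F t x * p t x)
    (F' := fun t x => F' t x * p t x + F t x * pt t x) (by fun_prop) (by fun_prop)
    (fun t x ht => (hd t x ht).mul (h.p_t t x)) hN
    (fun x => by rw [h.eq_zero (by simp), mul_zero]) (fun x => by rw [h.eq_zero (by simp), mul_zero])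
  rw [integral_add (integrableOn_stripBox (F := fun t x => F' t x * p t x) (by fun_prop) N)
    (integrableOn_stripBox (F := fun t x => F t x * pt t x) (by fun_prop) N)] at h1
  linarith

theorem integral_mul_space (h : TestJet N p pt px) {F F' : ℝ → ℝ → ℝ}
    (hF : Continuous fun z : ℝ × ℝ => F z.1 z.2) (hF' : Continuous fun z : ℝ × ℝ => F' z.1 z.2)
    (hd : ∀ t x, HasDerivAt (F t) (F' t x) x) (hN : 0 ≤ N) :
    ∫ z in stripBox N, F z.1 z.2 * px z.1 z.2 = -∫ z in stripBox N, F' z.1 z.2 * p z.1 z.2 := by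
  have c0 := h.cont
  have c1 := h.cont_x
  have h1 := integral_stripBox_space_deriv (F := fun t x => F t x * p t x)
    (F' := fun t x => F' t x * p t x + F t x * px t x) (by fun_prop)
    (fun t x => (hd t x).mul (h.p_x t x)) hN
    (fun x => by rw [h.eq_zero (by simp), mul_zero]) (fun x => by rw [h.eq_zero (by simp), mul_zero])
  rw [integral_add (integrableOn_stripBox (F := fun t x => F' t x * p t x) (by fun_prop) N)
    (integrableOn_stripBox (F := fun t x => F t x * px t x) (by fun_prop) N)] at h1
  linarith

end TestJet

/-- The entropy dissipation tested against a test function. -/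
theorem EntropyFlow.integral_dissipation {γ ε A : ℝ} {r rx ux uxx f g e ex fx gx : ℝ → ℝ → ℝ}
    (h : EntropyFlow γ ε A r rx ux uxx f g e ex fx gx)
    (cux : Continuous fun z : ℝ × ℝ => ux z.1 z.2) (cuxx : Continuous fun z : ℝ × ℝ => uxx z.1 z.2)
    (dux : ∀ t x, HasDerivAt (ux t) (uxx t x) x) {N : ℝ} (hN : 0 ≤ N) {p pt px : ℝ → ℝ → ℝ}
    (hp : TestJet N p pt px) :
    ∫ z in stripBox N, (f z.1 z.2 * pt z.1 z.2 + g z.1 z.2 * px z.1 z.2) =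
      ∫ z in stripBox N, ε * (ux z.1 z.2 * (ex z.1 z.2 * p z.1 z.2 + e z.1 z.2 * px z.1 z.2)) := by
  have cf := h.cont_f
  have cg := h.cont_g
  have ce := h.cont_e
  have cex := h.cont_ex
  have cgx := h.cont_gx
  have cp := hp.cont
  have cpt := hp.cont_t
  have cpx := hp.cont_x
  have a1 := hp.integral_mul_time (F := f) (F' := fun t x => -gx t x + ε * uxx t x * e t x) cf
    (by fun_prop) h.f_t hN
  have a2 := hp.integral_mul_space (F := g) (F' := gx) cg cgx h.g_x hN
  have a3 := hp.integral_mul_space (F := fun t x => ε * (ux t x * e t x))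
    (F' := fun t x => ε * (uxx t x * e t x + ux t x * ex t x)) (by fun_prop) (by fun_prop)
    (fun t x => ((dux t x).mul (h.e_x t x)).const_mul ε) hN
  have I : ∀ {F : ℝ → ℝ → ℝ}, (Continuous fun z : ℝ × ℝ => F z.1 z.2) →
      IntegrableOn (fun z : ℝ × ℝ => F z.1 z.2) (stripBox N) := fun hF => integrableOn_stripBox hF N
  have i1 := I (F := fun t x => gx t x * p t x) (by fun_prop)
  have i2 := I (F := fun t x => ε * (uxx t x * e t x) * p t x) (by fun_prop)
  have i3 := I (F := fun t x => ε * (ux t x * ex t x) * p t x) (by fun_prop)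
  have i4 := I (F := fun t x => ε * (ux t x * e t x) * px t x) (by fun_prop)
  have b1 : ∫ z in stripBox N, (-gx z.1 z.2 + ε * uxx z.1 z.2 * e z.1 z.2) * p z.1 z.2 =
      -(∫ z in stripBox N, gx z.1 z.2 * p z.1 z.2)
        + ∫ z in stripBox N, ε * (uxx z.1 z.2 * e z.1 z.2) * p z.1 z.2 := by
    rw [neg_add_eq_sub, ← integral_sub i2 i1]
    congr 1; funext z; ring
  have b2 : ∫ z in stripBox N, ε * (uxx z.1 z.2 * e z.1 z.2 + ux z.1 z.2 * ex z.1 z.2) * p z.1 z.2 =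
      (∫ z in stripBox N, ε * (uxx z.1 z.2 * e z.1 z.2) * p z.1 z.2)
        + ∫ z in stripBox N, ε * (ux z.1 z.2 * ex z.1 z.2) * p z.1 z.2 := by
    rw [← integral_add i2 i3]
    congr 1; funext z; ring
  have b3 : ∫ z in stripBox N, ε * (ux z.1 z.2 * (ex z.1 z.2 * p z.1 z.2 + e z.1 z.2 * px z.1 z.2)) =
      (∫ z in stripBox N, ε * (ux z.1 z.2 * ex z.1 z.2) * p z.1 z.2)
        + ∫ z in stripBox N, ε * (ux z.1 z.2 * e z.1 z.2) * px z.1 z.2 := by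
    rw [← integral_add i3 i4]
    congr 1; funext z; ring
  rw [integral_add (I (F := fun t x => f t x * pt t x) (by fun_prop))
    (I (F := fun t x => g t x * px t x) (by fun_prop))]
  linarith

theorem abs_mul_le_add_sq_div {a b α : ℝ} (hα : 0 < α) : |a * b| ≤ a ^ 2 / α + α * b ^ 2 := by
  rw [abs_mul, div_add' _ _ _ hα.ne', le_div_iff₀ hα, ← sq_abs a, ← sq_abs b]
  nlinarith [sq_nonneg (|a| - α * |b|),
    mul_nonneg (abs_nonneg a) (mul_nonneg hα.le (abs_nonneg b))]

section

variable {γ ε A : ℝ} {r rx ux uxx f g e ex fx gx p pt px : ℝ → ℝ → ℝ} {N C k : ℝ}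

/-- Meant for small ε. In the tested dissipation ε u_x (η_m)_x is bounded only in L¹ and is paired
with the bound k of the test function. In ε u_x η_m φ_x the factor η_m is bounded, and Young's
inequality with parameter α leaves ε/α times the dissipation. -/
theorem EntropyFlow.abs_integral_le_of_small (h : EntropyFlow γ ε A r rx ux uxx f g e ex fx gx)
    (cux : Continuous fun z : ℝ × ℝ => ux z.1 z.2) (cuxx : Continuous fun z : ℝ × ℝ => uxx z.1 z.2)
    (dux : ∀ t x, HasDerivAt (ux t) (uxx t x) x) (hN : 0 ≤ N) (hε : 0 ≤ ε)
    (hC : ∫ z in stripBox N, ε * (ux z.1 z.2 ^ 2 + ex z.1 z.2 ^ 2) ≤ C)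
    (hp : TestJet N p pt px) (hk : ∀ t x, |p t x| ≤ k)
    (hpx : ∫ z in stripBox N, px z.1 z.2 ^ 2 ≤ 1) {α : ℝ} (hα : 0 < α) :
    |∫ z in stripBox N, (f z.1 z.2 * pt z.1 z.2 + g z.1 z.2 * px z.1 z.2)| ≤
      k * C + A * (ε / α * C + α) := by
  have hA : 0 ≤ A := (abs_nonneg _).trans (h.e_le 0 0)
  have hk0 : 0 ≤ k := (abs_nonneg _).trans (hk 0 0)
  have ce := h.cont_e
  have cex := h.cont_ex
  have cpx := hp.cont_x
  rw [h.integral_dissipation cux cuxx dux hN hp]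
  refine (abs_integral_stripBox_le (F := fun t x => ε * (ux t x * (ex t x * p t x + e t x * px t x)))
    (G := fun t x => (k + A * (ε / α)) * (ε * (ux t x ^ 2 + ex t x ^ 2)) + A * α * px t x ^ 2)
    (by fun_prop) fun t x _ => ?_).trans ?_
  · have h1 : |ε * (ux t x * ex t x) * p t x| ≤ k * (ε * (ux t x ^ 2 + ex t x ^ 2)) := by
      rw [abs_mul, abs_mul, abs_of_nonneg hε, mul_comm]
      refine mul_le_mul (hk t x) (mul_le_mul_of_nonneg_left ?_ hε) (by positivity) hk0
      have := abs_mul_le_add_sq_div (a := ux t x) (b := ex t x) one_pos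
      linarith
    have h2 : |e t x * (ε * ux t x * px t x)| ≤
        A * ((ε * ux t x) ^ 2 / α + α * px t x ^ 2) := by
      rw [abs_mul]
      exact mul_le_mul (h.e_le t x) (abs_mul_le_add_sq_div hα) (abs_nonneg _) hA
    have h3 : 0 ≤ A * (ε / α) * (ε * ex t x ^ 2) := by positivity
    calc _ = |ε * (ux t x * ex t x) * p t x + e t x * (ε * ux t x * px t x)| := by congr 1; ring
      _ ≤ k * (ε * (ux t x ^ 2 + ex t x ^ 2)) + A * ((ε * ux t x) ^ 2 / α + α * px t x ^ 2)
          + A * (ε / α) * (ε * ex t x ^ 2) := by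
        refine (abs_add_le _ _).trans ?_; linarith
      _ = _ := by ring
  · rw [integral_add (integrableOn_stripBox (F := fun t x => (k + A * (ε / α)) *
      (ε * (ux t x ^ 2 + ex t x ^ 2))) (by fun_prop) N)
      (integrableOn_stripBox (F := fun t x => A * α * px t x ^ 2) (by fun_prop) N),
      integral_const_mul (k + A * (ε / α)), integral_const_mul (A * α)]
    have h1 := mul_le_mul_of_nonneg_left hC (by positivity : 0 ≤ k + A * (ε / α))
    have h2 := mul_le_mul_of_nonneg_left hpx (by positivity : 0 ≤ A * α)
    linarith

/-- Averaging in x turns q_x and the leading viscous term into differences of q and of ε u_x η_m at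
two points. Only the integrable product ε u_x (η_m)_x stays under the integral, and u_xx disappears.
-/
theorem EntropyFlow.hasDerivAt_integral_translate
    (h : EntropyFlow γ ε A r rx ux uxx f g e ex fx gx)
    (cux : Continuous fun z : ℝ × ℝ => ux z.1 z.2) (cuxx : Continuous fun z : ℝ × ℝ => uxx z.1 z.2)
    (dux : ∀ t x, HasDerivAt (ux t) (uxx t x) x) (l : ℝ) (t x : ℝ) (ht : 0 < t) :
    HasDerivAt (fun s => ∫ y in (0 : ℝ)..l, f s (x + y))
      (-(g t (x + l) - g t x) + ε * (ux t (x + l) * e t (x + l) - ux t x * e t x)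
        - ε * ∫ y in (0 : ℝ)..l, ux t (x + y) * ex t (x + y)) t := by
  have ce := h.cont_e
  have cex := h.cont_ex
  have cgx := h.cont_gx
  have sh : ∀ {F : ℝ → ℝ → ℝ}, (Continuous fun z : ℝ × ℝ => F z.1 z.2) →
      Continuous fun z : ℝ × ℝ => F z.1 (x + z.2) := fun hF =>
    hF.comp (by fun_prop : Continuous fun z : ℝ × ℝ => ((z.1, x + z.2) : ℝ × ℝ))
  have h1 := hasDerivAt_integral_of_evolution (F := fun s y => f s (x + y))
    (F' := fun s y => -gx s (x + y) + ε * uxx s (x + y) * e s (x + y)) (sh h.cont_f)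
    (sh (F := fun s y => -gx s y + ε * uxx s y * e s y) (by fun_prop))
    (fun s y hs => h.f_t s (x + y) hs) 0 l ht
  refine h1.congr_deriv ?_
  have sl : ∀ {F : ℝ → ℝ → ℝ}, (Continuous fun z : ℝ × ℝ => F z.1 z.2) →
      Continuous fun y => F t (x + y) := fun hF => (continuous_slice hF t).comp (by fun_prop)
  have c1 := sl cgx
  have c2 := sl (F := fun s y => uxx s y * e s y + ux s y * ex s y) (by fun_prop)
  have c3 := sl (F := fun s y => ux s y * ex s y) (by fun_prop)
  have d0 : ∀ y, HasDerivAt (fun y => x + y) 1 y := fun y => (hasDerivAt_id y).const_add x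
  have d1 : ∀ y, HasDerivAt (fun y => g t (x + y)) (gx t (x + y)) y := fun y =>
    ((h.g_x t (x + y)).comp y (d0 y)).congr_deriv (mul_one _)
  have d2 : ∀ y, HasDerivAt (fun y => ux t (x + y) * e t (x + y))
      (uxx t (x + y) * e t (x + y) + ux t (x + y) * ex t (x + y)) y := fun y =>
    (((dux t (x + y)).mul (h.e_x t (x + y))).comp y (d0 y)).congr_deriv (mul_one _)
  have e1 := intervalIntegral.integral_eq_sub_of_hasDerivAt (fun y _ => d1 y)
    (c1.intervalIntegrable 0 l)
  have e2 := intervalIntegral.integral_eq_sub_of_hasDerivAt (fun y _ => d2 y)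
    (c2.intervalIntegrable 0 l)
  rw [add_zero] at e1 e2
  rw [← e1, ← e2, add_sub_assoc, ← mul_sub, ← intervalIntegral.integral_sub (c2.intervalIntegrable 0 l)
    (c3.intervalIntegrable 0 l), ← intervalIntegral.integral_neg,
    ← intervalIntegral.integral_const_mul, ← intervalIntegral.integral_add]
  · refine intervalIntegral.integral_congr fun y _ => ?_
    ring
  · exact c1.neg.intervalIntegrable _ _
  · exact ((c2.sub c3).const_mul ε).intervalIntegrable _ _

/-- The deviation from the average is at most the integral of |F'| over [x, x + l]; Young's
inequality is applied inside that integral. After integration in x both terms carry a factor l. -/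
theorem abs_sub_average_mul_le {F F' : ℝ → ℝ} (hd : ∀ x, HasDerivAt F (F' x) x)
    (hF' : Continuous F') {l : ℝ} (hl : 0 < l) (x b : ℝ) :
    |(F x - (∫ y in (0 : ℝ)..l, F (x + y)) / l) * b| ≤
      (∫ y in (0 : ℝ)..l, F' (x + y) ^ 2) + l * b ^ 2 := by
  have hF : Continuous F := continuous_iff_continuousAt.2 fun x => (hd x).continuousAt
  have cF : Continuous fun y => F (x + y) := hF.comp (by fun_prop)
  have cF' : Continuous fun y => F' (x + y) := hF'.comp (by fun_prop)
  set I := ∫ y in (0 : ℝ)..l, |F' (x + y)| with hI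
  have d1 : ∀ y, HasDerivAt (fun y => F (x + y)) (F' (x + y)) y := fun y =>
    ((hd (x + y)).comp y ((hasDerivAt_id y).const_add x)).congr_deriv (mul_one _)
  have h1 : ∀ y ∈ Icc 0 l, |F x - F (x + y)| ≤ I := by
    intro y hy
    have e1 := intervalIntegral.integral_eq_sub_of_hasDerivAt (fun y _ => d1 y)
      (cF'.intervalIntegrable 0 y)
    rw [add_zero] at e1
    rw [abs_sub_comm, ← e1]
    refine (intervalIntegral.abs_integral_le_integral_abs hy.1).trans ?_
    exact intervalIntegral.integral_mono_interval le_rfl hy.1 hy.2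
      (Eventually.of_forall fun _ => abs_nonneg _) (cF'.abs.intervalIntegrable _ _)
  have h2 : |F x - (∫ y in (0 : ℝ)..l, F (x + y)) / l| ≤ I := by
    have e1 : F x - (∫ y in (0 : ℝ)..l, F (x + y)) / l =
        (∫ y in (0 : ℝ)..l, (F x - F (x + y))) / l := by
      rw [intervalIntegral.integral_sub intervalIntegrable_const (cF.intervalIntegrable _ _),
        intervalIntegral.integral_const, smul_eq_mul, sub_zero]
      field_simp
    rw [e1, abs_div, abs_of_pos hl, div_le_iff₀ hl]
    refine (intervalIntegral.abs_integral_le_integral_abs hl.le).trans ?_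
    refine (intervalIntegral.integral_mono_on hl.le
      ((continuous_const.sub cF).abs.intervalIntegrable _ _)
      (intervalIntegrable_const (c := I)) h1).trans (le_of_eq ?_)
    rw [intervalIntegral.integral_const, smul_eq_mul, sub_zero, mul_comm]
  rw [abs_mul]
  calc _ ≤ I * |b| := by gcongr
    _ = ∫ y in (0 : ℝ)..l, |F' (x + y)| * |b| := by rw [intervalIntegral.integral_mul_const]
    _ ≤ ∫ y in (0 : ℝ)..l, (F' (x + y) ^ 2 + b ^ 2) := by
      refine intervalIntegral.integral_mono hl.le ((cF'.abs.mul continuous_const).intervalIntegrable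
        _ _) (((cF'.pow 2).add continuous_const).intervalIntegrable _ _) fun y => ?_
      simp only
      nlinarith [sq_nonneg (|F' (x + y)| - |b|), sq_abs (F' (x + y)), sq_abs b,
        sq_nonneg (F' (x + y)), sq_nonneg b]
    _ = _ := by
      have i1 : IntervalIntegrable (fun y => F' (x + y) ^ 2) volume 0 l :=
        (cF'.pow 2).intervalIntegrable _ _
      rw [intervalIntegral.integral_add i1 intervalIntegrable_const, intervalIntegral.integral_const, smul_eq_mul, sub_zero]

-- Meant for ε bounded below, where η_x and q_x are in L² and q is bounded. The flux term is
-- integrated by parts in x. In the time term η is split into its average over length l and a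
-- deviation: the deviation tested against φ_t costs a multiple of l, and the average is integrated
-- by parts in time. No derivative of φ is left in the other terms, which cost a small constant plus
-- a multiple of the squared L² norm of φ.
set_option maxHeartbeats 1000000 in
theorem EntropyFlow.abs_integral_le_of_large (h : EntropyFlow γ ε A r rx ux uxx f g e ex fx gx)
    (cux : Continuous fun z : ℝ × ℝ => ux z.1 z.2) (cuxx : Continuous fun z : ℝ × ℝ => uxx z.1 z.2)
    (dux : ∀ t x, HasDerivAt (ux t) (uxx t x) x) (hN : 0 ≤ N) (hε : 0 ≤ ε) {ε₀ : ℝ} (hε₀ : ε ≤ ε₀)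
    (hC : ∫ z in stripBox (N + 1), ε * (ux z.1 z.2 ^ 2 + ex z.1 z.2 ^ 2) ≤ C) {B B' : ℝ}
    (hB : ∫ z in stripBox (N + 1), (fx z.1 z.2 ^ 2 + gx z.1 z.2 ^ 2) ≤ B)
    (hg : ∀ t x, (t, x) ∈ stripBox (N + 1) → |g t x| ≤ B')
    (hp : TestJet N p pt px) (hk : ∀ t x, |p t x| ≤ k)
    (hpt : ∫ z in stripBox N, pt z.1 z.2 ^ 2 ≤ 1) {α l : ℝ} (hα : 0 < α) (hl : 0 < l)
    (hl1 : l ≤ 1) :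
    |∫ z in stripBox N, (f z.1 z.2 * pt z.1 z.2 + g z.1 z.2 * px z.1 z.2)| ≤
      k * C + l * (B + 1) + α * (2 * N ^ 2 + 2 * C + B) +
        ((2 * B' / l) ^ 2 / α + 2 * (ε₀ * ((A / l) ^ 2 / α)) + 1 / α) *
          ∫ z in stripBox N, p z.1 z.2 ^ 2 := by
  have hA : 0 ≤ A := (abs_nonneg _).trans (h.e_le 0 0)
  have hk0 : 0 ≤ k := (abs_nonneg _).trans (hk 0 0)
  have cf := h.cont_f
  have cg := h.cont_g
  have ce := h.cont_e
  have cex := h.cont_ex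
  have cfx := h.cont_fx
  have cgx := h.cont_gx
  have cp := hp.cont
  have cpt := hp.cont_t
  have cpx := hp.cont_x
  set D : ℝ → ℝ → ℝ := fun t x => ε * (ux t x ^ 2 + ex t x ^ 2) with hD
  have cD : Continuous fun z : ℝ × ℝ => D z.1 z.2 := by simp only [hD]; fun_prop
  have D0 : ∀ t x, 0 ≤ D t x := fun t x => by simp only [hD]; positivity
  have tr : ∀ {F : ℝ → ℝ → ℝ}, (Continuous fun z : ℝ × ℝ => F z.1 z.2) →
      Continuous fun z : ℝ × ℝ => F z.1 (z.2 + l) := fun hF =>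
    hF.comp (by fun_prop : Continuous fun z : ℝ × ℝ => ((z.1, z.2 + l) : ℝ × ℝ))
  have tg := tr cg
  have tu := tr cux
  have te := tr ce
  have tD := tr cD
  have cS := continuous_integral_translate cf l
  have cue := continuous_integral_translate (F := fun t x => ux t x * ex t x) (by fun_prop) l
  have cJ := continuous_integral_translate cD l
  have cf2 := continuous_integral_translate (F := fun t x => fx t x ^ 2) (by fun_prop) l
  set S : ℝ → ℝ → ℝ := fun t x => ∫ y in (0 : ℝ)..l, f t (x + y) with hS
  set U : ℝ → ℝ → ℝ := fun t x => ∫ y in (0 : ℝ)..l, ux t (x + y) * ex t (x + y) with hU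
  set J : ℝ → ℝ → ℝ := fun t x => ∫ y in (0 : ℝ)..l, D t (x + y) with hJ
  set V : ℝ → ℝ → ℝ := fun t x => ∫ y in (0 : ℝ)..l, fx t (x + y) ^ 2 with hV
  set S' : ℝ → ℝ → ℝ := fun t x => -(g t (x + l) - g t x) +
    ε * (ux t (x + l) * e t (x + l) - ux t x * e t x) - ε * U t x with hS'
  have cS' : Continuous fun z : ℝ × ℝ => S' z.1 z.2 := by
    simp only [hS']
    fun_prop
  have J0 : ∀ t x, 0 ≤ J t x := fun t x =>
    intervalIntegral.integral_nonneg hl.le fun y _ => D0 t (x + y)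
  have UJ : ∀ t x, |ε * U t x| ≤ J t x := fun t x => by
    have cc := (continuous_slice (f := fun t x => ux t x * ex t x) (by fun_prop) t).comp
      (by fun_prop : Continuous fun y : ℝ => x + y)
    have cd := (continuous_slice cD t).comp (by fun_prop : Continuous fun y : ℝ => x + y)
    rw [abs_mul, abs_of_nonneg hε, hU]
    simp only
    refine (mul_le_mul_of_nonneg_left (intervalIntegral.abs_integral_le_integral_abs hl.le) hε).trans
      ?_
    rw [← intervalIntegral.integral_const_mul]
    refine intervalIntegral.integral_mono hl.le ((cc.abs.const_mul ε).intervalIntegrable _ _)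
      (cd.intervalIntegrable _ _) fun y => ?_
    simp only [hD]
    refine mul_le_mul_of_nonneg_left ?_ hε
    have := abs_mul_le_add_sq_div (a := ux t (x + y)) (b := ex t (x + y)) one_pos
    linarith
  have a1 := hp.integral_mul_time (F := S) (F' := S') cS cS'
    (fun t x ht => h.hasDerivAt_integral_translate cux cuxx dux l t x ht) hN
  have a2 := hp.integral_mul_space (F := g) (F' := gx) cg cgx h.g_x hN
  have I : ∀ {F : ℝ → ℝ → ℝ}, (Continuous fun z : ℝ × ℝ => F z.1 z.2) →
      IntegrableOn (fun z : ℝ × ℝ => F z.1 z.2) (stripBox N) := fun hF => integrableOn_stripBox hF N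
  have e1 : ∫ z in stripBox N, (f z.1 z.2 * pt z.1 z.2 + g z.1 z.2 * px z.1 z.2) =
      ∫ z in stripBox N, ((f z.1 z.2 - S z.1 z.2 / l) * pt z.1 z.2
        - (S' z.1 z.2 / l * p z.1 z.2 + gx z.1 z.2 * p z.1 z.2)) := by
    have i1 := I (F := fun t x => (f t x - S t x / l) * pt t x) (by fun_prop)
    have i2 := I (F := fun t x => S t x * pt t x) (by fun_prop)
    have i3 := I (F := fun t x => g t x * px t x) (by fun_prop)
    have i4 := I (F := fun t x => S' t x / l * p t x) (by fun_prop)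
    have i5 := I (F := fun t x => gx t x * p t x) (by fun_prop)
    have b1 : ∫ z in stripBox N, (f z.1 z.2 * pt z.1 z.2 + g z.1 z.2 * px z.1 z.2) =
        (∫ z in stripBox N, (f z.1 z.2 - S z.1 z.2 / l) * pt z.1 z.2) +
          1 / l * (∫ z in stripBox N, S z.1 z.2 * pt z.1 z.2) +
          ∫ z in stripBox N, g z.1 z.2 * px z.1 z.2 := by
      rw [← integral_const_mul, ← integral_add i1 (i2.const_mul _)]
      rw [← integral_add (I (F := fun t x => (f t x - S t x / l) * pt t x +
        1 / l * (S t x * pt t x)) (by fun_prop)) i3]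
      congr 1; funext z; field_simp; ring
    have b2 : ∫ z in stripBox N, S' z.1 z.2 / l * p z.1 z.2 =
        1 / l * ∫ z in stripBox N, S' z.1 z.2 * p z.1 z.2 := by
      rw [← integral_const_mul]; congr 1; funext z; ring
    rw [b1, integral_sub i1 (I (F := fun t x => S' t x / l * p t x + gx t x * p t x) (by fun_prop)),
      integral_add i4 i5, b2, a1, a2]
    ring
  rw [e1]
  set Q := (2 * B' / l) ^ 2 / α + 2 * (ε₀ * ((A / l) ^ 2 / α)) + 1 / α with hQ
  refine (abs_integral_stripBox_le (F := fun t x => (f t x - S t x / l) * pt t x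
      - (S' t x / l * p t x + gx t x * p t x))
    (G := fun t x => V t x + l * pt t x ^ 2 + α + α * D t (x + l) + α * D t x + k / l * J t x
      + α * gx t x ^ 2 + Q * p t x ^ 2)
    (by fun_prop) fun t x hz => ?_).trans ?_
  · have h1 : |(f t x - S t x / l) * pt t x| ≤ V t x + l * pt t x ^ 2 :=
      abs_sub_average_mul_le (h.f_x t) (continuous_slice cfx t) hl x (pt t x)
    have hz1 : (t, x) ∈ stripBox (N + 1) := stripBox_subset (by linarith) hz
    have hz2 : (t, x + l) ∈ stripBox (N + 1) :=
      ⟨hz1.1, by have := hz.2.1; simp only at this ⊢; linarith,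
        by have := hz.2.2; simp only at this ⊢; linarith⟩
    have h2 : |(g t (x + l) - g t x) / l * p t x| ≤ α + (2 * B' / l) ^ 2 / α * p t x ^ 2 := by
      have b1 : |(g t (x + l) - g t x) / l| ≤ 2 * B' / l := by
        rw [abs_div, abs_of_pos hl]
        refine div_le_div_of_nonneg_right ((abs_sub _ _).trans ?_) hl.le
        linarith [hg t x hz1, hg t (x + l) hz2]
      have b2 := abs_mul_le_add_sq_div (a := 2 * B' / l * p t x) (b := 1) hα
      have b3 : |2 * B' / l * p t x| = 2 * B' / l * |p t x| := by
        rw [abs_mul, abs_of_nonneg ((abs_nonneg _).trans b1)]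
      rw [mul_one, b3] at b2
      rw [abs_mul]
      refine (mul_le_mul_of_nonneg_right b1 (abs_nonneg _)).trans (b2.trans (le_of_eq ?_))
      ring
    have h3 : ∀ y, |ε * (ux t y * e t y) / l * p t x| ≤
        α * D t y + ε₀ * ((A / l) ^ 2 / α) * p t x ^ 2 := by
      intro y
      have b2 := abs_mul_le_add_sq_div (a := A / l * p t x) (b := ux t y) hα
      have b4 : 0 ≤ α * (ε * ex t y ^ 2) := by positivity
      calc |ε * (ux t y * e t y) / l * p t x| = ε * (|e t y| / l * |p t x| * |ux t y|) := by
            rw [abs_mul, abs_div, abs_of_pos hl, abs_mul, abs_mul, abs_of_nonneg hε]; ring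
        _ ≤ ε * (A / l * |p t x| * |ux t y|) := by gcongr; exact h.e_le t y
        _ = ε * |A / l * p t x * ux t y| := by
            rw [abs_mul, abs_mul, abs_of_nonneg (by positivity : 0 ≤ A / l)]
        _ ≤ ε * ((A / l * p t x) ^ 2 / α + α * ux t y ^ 2) := by gcongr
        _ = ε * ((A / l) ^ 2 / α * p t x ^ 2) + α * (ε * ux t y ^ 2) := by ring
        _ ≤ ε₀ * ((A / l) ^ 2 / α * p t x ^ 2) + α * (ε * ux t y ^ 2) := by gcongr
        _ ≤ _ := by simp only [hD]; linarith
    -- Only an L¹ bound is available for this term, so the bound k on the test function is used; J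
    -- integrates to at most l C, which cancels the 1/l.
    have h4 : |ε * U t x / l * p t x| ≤ k / l * J t x := by
      rw [abs_mul, abs_div, abs_of_pos hl]
      calc _ ≤ J t x / l * k := by
            refine mul_le_mul (div_le_div_of_nonneg_right (UJ t x) hl.le) (hk t x) (abs_nonneg _) ?_
            exact div_nonneg (J0 t x) hl.le
        _ = _ := by ring
    have h5 : |gx t x * p t x| ≤ 1 / α * p t x ^ 2 + α * gx t x ^ 2 := by
      have := abs_mul_le_add_sq_div (a := p t x) (b := gx t x) hα
      rw [mul_comm (gx t x)]
      refine this.trans (le_of_eq ?_); ring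
    have h31 := h3 x
    have h32 := h3 (x + l)
    have e2 : S' t x / l * p t x = -((g t (x + l) - g t x) / l * p t x)
        + ε * (ux t (x + l) * e t (x + l)) / l * p t x - ε * (ux t x * e t x) / l * p t x
        - ε * U t x / l * p t x := by simp only [hS']; ring
    rw [e2, hQ]
    rw [abs_le] at *
    constructor <;> linarith [h1.1, h1.2, h2.1, h2.2, h31.1, h31.2, h32.1, h32.2, h4.1, h4.2, h5.1,
      h5.2]
  · have M1 : N ≤ N + 1 := by linarith
    have hlI : l ∈ Icc (0 : ℝ) 1 := ⟨hl.le, hl1⟩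
    have k1 : ∫ z in stripBox N, V z.1 z.2 ≤ l * B := by
      refine (integral_stripBox_translate_le (F := fun t x => fx t x ^ 2) (by fun_prop)
        (fun _ _ => sq_nonneg _) hN hlI).trans (mul_le_mul_of_nonneg_left ?_ hl.le)
      exact (integral_stripBox_mono (F := fun t x => fx t x ^ 2)
        (G := fun t x => fx t x ^ 2 + gx t x ^ 2) (by fun_prop) (by fun_prop)
        fun t x _ => by linarith [sq_nonneg (gx t x)]).trans hB
    have k2 : ∫ z in stripBox N, D z.1 (z.2 + l) ≤ C :=
      (integral_stripBox_shift_le cD D0 hN hlI).trans hC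
    have k3 : ∫ z in stripBox N, D z.1 z.2 ≤ C := (integral_stripBox_mono_set cD D0 M1).trans hC
    have k4 : ∫ z in stripBox N, J z.1 z.2 ≤ l * C :=
      (integral_stripBox_translate_le cD D0 hN hlI).trans (mul_le_mul_of_nonneg_left hC hl.le)
    have k5 : ∫ z in stripBox N, gx z.1 z.2 ^ 2 ≤ B := by
      refine (integral_stripBox_mono_set (F := fun t x => gx t x ^ 2) (by fun_prop)
        (fun _ _ => sq_nonneg _) M1).trans ?_
      exact (integral_stripBox_mono (F := fun t x => gx t x ^ 2)
        (G := fun t x => fx t x ^ 2 + gx t x ^ 2) (by fun_prop) (by fun_prop)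
        fun t x _ => by linarith [sq_nonneg (fx t x)]).trans hB
    rw [integral_add (I (F := fun t x => V t x + l * pt t x ^ 2 + α + α * D t (x + l) + α * D t x
        + k / l * J t x + α * gx t x ^ 2) (by fun_prop)) (I (F := fun t x => Q * p t x ^ 2)
        (by fun_prop)),
      integral_add (I (F := fun t x => V t x + l * pt t x ^ 2 + α + α * D t (x + l) + α * D t x
        + k / l * J t x) (by fun_prop)) (I (F := fun t x => α * gx t x ^ 2) (by fun_prop)),
      integral_add (I (F := fun t x => V t x + l * pt t x ^ 2 + α + α * D t (x + l) + α * D t x)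
        (by fun_prop)) (I (F := fun t x => k / l * J t x) (by fun_prop)),
      integral_add (I (F := fun t x => V t x + l * pt t x ^ 2 + α + α * D t (x + l))
        (by fun_prop)) (I (F := fun t x => α * D t x) (by fun_prop)),
      integral_add (I (F := fun t x => V t x + l * pt t x ^ 2 + α)
        (by fun_prop)) (I (F := fun t x => α * D t (x + l)) (by fun_prop)),
      integral_add (I (F := fun t x => V t x + l * pt t x ^ 2)
        (by fun_prop)) (I (F := fun _ _ => α) (by fun_prop)),
      integral_add (I (F := fun t x => V t x)
        (by fun_prop)) (I (F := fun t x => l * pt t x ^ 2) (by fun_prop)),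
      integral_const_mul l, integral_const_mul α, integral_const_mul α, integral_const_mul α,
      integral_const_mul (k / l), integral_const_mul Q, integral_stripBox_const hN]
    have k4' := mul_le_mul_of_nonneg_left k4 (by positivity : 0 ≤ k / l)
    have e3 : k / l * (l * C) = k * C := by field_simp
    rw [e3] at k4'
    have k2' := mul_le_mul_of_nonneg_left k2 hα.le
    have k3' := mul_le_mul_of_nonneg_left k3 hα.le
    have k5' := mul_le_mul_of_nonneg_left k5 hα.le
    have k6 := mul_le_mul_of_nonneg_left hpt hl.le
    linarith

end

/-! ### Truncation of test functions -/

/-- A bounded truncation `q` of a test function `p`; its gradient is the one of `p` times a factor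
that is close to `1` where `p` is small. -/
theorem TestJet.exists_truncation {N : ℝ} {p pt px : ℝ → ℝ → ℝ} (hp : TestJet N p pt px) {k : ℝ}
    (hk : 0 < k) : ∃ q b : ℝ → ℝ → ℝ, (Continuous fun z : ℝ × ℝ => b z.1 z.2) ∧
      TestJet N q (fun t x => b t x * pt t x) (fun t x => b t x * px t x) ∧
      ∀ t x, |q t x| ≤ k ∧ q t x ^ 2 ≤ p t x ^ 2 ∧ b t x ^ 2 ≤ 1 ∧ (1 - b t x) ^ 2 ≤ 4 ∧
        (1 - b t x) ^ 2 ≤ 4 / k ^ 2 * p t x ^ 2 := by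
  have cp := hp.cont
  have cpt := hp.cont_t
  have cpx := hp.cont_x
  have n1 : ∀ s : ℝ, (1 + s ^ 2) ≠ 0 := fun s => by positivity
  have n2 : ∀ s : ℝ, (1 + s ^ 2) ^ 2 ≠ 0 := fun s => by positivity
  -- The truncation is k s/(1 + s²) at s = p/k. It vanishes where p does and is smooth, so it is
  -- again an admissible test function.
  have dβ : ∀ s : ℝ, HasDerivAt (fun s : ℝ => k * (s / (1 + s ^ 2)))
      (k * ((1 - s ^ 2) / (1 + s ^ 2) ^ 2)) s := fun s => by
    have h1 : HasDerivAt (fun s : ℝ => 1 + s ^ 2) (2 * s) s := by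
      simpa using (hasDerivAt_pow 2 s).const_add 1
    refine (((hasDerivAt_id s).div h1 (n1 s)).const_mul k).congr_deriv ?_
    simp only [id]
    congr 2; ring
  refine ⟨fun t x => k * (p t x / k / (1 + (p t x / k) ^ 2)),
    fun t x => (1 - (p t x / k) ^ 2) / (1 + (p t x / k) ^ 2) ^ 2, ?_, ⟨?_, ?_, ?_, ?_, ?_, ?_⟩, ?_⟩
  · fun_prop (disch := exact fun _ => n2 _)
  · fun_prop (disch := exact fun _ => n1 _)
  · fun_prop (disch := exact fun _ => n2 _)
  · fun_prop (disch := exact fun _ => n2 _)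
  · intro t x
    refine ((dβ (p t x / k)).comp t ((hp.p_t t x).div_const k)).congr_deriv ?_
    field_simp
  · intro t x
    refine ((dβ (p t x / k)).comp x ((hp.p_x t x).div_const k)).congr_deriv ?_
    field_simp
  · intro t x hne
    refine hp.support t x fun h0 => hne ?_
    rw [h0]; simp
  · intro t x
    have e1 : p t x = k * (p t x / k) := by field_simp
    have e2 : 4 / k ^ 2 * p t x ^ 2 = 4 * (p t x / k) ^ 2 := by field_simp
    set s := p t x / k
    have hs : 0 < 1 + s ^ 2 := by positivity
    have hs2 : 0 < (1 + s ^ 2) ^ 2 := by positivity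
    have q1 : |s / (1 + s ^ 2)| ≤ 1 := by
      rw [abs_div, abs_of_pos hs, div_le_one hs]
      nlinarith [sq_nonneg (|s| - 1), sq_abs s, abs_nonneg s]
    have q2 : |s / (1 + s ^ 2)| ≤ |s| := by
      rw [abs_div, abs_of_pos hs]
      exact div_le_self (abs_nonneg _) (by nlinarith [sq_nonneg s])
    have e3 : 1 - (1 - s ^ 2) / (1 + s ^ 2) ^ 2 = (3 * s ^ 2 + s ^ 4) / (1 + s ^ 2) ^ 2 := by
      field_simp; ring
    have b0 : 0 ≤ (3 * s ^ 2 + s ^ 4) / (1 + s ^ 2) ^ 2 := by positivity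
    have b1 : (3 * s ^ 2 + s ^ 4) / (1 + s ^ 2) ^ 2 ≤ 2 := by
      rw [div_le_iff₀ hs2]; nlinarith [sq_nonneg s, sq_nonneg (s ^ 2)]
    have b2 : (3 * s ^ 2 + s ^ 4) / (1 + s ^ 2) ^ 2 ≤ 2 * |s| := by
      rw [div_le_iff₀ hs2, ← sq_abs s, show s ^ 4 = |s| ^ 4 by rw [Even.pow_abs (by decide)]]
      have ha := abs_nonneg s
      set a := |s|
      -- This product is 2a(1 + a²)² - (3a² + a⁴), the difference of the two sides.
      have : 0 ≤ a * (2 - 3 * a + 4 * a ^ 2 - a ^ 3 + 2 * a ^ 4) := by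
        refine mul_nonneg ha ?_
        nlinarith [sq_nonneg (a ^ 2 - a / 4), sq_nonneg (a - 3 / 8), sq_nonneg (a ^ 2)]
      nlinarith
    refine ⟨?_, ?_, ?_, ?_, ?_⟩
    · rw [abs_mul, abs_of_pos hk]; exact mul_le_of_le_one_right hk.le q1
    · rw [e1, mul_pow, mul_pow]
      refine mul_le_mul_of_nonneg_left ?_ (sq_nonneg k)
      exact sq_le_sq.2 q2
    · have h1 : (1 - s ^ 2) / (1 + s ^ 2) ^ 2 = 1 - (3 * s ^ 2 + s ^ 4) / (1 + s ^ 2) ^ 2 := by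
        rw [← e3]; ring
      change ((1 - s ^ 2) / (1 + s ^ 2) ^ 2) ^ 2 ≤ 1
      rw [h1]; nlinarith
    · rw [e3]; nlinarith
    · rw [e2, e3]
      calc _ ≤ (2 * |s|) ^ 2 := pow_le_pow_left₀ b0 b2 2
        _ = 4 * s ^ 2 := by rw [mul_pow, sq_abs]; norm_num

/-- The factor 1 - b is at most 2 and at most 2|p|/k. The first bound is used on the part w of η² +
q², whose integral is small, the second on the bounded part K. The bounded part thus costs only a
multiple of the squared L² norm of p. -/
theorem abs_integral_truncation_rest_le {f g p pt px b w : ℝ → ℝ → ℝ} {N k α K W : ℝ}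
    (hp : TestJet N p pt px)
    (cw : Continuous fun z : ℝ × ℝ => w z.1 z.2) (hα : 0 < α)
    (hw0 : ∀ t x, 0 ≤ w t x) (hK : 0 ≤ K) (hfg : ∀ t x, f t x ^ 2 + g t x ^ 2 ≤ w t x + K)
    (hW : ∫ z in stripBox N, w z.1 z.2 ≤ W) (hb1 : ∀ t x, (1 - b t x) ^ 2 ≤ 4)
    (hb2 : ∀ t x, (1 - b t x) ^ 2 ≤ 4 / k ^ 2 * p t x ^ 2)
    (hn : ∫ z in stripBox N, (p z.1 z.2 ^ 2 + pt z.1 z.2 ^ 2 + px z.1 z.2 ^ 2) ≤ 1) :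
    |∫ z in stripBox N, (1 - b z.1 z.2) * (f z.1 z.2 * pt z.1 z.2 + g z.1 z.2 * px z.1 z.2)| ≤
      α + 4 / α * W + 4 / k ^ 2 * K / α * ∫ z in stripBox N, p z.1 z.2 ^ 2 := by
  have cp := hp.cont
  have cpt := hp.cont_t
  have cpx := hp.cont_x
  refine (abs_integral_stripBox_le
    (F := fun t x => (1 - b t x) * (f t x * pt t x + g t x * px t x))
    (G := fun t x => α * (p t x ^ 2 + pt t x ^ 2 + px t x ^ 2) + 4 / α * w t x +
      4 / k ^ 2 * K / α * p t x ^ 2) (by fun_prop) fun t x _ => ?_).trans ?_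
  · have h1 := abs_mul_le_add_sq_div (a := (1 - b t x) * f t x) (b := pt t x) hα
    have h2 := abs_mul_le_add_sq_div (a := (1 - b t x) * g t x) (b := px t x) hα
    have h3 : ((1 - b t x) * f t x) ^ 2 / α + ((1 - b t x) * g t x) ^ 2 / α ≤
        4 / α * w t x + 4 / k ^ 2 * K / α * p t x ^ 2 := by
      have : (1 - b t x) ^ 2 * (f t x ^ 2 + g t x ^ 2) ≤
          4 * w t x + 4 / k ^ 2 * p t x ^ 2 * K := by
        calc _ ≤ (1 - b t x) ^ 2 * (w t x + K) :=
              mul_le_mul_of_nonneg_left (hfg t x) (sq_nonneg _)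
          _ = (1 - b t x) ^ 2 * w t x + (1 - b t x) ^ 2 * K := by ring
          _ ≤ _ := add_le_add (mul_le_mul_of_nonneg_right (hb1 t x) (hw0 t x))
              (mul_le_mul_of_nonneg_right (hb2 t x) hK)
      calc _ = (1 - b t x) ^ 2 * (f t x ^ 2 + g t x ^ 2) / α := by ring
        _ ≤ (4 * w t x + 4 / k ^ 2 * p t x ^ 2 * K) / α := div_le_div_of_nonneg_right this hα.le
        _ = _ := by ring
    have h4 : 0 ≤ α * p t x ^ 2 := by positivity
    calc _ = |(1 - b t x) * f t x * pt t x + (1 - b t x) * g t x * px t x| := by congr 1; ring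
      _ ≤ _ := (abs_add_le _ _).trans (by linarith)
  · have I : ∀ {F : ℝ → ℝ → ℝ}, (Continuous fun z : ℝ × ℝ => F z.1 z.2) →
        IntegrableOn (fun z : ℝ × ℝ => F z.1 z.2) (stripBox N) := fun hF => integrableOn_stripBox hF N
    rw [integral_add (I (F := fun t x => α * (p t x ^ 2 + pt t x ^ 2 + px t x ^ 2) + 4 / α * w t x)
        (by fun_prop)) (I (F := fun t x => 4 / k ^ 2 * K / α * p t x ^ 2) (by fun_prop)),
      integral_add (I (F := fun t x => α * (p t x ^ 2 + pt t x ^ 2 + px t x ^ 2)) (by fun_prop))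
        (I (F := fun t x => 4 / α * w t x) (by fun_prop)), integral_const_mul α,
      integral_const_mul (4 / α), integral_const_mul (4 / k ^ 2 * K / α)]
    have h1 := mul_le_mul_of_nonneg_left hn hα.le
    have h2 := mul_le_mul_of_nonneg_left hW (by positivity : 0 ≤ 4 / α)
    linarith

/-! ### Bounds on entropy derivatives and the uniform estimate -/

section

variable {γ ε A : ℝ} {ρl ρr ul ur : ℝ} {r u rx rxx ux uxx f g e ex fx gx : ℝ → ℝ → ℝ} {N C : ℝ}

theorem EntropyFlow.integral_dissipation_sq_le (h : EntropyFlow γ ε A r rx ux uxx f g e ex fx gx)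
    (hv : ViscousFlow γ ε ρl ρr ul ur r u rx rxx ux uxx) (hB : FlowBounds γ ε N C r u rx ux)
    (hA : 0 ≤ A) (hε : 0 ≤ ε) (hN : 0 ≤ N) :
    ∫ z in stripBox N, ε * (ux z.1 z.2 ^ 2 + ex z.1 z.2 ^ 2) ≤ (1 + 2 * A) * |C| := by
  have cux := hv.cont_ux
  have crx := hv.cont_rx
  have cex := h.cont_ex
  obtain ⟨P, hP, eP⟩ := exists_continuous_rpow hv.cont_r (fun z => hv.pos z.1 z.2) (γ - 3)
  have c1 : Continuous fun z : ℝ × ℝ => ε * (r z.1 z.2 ^ (γ - 3) * rx z.1 z.2 ^ 2) := by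
    simp only [eP]; fun_prop
  have c2 : Continuous fun z : ℝ × ℝ => ε * ux z.1 z.2 ^ 2 := by fun_prop
  have b1 := hB.dissipation_u
  have b2 := hB.dissipation_r
  rw [← integral_stripBox_eq (F := fun t x => ε * ux t x ^ 2) c2 hN] at b1
  rw [← integral_stripBox_eq (F := fun t x => ε * (r t x ^ (γ - 3) * rx t x ^ 2)) c1 hN] at b2
  have hC := le_abs_self C
  refine (integral_stripBox_mono (F := fun t x => ε * (ux t x ^ 2 + ex t x ^ 2))
    (G := fun t x => (1 + A) * (ε * ux t x ^ 2) + A * (ε * (r t x ^ (γ - 3) * rx t x ^ 2)))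
    (by fun_prop) (by fun_prop) fun t x _ => ?_).trans ?_
  · have := mul_le_mul_of_nonneg_left (h.ex_le t x) hε
    linarith
  · rw [integral_add ((integrableOn_stripBox (F := fun t x => ε * ux t x ^ 2) c2 N).const_mul (1 + A))
      ((integrableOn_stripBox (F := fun t x => ε * (r t x ^ (γ - 3) * rx t x ^ 2)) c1 N).const_mul A),
      integral_const_mul (1 + A), integral_const_mul A]
    have h1 := mul_le_mul_of_nonneg_left (b1.trans hC) (by positivity : 0 ≤ 1 + A)
    have h2 := mul_le_mul_of_nonneg_left (b2.trans hC) hA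
    linarith

/-- The missing weights are inserted by 1 ≤ R³/ρ³ and 1 ≤ ε/d, which reduces the gradient to
quantities already bounded. The constant blows up as d tends to 0, but d is fixed when this is used.
-/
theorem EntropyFlow.integral_gradient_sq_le (h : EntropyFlow γ ε A r rx ux uxx f g e ex fx gx)
    (hγ : 1 < γ)
    (hv : ViscousFlow γ ε ρl ρr ul ur r u rx rxx ux uxx) (hB : FlowBounds γ ε N C r u rx ux)
    (hA : 0 ≤ A) (hN : 0 ≤ N) {d R : ℝ} (hd : 0 < d) (hdε : d ≤ ε)
    (hR : ∀ t x, (t, x) ∈ stripBox N → r t x ≤ R) (hR0 : 0 ≤ R) :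
    ∫ z in stripBox N, (fx z.1 z.2 ^ 2 + gx z.1 z.2 ^ 2) ≤
      A * ((1 + R) * (1 + R ^ gasTheta γ) ^ 2) ^ 2 * (R ^ 3 / d ^ 2 * (N * |C|) + |C| / d) := by
  have cux := hv.cont_ux
  have crx := hv.cont_rx
  have cr := hv.cont_r
  have cfx := h.cont_fx
  have cgx := h.cont_gx
  have hε : 0 < ε := hd.trans_le hdε
  have c1 : Continuous fun z : ℝ × ℝ => ε ^ 2 * (rx z.1 z.2 ^ 2 / r z.1 z.2 ^ 3) := by
    fun_prop (disch := exact fun z => (pow_pos (hv.pos z.1 z.2) 3).ne')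
  have c2 : Continuous fun z : ℝ × ℝ => ε * ux z.1 z.2 ^ 2 := by fun_prop
  have b1 := hB.dissipation_u
  rw [← integral_stripBox_eq (F := fun t x => ε * ux t x ^ 2) c2 hN] at b1
  have hC := le_abs_self C
  have b2 : ∫ z in stripBox N, ε ^ 2 * (rx z.1 z.2 ^ 2 / r z.1 z.2 ^ 3) ≤ N * |C| := by
    rw [integral_stripBox_eq (F := fun t x => ε ^ 2 * (rx t x ^ 2 / r t x ^ 3)) c1 hN]
    refine (intervalIntegral.integral_mono_on hN ((continuous_integral_slice
      (f := fun t x => ε ^ 2 * (rx t x ^ 2 / r t x ^ 3)) c1 (-N) N).intervalIntegrable _ _)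
      (intervalIntegrable_const (c := |C|)) fun t ht => (hB.gradient t ht).trans hC).trans ?_
    simp
  set T := ((1 + R) * (1 + R ^ gasTheta γ) ^ 2) ^ 2 with hT
  have hRθ : 0 ≤ R ^ gasTheta γ := Real.rpow_nonneg hR0 _
  refine (integral_stripBox_mono (F := fun t x => fx t x ^ 2 + gx t x ^ 2)
    (G := fun t x => A * T * (R ^ 3 / d ^ 2 * (ε ^ 2 * (rx t x ^ 2 / r t x ^ 3)) +
      1 / d * (ε * ux t x ^ 2))) (by fun_prop) (by fun_prop) fun t x hz => ?_).trans ?_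
  · have hr := hv.pos t x
    have hrR := hR t x hz
    refine (h.gradient t x).trans ?_
    rw [mul_assoc]
    refine mul_le_mul_of_nonneg_left ?_ hA
    have hrc : 0 ≤ r t x ^ gasTheta γ := Real.rpow_nonneg hr.le _
    have h1 : ((1 + r t x) * (1 + r t x ^ gasTheta γ) ^ 2) ^ 2 ≤ T := by
      rw [hT]
      have := Real.rpow_le_rpow hr.le hrR (gasTheta_pos hγ).le
      gcongr
    refine mul_le_mul h1 (add_le_add ?_ ?_) (by positivity) (by positivity)
    · have h2 : 1 ≤ ε ^ 2 / d ^ 2 := by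
        rw [one_le_div (by positivity)]; gcongr
      have h3 : 1 ≤ R ^ 3 / r t x ^ 3 := by
        rw [one_le_div (by positivity)]; gcongr
      calc rx t x ^ 2 = 1 * 1 * rx t x ^ 2 := by ring
        _ ≤ (ε ^ 2 / d ^ 2) * (R ^ 3 / r t x ^ 3) * rx t x ^ 2 := by gcongr
        _ = _ := by ring
    · have h2 : 1 ≤ ε / d := by rwa [one_le_div hd]
      calc ux t x ^ 2 = 1 * ux t x ^ 2 := by ring
        _ ≤ ε / d * ux t x ^ 2 := by gcongr
        _ = _ := by ring
  · rw [integral_const_mul (A * T)]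
    rw [integral_add ((integrableOn_stripBox (F := fun t x => ε ^ 2 * (rx t x ^ 2 / r t x ^ 3)) c1
      N).const_mul (R ^ 3 / d ^ 2)) ((integrableOn_stripBox (F := fun t x => ε * ux t x ^ 2) c2
      N).const_mul (1 / d)), integral_const_mul (R ^ 3 / d ^ 2), integral_const_mul (1 / d)]
    refine mul_le_mul_of_nonneg_left (add_le_add ?_ ?_) (by positivity)
    · exact mul_le_mul_of_nonneg_left b2 (by positivity)
    · rw [one_div, inv_mul_eq_div]
      exact div_le_div_of_nonneg_right (b1.trans hC) hd.le

end

theorem abs_le_one_add_sq (a : ℝ) : |a| ≤ 1 + a ^ 2 := by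
  rw [← sq_abs a]; nlinarith [sq_nonneg (|a| - 1), abs_nonneg a]

set_option maxHeartbeats 1000000 in
/-- The entropy dissipation, tested against functions of norm one in `H¹`, is small up to a multiple
of the square of the `L²` norm, uniformly in the viscosity. -/
theorem exists_dissipation_le {γ : ℝ} (hγ : 1 < γ) {ε₀ A : ℝ} (hA : 0 < A)
    {ρl ρr ul ur : ℝ} (hρl : 0 < ρl) (hρr : 0 < ρr) {ρbar ubar : ℝ → ℝ}
    (hbar : IsReferenceProfile ρl ρr ul ur ρbar ubar) (E₀ E₁ M₀ : ℝ) {N : ℝ} (hN : 0 < N) {δ : ℝ}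
    (hδ : 0 < δ) :
    ∃ K : ℝ, 0 ≤ K ∧ ∀ ε ∈ Ioc 0 ε₀, ∀ (ρ₀ u₀ : ℝ → ℝ) (r u rx rxx ux uxx f g e ex fx gx : ℝ → ℝ → ℝ),
      HasDataBounds γ ε ρbar ubar E₀ E₁ M₀ ρ₀ u₀ → (∀ x, r 0 x = ρ₀ x) → (∀ x, u 0 x = u₀ x) →
      ViscousFlow γ ε ρl ρr ul ur r u rx rxx ux uxx →
      EntropyFlow γ ε A r rx ux uxx f g e ex fx gx →
      ∀ p pt px : ℝ → ℝ → ℝ, TestJet N p pt px →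
        ∫ z in stripBox N, (p z.1 z.2 ^ 2 + pt z.1 z.2 ^ 2 + px z.1 z.2 ^ 2) ≤ 1 →
        |∫ z in stripBox N, (f z.1 z.2 * pt z.1 z.2 + g z.1 z.2 * px z.1 z.2)| ≤
          δ + K * ∫ z in stripBox N, p z.1 z.2 ^ 2 := by
  have hθ := gasTheta_pos hγ
  have hM : 0 < N + 1 := by linarith
  obtain ⟨C, hC⟩ := exists_flowBounds hγ (ε₀ := ε₀) hρl hρr hbar E₀ E₁ M₀ hM
  obtain ⟨C', hC'⟩ := exists_integral_rpow_succ_le hγ (ε₀ := ε₀) C hN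
  set CD := (1 + 2 * A) * |C| with hCD
  have CD0 : 0 ≤ CD := by positivity
  set k := δ / (8 * (CD + 1)) with hk
  have k0 : 0 < k := by positivity
  -- Every error below is made at most δ/8: two from the truncation remainder and three from either
  -- regime of ε, in total 5δ/8.
  have kC : k * CD ≤ δ / 8 := by
    rw [hk, div_mul_eq_mul_div, div_le_div_iff₀ (by positivity) (by positivity)]
    nlinarith
  -- The coefficient of ρ^(γ+1) is chosen so small that, after the factor 4/(δ/8) of the truncation
  -- remainder, it still contributes at most δ/8. The possibly large S only multiplies the squared
  -- L² norm.
  obtain ⟨S, hS0, hS⟩ := exists_sq_mul_one_add_rpow_le hγ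
    (δ := δ ^ 2 / (8 * 4 * 8 * A * (|C'| + 1))) (by positivity)
  set σ := δ ^ 2 / (8 * 4 * 8 * A * (|C'| + 1)) with hσ
  have σ0 : 0 < σ := by positivity
  have hrest : 4 / (δ / 8) * (A * σ * |C'|) ≤ δ / 8 := by
    have : 4 / (δ / 8) * (A * σ * |C'|) = δ / 8 * (|C'| / (|C'| + 1)) := by
      rw [hσ]; field_simp
    rw [this]
    exact mul_le_of_le_one_right (by positivity) (div_le_one_of_le₀ (by linarith) (by positivity))
  set α := δ / (8 * A) with hα
  have α0 : 0 < α := by positivity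
  -- This value separates small from large viscosities. It depends only on δ and on constants
  -- uniform in ε, so R, B, B', l, β and Q below may depend on it.
  set d := α * δ / (8 * A * (CD + 1)) with hd
  have d0 : 0 < d := by positivity
  have hsmall : ∀ ε, ε ≤ d → A * (ε / α * CD + α) ≤ δ / 8 + δ / 8 := by
    intro ε hε
    have h1 : A * α = δ / 8 := by rw [hα]; field_simp
    have h2 : A * (d / α * CD) = δ / 8 * (CD / (CD + 1)) := by rw [hd]; field_simp
    have h3 : A * (ε / α * CD) ≤ A * (d / α * CD) := by gcongr
    have h4 : δ / 8 * (CD / (CD + 1)) ≤ δ / 8 :=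
      mul_le_of_le_one_right (by positivity) (div_le_one_of_le₀ (by linarith) (by positivity))
    linarith
  set R := |Real.exp ((C + C / d ^ 2) / 2) * C / (2 * (N + 1))| with hR
  have R0 : 0 ≤ R := abs_nonneg _
  have Rθ : 0 ≤ R ^ gasTheta γ := Real.rpow_nonneg R0 _
  set B := A * ((1 + R) * (1 + R ^ gasTheta γ) ^ 2) ^ 2 *
    (R ^ 3 / d ^ 2 * ((N + 1) * |C|) + |C| / d) with hB
  have B0 : 0 ≤ B := by positivity
  set B' := 1 + A * (R ^ 2 * (1 + R ^ gasTheta γ)) with hB'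
  set l := min 1 (δ / (8 * (B + 1))) with hl
  have l0 : 0 < l := lt_min one_pos (by positivity)
  have hlB : l * (B + 1) ≤ δ / 8 := by
    calc _ ≤ δ / (8 * (B + 1)) * (B + 1) := by gcongr; exact min_le_right _ _
      _ = δ / 8 := by field_simp
  set β := δ / (8 * (2 * N ^ 2 + 2 * CD + B + 1)) with hβ
  have β0 : 0 < β := by positivity
  have hβB : β * (2 * N ^ 2 + 2 * CD + B) ≤ δ / 8 := by
    have : δ / 8 = β * (2 * N ^ 2 + 2 * CD + B + 1) := by rw [hβ]; field_simp
    rw [this]; exact mul_le_mul_of_nonneg_left (by linarith) β0.le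
  set Q := (2 * B' / l) ^ 2 / β + 2 * (|ε₀| * ((A / l) ^ 2 / β)) + 1 / β with hQ
  have Q0 : 0 ≤ Q := by positivity
  refine ⟨4 / k ^ 2 * (A * S) / (δ / 8) + Q, by positivity, ?_⟩
  intro ε hε ρ₀ u₀ r u rx rxx ux uxx f g e ex fx gx hdata hr hu hv h p pt px hp hn
  have hε0 : 0 < ε := hε.1
  have hFB := hC ε hε ρ₀ u₀ r u rx rxx ux uxx hdata hr hu hv
  have hpow := hC' ε hε ρl ρr ul ur r u rx rxx ux uxx hv hFB
  obtain ⟨P, hP, eP⟩ := exists_continuous_rpow hv.cont_r (fun z => hv.pos z.1 z.2) γ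
  have cr := hv.cont_r
  have crg : Continuous fun z : ℝ × ℝ => r z.1 z.2 * r z.1 z.2 ^ γ := by
    simp only [eP]; fun_prop
  rw [← integral_stripBox_eq (F := fun t x => r t x * r t x ^ γ) crg hN.le] at hpow
  have hD := h.integral_dissipation_sq_le hv hFB hA.le hε0.le hM.le
  rw [← hCD] at hD
  have cux := hv.cont_ux
  have cex := h.cont_ex
  have hDN : ∫ z in stripBox N, ε * (ux z.1 z.2 ^ 2 + ex z.1 z.2 ^ 2) ≤ CD :=
    (integral_stripBox_mono_set (F := fun t x => ε * (ux t x ^ 2 + ex t x ^ 2)) (by fun_prop)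
      (fun t x => by positivity) (by linarith : N ≤ N + 1)).trans hD
  obtain ⟨q, b, cb, hq, hqb⟩ := hp.exists_truncation k0
  have cp := hp.cont
  have cpt := hp.cont_t
  have cpx := hp.cont_x
  have cq := hq.cont
  have cf := h.cont_f
  have cg := h.cont_g
  have hrest' := abs_integral_truncation_rest_le (f := f) (g := g)
    (w := fun t x => A * σ * (r t x * r t x ^ γ)) (K := A * S) (k := k) (W := A * σ * |C'|) hp
    (by fun_prop) (by positivity : 0 < δ / 8)
    (fun t x => mul_nonneg (by positivity) (mul_nonneg (hv.pos t x).le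
      (Real.rpow_nonneg (hv.pos t x).le _))) (by positivity)
    (fun t x => (h.growth t x).trans (by
      have := mul_le_mul_of_nonneg_left (hS (r t x) (hv.pos t x)) hA.le
      linarith))
    (by
      rw [integral_const_mul]
      exact mul_le_mul_of_nonneg_left (hpow.trans (le_abs_self _)) (by positivity))
    (fun t x => (hqb t x).2.2.2.1) (fun t x => (hqb t x).2.2.2.2) hn
  have hqq : ∫ z in stripBox N, q z.1 z.2 ^ 2 ≤ ∫ z in stripBox N, p z.1 z.2 ^ 2 :=
    integral_stripBox_mono (F := fun t x => q t x ^ 2) (G := fun t x => p t x ^ 2) (by fun_prop)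
      (by fun_prop) fun t x _ => (hqb t x).2.1
  have hbt : ∀ t x, (b t x * pt t x) ^ 2 ≤ p t x ^ 2 + pt t x ^ 2 + px t x ^ 2 := fun t x => by
    have := mul_le_mul_of_nonneg_right (hqb t x).2.2.1 (sq_nonneg (pt t x))
    rw [mul_pow]; linarith [sq_nonneg (p t x), sq_nonneg (px t x)]
  have hbx : ∀ t x, (b t x * px t x) ^ 2 ≤ p t x ^ 2 + pt t x ^ 2 + px t x ^ 2 := fun t x => by
    have := mul_le_mul_of_nonneg_right (hqb t x).2.2.1 (sq_nonneg (px t x))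
    rw [mul_pow]; linarith [sq_nonneg (p t x), sq_nonneg (pt t x)]
  have hqt : ∫ z in stripBox N, (b z.1 z.2 * pt z.1 z.2) ^ 2 ≤ 1 :=
    (integral_stripBox_mono (F := fun t x => (b t x * pt t x) ^ 2)
      (G := fun t x => p t x ^ 2 + pt t x ^ 2 + px t x ^ 2) (by fun_prop) (by fun_prop)
      fun t x _ => hbt t x).trans hn
  have hqx : ∫ z in stripBox N, (b z.1 z.2 * px z.1 z.2) ^ 2 ≤ 1 :=
    (integral_stripBox_mono (F := fun t x => (b t x * px t x) ^ 2)
      (G := fun t x => p t x ^ 2 + pt t x ^ 2 + px t x ^ 2) (by fun_prop) (by fun_prop)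
      fun t x _ => hbx t x).trans hn
  have hp0 : 0 ≤ ∫ z in stripBox N, p z.1 z.2 ^ 2 := integral_nonneg fun _ => sq_nonneg _
  have hmain : |∫ z in stripBox N, (f z.1 z.2 * (b z.1 z.2 * pt z.1 z.2)
      + g z.1 z.2 * (b z.1 z.2 * px z.1 z.2))| ≤
      3 * (δ / 8) + Q * ∫ z in stripBox N, p z.1 z.2 ^ 2 := by
    -- Below d the factor ε makes the viscous term small; above d the density bound and the L²
    -- bounds on the gradients are available.
    rcases le_total ε d with hεd | hεd
    · have h1 := h.abs_integral_le_of_small cux hv.cont_uxx hv.ux_x hN.le hε0.le hDN hq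
        (fun t x => (hqb t x).1) hqx α0
      have h2 := hsmall ε hεd
      have h3 := mul_nonneg Q0 hp0
      linarith
    · have hrR : ∀ t x, (t, x) ∈ stripBox (N + 1) → r t x ≤ R := fun t x hz =>
        (hv.density_le hM hFB d0 hεd hz.1 hz.2).trans (le_abs_self _)
      have hBB := h.integral_gradient_sq_le hγ hv hFB hA.le hM.le d0 hεd hrR R0
      have hgB : ∀ t x, (t, x) ∈ stripBox (N + 1) → |g t x| ≤ B' := by
        intro t x hz
        have h1 := h.growth t x
        have hr0 := hv.pos t x
        have h2 : r t x ^ 2 * (1 + r t x ^ gasTheta γ) ≤ R ^ 2 * (1 + R ^ gasTheta γ) := by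
          have h3 := hrR t x hz
          have h4 := Real.rpow_le_rpow hr0.le h3 hθ.le
          have h5 : 0 ≤ r t x ^ gasTheta γ := Real.rpow_nonneg hr0.le _
          gcongr
        have h3 := mul_le_mul_of_nonneg_left h2 hA.le
        have h6 := abs_le_one_add_sq (g t x)
        linarith [sq_nonneg (f t x)]
      have h1 := h.abs_integral_le_of_large cux hv.cont_uxx hv.ux_x hN.le hε0.le
        (hε.2.trans (le_abs_self ε₀)) hD hBB hgB hq (fun t x => (hqb t x).1) hqt β0 l0
        (min_le_left _ _)
      have h3 := mul_le_mul_of_nonneg_left hqq Q0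
      linarith
  have hsplit : ∫ z in stripBox N, (f z.1 z.2 * pt z.1 z.2 + g z.1 z.2 * px z.1 z.2) =
      (∫ z in stripBox N, (f z.1 z.2 * (b z.1 z.2 * pt z.1 z.2)
      + g z.1 z.2 * (b z.1 z.2 * px z.1 z.2))) + ∫ z in stripBox N, (1 - b z.1 z.2) *
        (f z.1 z.2 * pt z.1 z.2 + g z.1 z.2 * px z.1 z.2) := by
    rw [← integral_add (integrableOn_stripBox (F := fun t x => f t x * (b t x * pt t x)
      + g t x * (b t x * px t x)) (by fun_prop) N) (integrableOn_stripBox (F := fun t x =>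
      (1 - b t x) * (f t x * pt t x + g t x * px t x)) (by fun_prop) N)]
    congr 1; funext z; ring
  rw [hsplit]
  refine (abs_add_le _ _).trans ((add_le_add hmain hrest').trans ?_)
  linarith

/-! ### Poincaré's inequality on a grid -/

theorem integral_sub_const_sq {w : ℝ → ℝ} (hw : Continuous w) (a b c : ℝ) :
    ∫ x in a..b, (w x - c) ^ 2 =
      (∫ x in a..b, w x ^ 2) - 2 * c * (∫ x in a..b, w x) + c ^ 2 * (b - a) := by
  have i1 : IntervalIntegrable (fun x => w x ^ 2) volume a b := (hw.pow 2).intervalIntegrable _ _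
  have i2 : IntervalIntegrable (fun x => 2 * c * w x) volume a b :=
    (hw.const_mul (2 * c)).intervalIntegrable _ _
  have i3 : IntervalIntegrable (fun x => w x ^ 2 - 2 * c * w x) volume a b := i1.sub i2
  have e1 : ∀ x, (w x - c) ^ 2 = w x ^ 2 - 2 * c * w x + c ^ 2 := fun x => by ring
  simp_rw [e1]
  rw [intervalIntegral.integral_add i3 intervalIntegrable_const,
    intervalIntegral.integral_sub i1 i2, intervalIntegral.integral_const_mul,
    intervalIntegral.integral_const, smul_eq_mul]
  ring

/-- Cauchy–Schwarz, from the fact that the integral of the squared deviation from the mean is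
nonnegative. -/
theorem sq_integral_le {w : ℝ → ℝ} (hw : Continuous w) {a b : ℝ} (hab : a ≤ b) :
    (∫ x in a..b, w x) ^ 2 ≤ (b - a) * ∫ x in a..b, w x ^ 2 := by
  rcases hab.eq_or_lt with rfl | hlt
  · simp
  have h0 : 0 < b - a := sub_pos.2 hlt
  have h1 : 0 ≤ ∫ x in a..b, (w x - (∫ x in a..b, w x) / (b - a)) ^ 2 :=
    intervalIntegral.integral_nonneg hab fun x _ => sq_nonneg _
  rw [integral_sub_const_sq hw] at h1
  set I := ∫ x in a..b, w x
  have e1 : (b - a) * ((∫ x in a..b, w x ^ 2) - 2 * (I / (b - a)) * I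
      + (I / (b - a)) ^ 2 * (b - a)) = (b - a) * (∫ x in a..b, w x ^ 2) - I ^ 2 := by
    field_simp; ring
  nlinarith [mul_nonneg h0.le h1]

/-- Poincaré's inequality on an interval of length `h`. -/
theorem integral_sq_le_of_hasDerivAt {w w' : ℝ → ℝ} (hw : Continuous w) (hw' : Continuous w')
    {a h : ℝ} (hh : 0 < h) (hd : ∀ x ∈ Ioo a (a + h), HasDerivAt w (w' x) x) :
    ∫ x in a..a + h, w x ^ 2 ≤
      h ^ 2 * (∫ x in a..a + h, w' x ^ 2) + 1 / h * (∫ x in a..a + h, w x) ^ 2 := by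
  have hab : a ≤ a + h := by linarith
  set I := ∫ x in a..a + h, |w' x| with hI
  have osc : ∀ y ∈ Icc a (a + h), ∀ x ∈ Icc a (a + h), y ≤ x → |w x - w y| ≤ I := by
    intro y hy x hx hyx
    have e1 := intervalIntegral.integral_eq_sub_of_hasDerivAt_of_le hyx hw.continuousOn
      (fun z hz => hd z ⟨hy.1.trans_lt hz.1, hz.2.trans_le hx.2⟩) (hw'.intervalIntegrable _ _)
    rw [← e1]
    refine (intervalIntegral.abs_integral_le_integral_abs hyx).trans ?_
    exact intervalIntegral.integral_mono_interval hy.1 hyx hx.2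
      (Eventually.of_forall fun _ => abs_nonneg _) (hw'.abs.intervalIntegrable _ _)
  have osc' : ∀ y ∈ Icc a (a + h), ∀ x ∈ Icc a (a + h), |w x - w y| ≤ I := by
    intro y hy x hx
    rcases le_total y x with hyx | hyx
    · exact osc y hy x hx hyx
    · rw [abs_sub_comm]; exact osc x hx y hy hyx
  set c := (∫ x in a..a + h, w x) / h with hc
  have dev : ∀ x ∈ Icc a (a + h), |w x - c| ≤ I := by
    intro x hx
    have e1 : w x - c = (∫ y in a..a + h, (w x - w y)) / h := by
      rw [intervalIntegral.integral_sub intervalIntegrable_const (hw.intervalIntegrable _ _),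
        intervalIntegral.integral_const, smul_eq_mul, hc, add_sub_cancel_left]
      field_simp
    rw [e1, abs_div, abs_of_pos hh, div_le_iff₀ hh]
    refine (intervalIntegral.abs_integral_le_integral_abs hab).trans ?_
    refine (intervalIntegral.integral_mono_on hab
      ((continuous_const.sub hw).abs.intervalIntegrable _ _)
      (intervalIntegrable_const (c := I)) fun y hy => osc' y hy x hx).trans (le_of_eq ?_)
    rw [intervalIntegral.integral_const, smul_eq_mul, add_sub_cancel_left, mul_comm]
  have hI2 : I ^ 2 ≤ h * ∫ x in a..a + h, w' x ^ 2 := by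
    have := sq_integral_le hw'.abs hab
    simpa only [sq_abs, add_sub_cancel_left] using this
  have h1 : ∫ x in a..a + h, (w x - c) ^ 2 ≤ h * I ^ 2 := by
    have iw : IntervalIntegrable (fun x => (w x - c) ^ 2) volume a (a + h) :=
      ((hw.sub continuous_const).pow 2).intervalIntegrable _ _
    refine (intervalIntegral.integral_mono_on hab iw
      (intervalIntegrable_const (c := I ^ 2)) fun x hx => ?_).trans (le_of_eq ?_)
    · rw [← sq_abs]
      exact pow_le_pow_left₀ (abs_nonneg _) (dev x hx) 2
    · rw [intervalIntegral.integral_const, smul_eq_mul, add_sub_cancel_left]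
  rw [integral_sub_const_sq hw, add_sub_cancel_left] at h1
  have e2 : -(2 * c * ∫ x in a..a + h, w x) + c ^ 2 * h =
      -(1 / h * (∫ x in a..a + h, w x) ^ 2) := by
    rw [hc]; field_simp; ring
  nlinarith [mul_le_mul_of_nonneg_left hI2 hh.le]

theorem integral_eq_sum_uniform {w : ℝ → ℝ} (hw : Continuous w) (a h : ℝ) (m : ℕ) :
    ∫ x in a..a + m * h, w x = ∑ i ∈ Finset.range m, ∫ x in a + i * h..a + i * h + h, w x := by
  have := intervalIntegral.sum_integral_adjacent_intervals (f := w) (μ := volume)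
    (a := fun i : ℕ => a + i * h) (n := m) fun i _ => hw.intervalIntegrable _ _
  simp only [Nat.cast_zero, zero_mul, add_zero] at this
  rw [← this]
  refine Finset.sum_congr rfl fun i _ => ?_
  congr 1
  push_cast; ring

/-- Poincaré's inequality on an interval that is divided into `m` equal parts. -/
theorem integral_sq_le_sum {w w' : ℝ → ℝ} (hw : Continuous w) (hw' : Continuous w')
    {a h : ℝ} (hh : 0 < h) (hd : ∀ x, a < x → HasDerivAt w (w' x) x) (m : ℕ) :
    ∫ x in a..a + m * h, w x ^ 2 ≤ h ^ 2 * (∫ x in a..a + m * h, w' x ^ 2) +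
      1 / h * ∑ i ∈ Finset.range m, (∫ x in a + i * h..a + i * h + h, w x) ^ 2 := by
  rw [integral_eq_sum_uniform (w := fun x => w x ^ 2) (hw.pow 2),
    integral_eq_sum_uniform (w := fun x => w' x ^ 2) (hw'.pow 2), Finset.mul_sum,
    Finset.mul_sum, ← Finset.sum_add_distrib]
  refine Finset.sum_le_sum fun i _ => integral_sq_le_of_hasDerivAt hw hw' hh fun x hx => hd x ?_
  have : 0 ≤ (i : ℝ) * h := by positivity
  linarith [hx.1]

/-- The integral over the cell `(i, j)` of the subdivision of `[0, N] × [-N, N]` into `m²` cells. -/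
noncomputable def cellIntegral (N : ℝ) (m : ℕ) (p : ℝ → ℝ → ℝ) (i j : ℕ) : ℝ :=
  ∫ t in 0 + i * (N / m)..0 + i * (N / m) + N / m,
    ∫ x in -N + j * (2 * N / m)..-N + j * (2 * N / m) + 2 * N / m, p t x

/-- Poincaré's inequality in x on m strips leaves the strip integrals a_j(t), to which it is applied
again in t. By Cauchy–Schwarz the squared derivative of a_j is at most the strip width k times the
integral of p_t² over the strip; this k cancels the 1/k from the first application. -/
theorem TestJet.integral_sq_le_sum_cellIntegral {N : ℝ} {p pt px : ℝ → ℝ → ℝ}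
    (hp : TestJet N p pt px) (hN : 0 < N) {m : ℕ} (hm : 0 < m) :
    ∫ z in stripBox N, p z.1 z.2 ^ 2 ≤ (2 * N / m) ^ 2 * (∫ z in stripBox N, px z.1 z.2 ^ 2) +
      (N / m) ^ 2 * (∫ z in stripBox N, pt z.1 z.2 ^ 2) + 1 / (2 * N / m) * (1 / (N / m)) *
        ∑ i ∈ Finset.range m, ∑ j ∈ Finset.range m, cellIntegral N m p i j ^ 2 := by
  have cp := hp.cont
  have cpt := hp.cont_t
  have cpx := hp.cont_x
  have hm' : (0 : ℝ) < m := Nat.cast_pos.2 hm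
  set k := 2 * N / m with hk
  set l := N / m with hl
  have k0 : 0 < k := by positivity
  have l0 : 0 < l := by positivity
  have ek : -N + m * k = N := by rw [hk]; field_simp; ring
  have el : 0 + m * l = N := by rw [hl]; field_simp; ring
  set y : ℕ → ℝ := fun j => -N + j * k with hy
  set a : ℕ → ℝ → ℝ := fun j t => ∫ x in y j..y j + k, p t x with ha
  set a' : ℕ → ℝ → ℝ := fun j t => ∫ x in y j..y j + k, pt t x with ha'
  have ca : ∀ j, Continuous (a j) := fun j => continuous_integral_slice cp _ _
  have ca' : ∀ j, Continuous (a' j) := fun j => continuous_integral_slice cpt _ _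
  have da : ∀ j t, 0 < t → HasDerivAt (a j) (a' j t) t := fun j t ht =>
    hasDerivAt_integral_of_evolution cp cpt (fun t x _ => hp.p_t t x) _ _ ht
  have cp2 : Continuous fun z : ℝ × ℝ => p z.1 z.2 ^ 2 := by fun_prop
  have cpx2 : Continuous fun z : ℝ × ℝ => px z.1 z.2 ^ 2 := by fun_prop
  have cpt2 : Continuous fun z : ℝ × ℝ => pt z.1 z.2 ^ 2 := by fun_prop
  rw [integral_stripBox_eq (F := fun t x => p t x ^ 2) cp2 hN.le,
    integral_stripBox_eq (F := fun t x => px t x ^ 2) cpx2 hN.le,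
    integral_stripBox_eq (F := fun t x => pt t x ^ 2) cpt2 hN.le]
  have s1 : ∀ t, ∫ x in -N..N, p t x ^ 2 ≤
      k ^ 2 * (∫ x in -N..N, px t x ^ 2) + 1 / k * ∑ j ∈ Finset.range m, a j t ^ 2 := fun t => by
    have := integral_sq_le_sum (continuous_slice cp t) (continuous_slice cpx t) (a := -N) k0
      (fun x _ => hp.p_x t x) m
    rwa [ek] at this
  have Cpx := continuous_integral_slice (f := fun t x => px t x ^ 2) cpx2 (-N) N
  have Cpt := continuous_integral_slice (f := fun t x => pt t x ^ 2) cpt2 (-N) N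
  have Cp := continuous_integral_slice (f := fun t x => p t x ^ 2) cp2 (-N) N
  have ia : ∀ j ∈ Finset.range m, IntervalIntegrable (fun t => a j t ^ 2) volume 0 N :=
    fun j _ => ((ca j).pow 2).intervalIntegrable _ _
  have csum : Continuous fun t => ∑ j ∈ Finset.range m, a j t ^ 2 :=
    continuous_finsetSum _ fun j _ => (ca j).pow 2
  have s2 : ∫ t in (0 : ℝ)..N, ∫ x in -N..N, p t x ^ 2 ≤
      k ^ 2 * (∫ t in (0 : ℝ)..N, ∫ x in -N..N, px t x ^ 2) +
        1 / k * ∑ j ∈ Finset.range m, ∫ t in (0 : ℝ)..N, a j t ^ 2 := by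
    have cc : Continuous fun t => k ^ 2 * (∫ x in -N..N, px t x ^ 2) +
        1 / k * ∑ j ∈ Finset.range m, a j t ^ 2 := (Cpx.const_mul (k ^ 2)).add (csum.const_mul (1 / k))
    refine (intervalIntegral.integral_mono hN.le (Cp.intervalIntegrable _ _)
      (cc.intervalIntegrable _ _) s1).trans (le_of_eq ?_)
    rw [intervalIntegral.integral_add ((Cpx.const_mul (k ^ 2)).intervalIntegrable _ _)
      ((csum.const_mul (1 / k)).intervalIntegrable _ _), intervalIntegral.integral_const_mul,
      intervalIntegral.integral_const_mul, intervalIntegral.integral_finsetSum ia]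
  have s3 : ∀ j, ∫ t in (0 : ℝ)..N, a j t ^ 2 ≤ l ^ 2 * (∫ t in (0 : ℝ)..N, a' j t ^ 2) +
      1 / l * ∑ i ∈ Finset.range m, cellIntegral N m p i j ^ 2 := fun j => by
    have := integral_sq_le_sum (ca j) (ca' j) (a := 0) l0 (da j) m
    rwa [el] at this
  have s4 : ∑ j ∈ Finset.range m, ∫ t in (0 : ℝ)..N, a' j t ^ 2 ≤
      k * ∫ t in (0 : ℝ)..N, ∫ x in -N..N, pt t x ^ 2 := by
    have ia' : ∀ j ∈ Finset.range m, IntervalIntegrable (fun t => a' j t ^ 2) volume 0 N :=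
      fun j _ => ((ca' j).pow 2).intervalIntegrable _ _
    rw [← intervalIntegral.integral_finsetSum ia', ← intervalIntegral.integral_const_mul]
    refine intervalIntegral.integral_mono hN.le
      ((continuous_finsetSum _ fun j _ => (ca' j).pow 2).intervalIntegrable _ _)
      ((Cpt.const_mul k).intervalIntegrable _ _) fun t => ?_
    have := integral_eq_sum_uniform (w := fun x => pt t x ^ 2)
      ((continuous_slice cpt t).pow 2) (-N) k m
    rw [ek] at this
    simp only
    rw [this, Finset.mul_sum]
    refine Finset.sum_le_sum fun j _ => ?_
    have := sq_integral_le (continuous_slice cpt t) (by linarith : y j ≤ y j + k)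
    rwa [add_sub_cancel_left] at this
  have s5 : ∑ j ∈ Finset.range m, ∫ t in (0 : ℝ)..N, a j t ^ 2 ≤
      l ^ 2 * (k * ∫ t in (0 : ℝ)..N, ∫ x in -N..N, pt t x ^ 2) + 1 / l *
        ∑ i ∈ Finset.range m, ∑ j ∈ Finset.range m, cellIntegral N m p i j ^ 2 := by
    refine (Finset.sum_le_sum fun j _ => s3 j).trans ?_
    rw [Finset.sum_add_distrib, ← Finset.mul_sum, ← Finset.mul_sum, Finset.sum_comm]
    gcongr
  have s6 := mul_le_mul_of_nonneg_left s5 (by positivity : 0 ≤ 1 / k)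
  have e1 : ∀ X : ℝ, 1 / k * (l ^ 2 * (k * X)) = l ^ 2 * X := fun X => by field_simp
  rw [mul_add, e1, ← mul_assoc (1 / k)] at s6
  linarith

/-- The `L²` norm of a test function is controlled by a small multiple of its `H¹` norm and
finitely many integrals. -/
theorem exists_cellIntegral_bound {N : ℝ} (hN : 0 < N) {η : ℝ} (hη : 0 < η) :
    ∃ m : ℕ, 0 < m ∧ ∃ K : ℝ, 0 ≤ K ∧ ∀ p pt px : ℝ → ℝ → ℝ, TestJet N p pt px →
      ∫ z in stripBox N, p z.1 z.2 ^ 2 ≤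
        η * (∫ z in stripBox N, (p z.1 z.2 ^ 2 + pt z.1 z.2 ^ 2 + px z.1 z.2 ^ 2)) +
          K * ∑ i ∈ Finset.range m, ∑ j ∈ Finset.range m, cellIntegral N m p i j ^ 2 := by
  -- Chosen so that both mesh widths, N/m and 2N/m, are at most √η.
  obtain ⟨m, hm⟩ := exists_nat_gt (2 * N / Real.sqrt η)
  have hs := Real.sqrt_pos.2 hη
  have hm' : (0 : ℝ) < m := lt_trans (by positivity) hm
  have hk : 2 * N / m ≤ Real.sqrt η := by
    rw [div_lt_iff₀ hs] at hm
    rw [div_le_iff₀ hm']; linarith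
  have hk2 : (2 * N / m) ^ 2 ≤ η := by
    rw [← Real.sq_sqrt hη.le]; gcongr
  have hl2 : (N / m) ^ 2 ≤ η := by
    refine le_trans ?_ hk2
    gcongr
    linarith
  refine ⟨m, Nat.cast_pos.1 hm', 1 / (2 * N / m) * (1 / (N / m)), by positivity,
    fun p pt px hp => ?_⟩
  have cp := hp.cont
  have cpt := hp.cont_t
  have cpx := hp.cont_x
  have I : ∀ {F : ℝ → ℝ → ℝ}, (Continuous fun z : ℝ × ℝ => F z.1 z.2) →
      IntegrableOn (fun z : ℝ × ℝ => F z.1 z.2) (stripBox N) := fun hF => integrableOn_stripBox hF N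
  have h1 := hp.integral_sq_le_sum_cellIntegral hN (Nat.cast_pos.1 hm')
  rw [integral_add (I (F := fun t x => p t x ^ 2 + pt t x ^ 2) (by fun_prop))
    (I (F := fun t x => px t x ^ 2) (by fun_prop)), integral_add (I (F := fun t x => p t x ^ 2)
    (by fun_prop)) (I (F := fun t x => pt t x ^ 2) (by fun_prop))]
  have a0 : 0 ≤ ∫ z in stripBox N, p z.1 z.2 ^ 2 := integral_nonneg fun _ => sq_nonneg _
  have a1 : 0 ≤ ∫ z in stripBox N, pt z.1 z.2 ^ 2 := integral_nonneg fun _ => sq_nonneg _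
  have a2 : 0 ≤ ∫ z in stripBox N, px z.1 z.2 ^ 2 := integral_nonneg fun _ => sq_nonneg _
  have b0 := mul_nonneg hη.le a0
  have b1 := mul_le_mul_of_nonneg_right hl2 a1
  have b2 := mul_le_mul_of_nonneg_right hk2 a2
  linarith

/-! ### Total boundedness of sets of functionals -/

theorem isCompact_image_comp {H V : Type*} [NormedAddCommGroup H] [NormedSpace ℝ H]
    [NormedAddCommGroup V] [NormedSpace ℝ V] [FiniteDimensional ℝ V] (P : H →L[ℝ] V) (B : ℝ) :
    IsCompact ((fun L : StrongDual ℝ V => L.comp P) '' {L | ‖L‖ ≤ B}) := by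
  have : ProperSpace (StrongDual ℝ V) := FiniteDimensional.proper ℝ (StrongDual ℝ V)
  have h1 : {L : StrongDual ℝ V | ‖L‖ ≤ B} = Metric.closedBall 0 B := by
    ext L; rw [mem_closedBall_zero_iff]; rfl
  rw [h1]
  exact (isCompact_closedBall _ _).image (by fun_prop)

/-- A bounded set of functionals on a Hilbert space that is uniformly small on the orthogonal
complements of finite-dimensional subspaces is totally bounded. -/
theorem totallyBounded_of_small_on_orthogonal {H : Type*} [NormedAddCommGroup H]
    [InnerProductSpace ℝ H] {𝒯 : Set (StrongDual ℝ H)} {B : ℝ} (hB : ∀ T ∈ 𝒯, ‖T‖ ≤ B)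
    (h : ∀ δ > 0, ∃ W : Submodule ℝ H, FiniteDimensional ℝ W ∧
      ∀ T ∈ 𝒯, ∀ v ∈ Wᗮ, |T v| ≤ δ * ‖v‖) : TotallyBounded 𝒯 := by
  rw [Metric.totallyBounded_iff]
  intro ε hε
  obtain ⟨W, hW, hT⟩ := h (ε / 3) (by positivity)
  set P : H →L[ℝ] W := W.orthogonalProjectionOnto
  set Φ : StrongDual ℝ W → StrongDual ℝ H := fun L => L.comp P with hΦ
  have hc : IsCompact (Φ '' {L | ‖L‖ ≤ B}) := isCompact_image_comp P B
  obtain ⟨t, ht, hcov⟩ := Metric.totallyBounded_iff.1 hc.totallyBounded (ε / 2) (by positivity)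
  refine ⟨t, ht, fun T hTm => ?_⟩
  have h3 : ‖T.comp W.subtypeL‖ ≤ B := by
    refine ContinuousLinearMap.opNorm_le_bound _ ((norm_nonneg T).trans (hB T hTm)) fun w => ?_
    exact (T.le_opNorm _).trans (mul_le_mul_of_nonneg_right (hB T hTm) (norm_nonneg _))
  have h1 : Φ (T.comp W.subtypeL) ∈ Φ '' {L | ‖L‖ ≤ B} := ⟨T.comp W.subtypeL, h3, rfl⟩
  obtain ⟨y, hy, hyb⟩ := mem_iUnion₂.1 (hcov h1)
  refine mem_iUnion₂.2 ⟨y, hy, ?_⟩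
  -- Restricting T to W and composing with the projection gives an element of a compact set. What is
  -- lost is T on the orthogonal complement, of norm at most ε/3; the net adds less than ε/2.
  have h2 : dist T (Φ (T.comp W.subtypeL)) ≤ ε / 3 := by
    rw [dist_eq_norm]
    refine ContinuousLinearMap.opNorm_le_bound _ (by positivity) fun v => ?_
    have e1 : (T - Φ (T.comp W.subtypeL)) v = T (v - W.starProjection v) := by
      rw [map_sub]; rfl
    have hv : v - W.starProjection v ∈ Wᗮ := W.sub_starProjection_mem_orthogonal v
    have hn : ‖v - W.starProjection v‖ ≤ ‖v‖ := by
      have e2 := W.norm_sq_eq_add_norm_sq_starProjection v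
      have e3 : Wᗮ.starProjection v = v - W.starProjection v := by
        rw [Submodule.starProjection_orthogonal_val]
      rw [e3] at e2
      refine abs_le_of_sq_le_sq' ?_ (norm_nonneg _) |>.2
      nlinarith [sq_nonneg ‖W.starProjection v‖]
    rw [e1, Real.norm_eq_abs]
    exact (hT T hTm _ hv).trans (mul_le_mul_of_nonneg_left hn (by positivity))
  calc dist T y ≤ dist T (Φ (T.comp W.subtypeL)) + dist (Φ (T.comp W.subtypeL)) y :=
        dist_triangle _ _ _
    _ < ε := by
      have := Metric.mem_ball.1 hyb
      linarith

/-! ### Test functions in H¹₀ and functionals in H⁻¹ of a rectangle -/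

section

variable {Q : TopologicalSpace.Opens (ℝ × ℝ)}

theorem TestFunction.differentiableAt (φ : TestFunction Q ℝ ⊤) (z : ℝ × ℝ) :
    DifferentiableAt ℝ φ z := (φ.contDiff.differentiable (by simp)) z

theorem jet_add (φ χ : TestFunction Q ℝ ⊤) : jet (φ + χ : TestFunction Q ℝ ⊤) = jet φ + jet χ := by
  funext z
  have e1 : (⇑(φ + χ) : ℝ × ℝ → ℝ) = ⇑φ + ⇑χ := by funext z; simp
  have e2 := fderiv_add (φ.differentiableAt z) (χ.differentiableAt z)
  ext i
  fin_cases i <;> simp [jet, dt, dx, e1, e2]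

theorem jet_smul (c : ℝ) (φ : TestFunction Q ℝ ⊤) :
    jet (c • φ : TestFunction Q ℝ ⊤) = c • jet φ := by
  funext z
  have e1 : (⇑(c • φ) : ℝ × ℝ → ℝ) = c • ⇑φ := by funext z; simp
  have e2 := fderiv_const_smul (φ.differentiableAt z) c
  ext i
  fin_cases i <;> simp [jet, dt, dx, e1, e2]

theorem toLp_jet_add (φ χ : TestFunction Q ℝ ⊤) :
    (memLp_jet (φ + χ)).toLp (jet (φ + χ : TestFunction Q ℝ ⊤)) =
      (memLp_jet φ).toLp (jet φ) + (memLp_jet χ).toLp (jet χ) := by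
  rw [← MemLp.toLp_add (memLp_jet φ) (memLp_jet χ)]
  exact MemLp.toLp_congr _ _ (Eventually.of_forall fun z => congrFun (jet_add φ χ) z)

theorem toLp_jet_smul (c : ℝ) (φ : TestFunction Q ℝ ⊤) :
    (memLp_jet (c • φ)).toLp (jet (c • φ : TestFunction Q ℝ ⊤)) =
      c • (memLp_jet φ).toLp (jet φ) := by
  rw [← MemLp.toLp_const_smul c (memLp_jet φ)]
  exact MemLp.toLp_congr _ _ (Eventually.of_forall fun z => congrFun (jet_smul c φ) z)

variable (Q) in
/-- The map `φ ↦ (φ, φ_t, φ_x)` into `L²`. -/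
noncomputable def jetLinearMap : TestFunction Q ℝ ⊤ →ₗ[ℝ]
    Lp (EuclideanSpace ℝ (Fin 3)) 2 (volume.restrict (Q : Set (ℝ × ℝ))) where
  toFun φ := (memLp_jet φ).toLp (jet φ)
  map_add' := toLp_jet_add
  map_smul' := toLp_jet_smul

/-- Since φ ↦ (φ, φ_t, φ_x) is linear, its range is already a subspace. Hence the test functions
themselves are dense in H¹₀, not only their linear combinations. -/
theorem H1Zero_eq : H1Zero Q = (LinearMap.range (jetLinearMap Q)).topologicalClosure := by
  unfold H1Zero
  congr 1
  have : (range fun φ : TestFunction Q ℝ ⊤ => (memLp_jet φ).toLp (jet φ)) =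
      ((LinearMap.range (jetLinearMap Q) : Submodule ℝ _) : Set _) := by
    ext y; exact Iff.rfl
  rw [this, Submodule.span_eq]

theorem dense_range_toH1Zero : Dense (range (toH1Zero (Q := Q))) := by
  rw [Subtype.dense_iff]
  intro w hw
  have hw' : w ∈ (LinearMap.range (jetLinearMap Q)).topologicalClosure := H1Zero_eq (Q := Q) ▸ hw
  have hw2 : w ∈ closure ((LinearMap.range (jetLinearMap Q) : Submodule ℝ _) : Set _) := hw'
  refine closure_mono ?_ hw2
  rintro _ ⟨φ, rfl⟩
  exact ⟨toH1Zero φ, ⟨φ, rfl⟩, rfl⟩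

/-- A closed condition that holds for test functions holds on `H¹₀`. -/
theorem H1Zero.induction {p : H1Zero Q → Prop} (hc : IsClosed {v | p v})
    (h : ∀ φ : TestFunction Q ℝ ⊤, p (toH1Zero φ)) (v : H1Zero Q) : p v := by
  have := hc.closure_subset_iff.2 (range_subset_iff.2 h)
  rw [dense_range_toH1Zero.closure_eq] at this
  exact this (mem_univ v)

theorem coeFn_toH1Zero (φ : TestFunction Q ℝ ⊤) :
    ((toH1Zero φ : H1Zero Q) : Lp (EuclideanSpace ℝ (Fin 3)) 2 (volume.restrict (Q : Set (ℝ × ℝ))))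
      =ᵐ[volume.restrict (Q : Set (ℝ × ℝ))] jet φ :=
  (memLp_jet φ).coeFn_toLp

theorem inner_toLp_toH1Zero {F : ℝ × ℝ → EuclideanSpace ℝ (Fin 3)}
    (hF : MemLp F 2 (volume.restrict (Q : Set (ℝ × ℝ)))) (φ : TestFunction Q ℝ ⊤) :
    inner ℝ (hF.toLp F) ((toH1Zero φ : H1Zero Q) :
      Lp (EuclideanSpace ℝ (Fin 3)) 2 (volume.restrict (Q : Set (ℝ × ℝ)))) =
      ∫ z in (Q : Set (ℝ × ℝ)), inner ℝ (F z) (jet φ z) := by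
  rw [L2.inner_def]
  refine integral_congr_ae ?_
  filter_upwards [hF.coeFn_toLp, coeFn_toH1Zero φ] with z h1 h2
  rw [h1, h2]

theorem norm_sq_toH1Zero (φ : TestFunction Q ℝ ⊤) :
    ‖toH1Zero φ‖ ^ 2 = ∫ z in (Q : Set (ℝ × ℝ)), (φ z ^ 2 + dt φ z ^ 2 + dx φ z ^ 2) := by
  have h1 : ‖toH1Zero φ‖ = ‖(memLp_jet φ).toLp (jet φ)‖ := rfl
  rw [h1, ← real_inner_self_eq_norm_sq]
  refine (inner_toLp_toH1Zero (memLp_jet φ) φ).trans ?_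
  congr 1; funext z
  rw [real_inner_self_eq_norm_sq, EuclideanSpace.norm_sq_eq, Fin.sum_univ_three]
  simp [jet]

theorem TestFunction.eq_zero_of_notMem (φ : TestFunction Q ℝ ⊤) {z : ℝ × ℝ}
    (hz : z ∉ (Q : Set (ℝ × ℝ))) : φ z = 0 ∧ fderiv ℝ φ z = 0 := by
  have h0 : z ∉ tsupport φ := fun h => hz (φ.tsupport_subset h)
  refine ⟨image_eq_zero_of_notMem_tsupport h0, ?_⟩
  by_contra hne
  exact h0 (support_fderiv_subset ℝ (f := φ) hne)

end

theorem halfPlaneBox_ae_eq (n : ℕ) : (halfPlaneBox n : Set (ℝ × ℝ)) =ᵐ[volume] stripBox n := by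
  rw [Measure.volume_eq_prod]
  exact Measure.set_prod_ae_eq Ioo_ae_eq_Icc Ioo_ae_eq_Icc

theorem testJet_of_testFunction {n : ℕ} (φ : TestFunction (halfPlaneBox n) ℝ ⊤) :
    TestJet n (fun t x => φ (t, x)) (fun t x => dt φ (t, x)) (fun t x => dx φ (t, x)) := by
  have hd : Continuous (fderiv ℝ φ) := φ.contDiff.continuous_fderiv (by simp)
  have h1 : Continuous (dt φ) := hd.clm_apply continuous_const
  have h2 : Continuous (dx φ) := hd.clm_apply continuous_const
  refine ⟨φ.continuous, h1, h2, fun t x => ?_, fun t x => ?_, fun t x hne => ?_⟩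
  · exact (φ.differentiableAt (t, x)).hasFDerivAt.comp_hasDerivAt t
      ((hasDerivAt_id t).prodMk (hasDerivAt_const t x))
  · exact (φ.differentiableAt (t, x)).hasFDerivAt.comp_hasDerivAt x
      ((hasDerivAt_const x t).prodMk (hasDerivAt_id x))
  · by_contra hcon
    exact hne (φ.eq_zero_of_notMem (z := (t, x)) fun hz => hcon hz).1

instance (Q : TopologicalSpace.Opens (ℝ × ℝ)) : CompleteSpace (H1Zero Q) :=
  (Submodule.isClosed_topologicalClosure _).completeSpace_coe

theorem memLp_divergence {f g : ℝ → ℝ → ℝ} (hf : Continuous fun z : ℝ × ℝ => f z.1 z.2)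
    (hg : Continuous fun z : ℝ × ℝ => g z.1 z.2) (n : ℕ) :
    MemLp (fun z : ℝ × ℝ => (!₂[0, -f z.1 z.2, -g z.1 z.2] : EuclideanSpace ℝ (Fin 3))) 2
      (volume.restrict (halfPlaneBox n : Set (ℝ × ℝ))) := by
  have hc : Continuous fun z : ℝ × ℝ =>
      (!₂[0, -f z.1 z.2, -g z.1 z.2] : EuclideanSpace ℝ (Fin 3)) := by
    refine (PiLp.continuous_toLp 2 (fun _ : Fin 3 => ℝ)).comp (continuous_pi fun i => ?_)
    fin_cases i
    · exact continuous_const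
    · exact hf.neg
    · exact hg.neg
  rw [memLp_two_iff_integrable_sq_norm hc.aestronglyMeasurable]
  have h2 : IntegrableOn (fun z : ℝ × ℝ =>
      ‖(!₂[0, -f z.1 z.2, -g z.1 z.2] : EuclideanSpace ℝ (Fin 3))‖ ^ 2) (stripBox n) :=
    (hc.norm.pow 2).continuousOn.integrableOn_compact (isCompact_Icc.prod isCompact_Icc)
  exact h2.mono_set (prod_mono Ioo_subset_Icc_self Ioo_subset_Icc_self)

/-- The distribution `f_t + g_x` as an element of `H⁻¹` of a rectangle. -/
noncomputable def divergenceDual {f g : ℝ → ℝ → ℝ} (hf : Continuous fun z : ℝ × ℝ => f z.1 z.2)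
    (hg : Continuous fun z : ℝ × ℝ => g z.1 z.2) (n : ℕ) : HNegOne (halfPlaneBox n) :=
  (innerSL ℝ ((memLp_divergence hf hg n).toLp _)).comp (H1Zero (halfPlaneBox n)).subtypeL

theorem divergenceDual_apply {f g : ℝ → ℝ → ℝ} (hf : Continuous fun z : ℝ × ℝ => f z.1 z.2)
    (hg : Continuous fun z : ℝ × ℝ => g z.1 z.2) (n : ℕ) (φ : TestFunction (halfPlaneBox n) ℝ ⊤) :
    divergenceDual hf hg n (toH1Zero φ) =
      -∫ z in (halfPlaneBox n : Set (ℝ × ℝ)), (f z.1 z.2 * dt φ z + g z.1 z.2 * dx φ z) := by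
  refine (inner_toLp_toH1Zero (memLp_divergence hf hg n) φ).trans ?_
  rw [← integral_neg]
  congr 1; funext z
  rw [PiLp.inner_apply, Fin.sum_univ_three]
  simp [jet]
  ring

theorem divergenceDual_eq_stripBox {f g : ℝ → ℝ → ℝ} (hf : Continuous fun z : ℝ × ℝ => f z.1 z.2)
    (hg : Continuous fun z : ℝ × ℝ => g z.1 z.2) (n : ℕ) (φ : TestFunction (halfPlaneBox n) ℝ ⊤) :
    divergenceDual hf hg n (toH1Zero φ) =
      -∫ z in stripBox n, (f z.1 z.2 * dt φ z + g z.1 z.2 * dx φ z) := by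
  rw [divergenceDual_apply, setIntegral_congr_set (halfPlaneBox_ae_eq n)]

/-- Test functions vanish with their derivatives off their rectangle, so both pairings equal the
same integral over the plane. -/
theorem divergenceDual_compatible {f g : ℝ → ℝ → ℝ} (hf : Continuous fun z : ℝ × ℝ => f z.1 z.2)
    (hg : Continuous fun z : ℝ × ℝ => g z.1 z.2) (m n : ℕ)
    (φ : TestFunction (halfPlaneBox m) ℝ ⊤) (χ : TestFunction (halfPlaneBox n) ℝ ⊤)
    (h : ∀ z, φ z = χ z) :
    divergenceDual hf hg m (toH1Zero φ) = divergenceDual hf hg n (toH1Zero χ) := by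
  have e : ∀ (k : ℕ) (ζ : TestFunction (halfPlaneBox k) ℝ ⊤),
      ∫ z in (halfPlaneBox k : Set (ℝ × ℝ)), (f z.1 z.2 * dt ζ z + g z.1 z.2 * dx ζ z) =
        ∫ z, (f z.1 z.2 * dt ζ z + g z.1 z.2 * dx ζ z) := fun k ζ => by
    refine setIntegral_eq_integral_of_forall_compl_eq_zero fun z hz => ?_
    simp [dt, dx, (ζ.eq_zero_of_notMem hz).2]
  have hφ : (⇑φ : ℝ × ℝ → ℝ) = ⇑χ := funext h
  rw [divergenceDual_apply, divergenceDual_apply, e, e, hφ]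

/-- The cell `(i, j)` of the subdivision of `[0, N] × [-N, N]` into `m²` cells. -/
def cell (N : ℝ) (m i j : ℕ) : Set (ℝ × ℝ) :=
  Ioc (0 + i * (N / m)) (0 + i * (N / m) + N / m) ×ˢ
    Ioc (-N + j * (2 * N / m)) (-N + j * (2 * N / m) + 2 * N / m)

theorem measurableSet_cell (N : ℝ) (m i j : ℕ) : MeasurableSet (cell N m i j) :=
  measurableSet_Ioc.prod measurableSet_Ioc

theorem volume_restrict_cell_ne_top (N : ℝ) (m i j : ℕ) (s : Set (ℝ × ℝ)) :
    (volume.restrict s) (cell N m i j) ≠ ⊤ := by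
  refine ((Measure.restrict_apply_le _ _).trans_lt ?_).ne
  exact ((Bornology.IsBounded.prod (Metric.isBounded_Ioc _ _)
    (Metric.isBounded_Ioc _ _)).measure_lt_top)

/-- The integral over a cell as a functional on `H¹₀`. -/
noncomputable def cellDual (n m i j : ℕ) : HNegOne (halfPlaneBox n) :=
  (innerSL ℝ (indicatorConstLp 2 (measurableSet_cell n m i j)
    (volume_restrict_cell_ne_top n m i j (halfPlaneBox n : Set (ℝ × ℝ)))
    (!₂[1, 0, 0] : EuclideanSpace ℝ (Fin 3)))).comp (H1Zero (halfPlaneBox n)).subtypeL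

theorem cellDual_apply {n m : ℕ} (i j : ℕ) (φ : TestFunction (halfPlaneBox n) ℝ ⊤) :
    cellDual n m i j (toH1Zero φ) = cellIntegral n m (fun t x => φ (t, x)) i j := by
  have e1 : cellDual n m i j (toH1Zero φ) =
      ∫ z in cell n m i j, φ z ∂(volume.restrict (halfPlaneBox n : Set (ℝ × ℝ))) := by
    refine (L2.inner_indicatorConstLp_eq_setIntegral_inner ℝ _ (measurableSet_cell n m i j) _
      (volume_restrict_cell_ne_top n m i j (halfPlaneBox n : Set (ℝ × ℝ)))).trans ?_
    refine integral_congr_ae (ae_restrict_of_ae ?_)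
    filter_upwards [coeFn_toH1Zero φ] with z hz
    refine (congrArg _ hz).trans ?_
    rw [PiLp.inner_apply, Fin.sum_univ_three]
    simp [jet]
  have e2 : ∫ z in cell n m i j, φ z ∂(volume.restrict (halfPlaneBox n : Set (ℝ × ℝ))) =
      ∫ z in cell n m i j, φ z := by
    rw [Measure.restrict_restrict (measurableSet_cell n m i j)]
    refine (setIntegral_eq_of_subset_of_forall_sdiff_eq_zero (measurableSet_cell n m i j)
      inter_subset_left fun z hz => ?_).symm
    exact (φ.eq_zero_of_notMem fun h => hz.2 ⟨hz.1, h⟩).1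
  rw [e1, e2, cellIntegral, cell]
  have hn : (0 : ℝ) ≤ n := Nat.cast_nonneg n
  have hm : (0 : ℝ) ≤ m := Nat.cast_nonneg m
  rw [intervalIntegral.integral_of_le (by
    have : 0 ≤ (n : ℝ) / m := by positivity
    linarith), Measure.volume_eq_prod, setIntegral_prod]
  · refine integral_congr_ae (Eventually.of_forall fun t => ?_)
    simp only
    rw [intervalIntegral.integral_of_le (by
      have : 0 ≤ 2 * (n : ℝ) / m := by positivity
      linarith)]
  · rw [← Measure.volume_eq_prod]
    exact (φ.continuous.integrable_of_hasCompactSupport φ.hasCompactSupport).integrableOn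

/-- The criterion for total boundedness in `H⁻¹` of a rectangle. -/
theorem totallyBounded_range_divergenceDual {ι : Type*} {f g : ι → ℝ → ℝ → ℝ}
    (hf : ∀ i, Continuous fun z : ℝ × ℝ => f i z.1 z.2)
    (hg : ∀ i, Continuous fun z : ℝ × ℝ => g i z.1 z.2) {n : ℕ} (hn : 0 < n)
    (h : ∀ δ > 0, ∃ K : ℝ, 0 ≤ K ∧ ∀ i, ∀ p pt px : ℝ → ℝ → ℝ, TestJet n p pt px →
      ∫ z in stripBox n, (p z.1 z.2 ^ 2 + pt z.1 z.2 ^ 2 + px z.1 z.2 ^ 2) ≤ 1 →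
      |∫ z in stripBox n, (f i z.1 z.2 * pt z.1 z.2 + g i z.1 z.2 * px z.1 z.2)| ≤
        δ + K * ∫ z in stripBox n, p z.1 z.2 ^ 2) :
    TotallyBounded (range fun i => divergenceDual (hf i) (hg i) n) := by
  have hn' : (0 : ℝ) < n := Nat.cast_pos.2 hn
  -- The estimate is put in quadratic form by a factor ‖v‖. In this form it is invariant under
  -- scaling, so it needs to be checked only for unit norm, and it is a closed condition, so it
  -- passes from test functions to all of H¹₀.
  have key : ∀ δ > 0, ∃ m : ℕ, ∃ K : ℝ, 0 ≤ K ∧ ∀ i (v : H1Zero (halfPlaneBox n)),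
      ‖v‖ * |divergenceDual (hf i) (hg i) n v| ≤ δ * ‖v‖ ^ 2 +
        K * ∑ a ∈ Finset.range m, ∑ b ∈ Finset.range m, cellDual n m a b v ^ 2 := by
    intro δ hδ
    obtain ⟨K, hK, hT⟩ := h (δ / 2) (by positivity)
    -- With this mesh parameter the H¹ part of the squared L² norm, multiplied by K, is at most δ/2.
    obtain ⟨m, hm, K', hK', hR⟩ := exists_cellIntegral_bound hn'
      (η := δ / 2 / (K + 1)) (by positivity)
    refine ⟨m, K * K', by positivity, fun i => ?_⟩
    have unit : ∀ φ : TestFunction (halfPlaneBox n) ℝ ⊤, ‖toH1Zero φ‖ ≤ 1 →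
        |divergenceDual (hf i) (hg i) n (toH1Zero φ)| ≤ δ + K * K' *
          ∑ a ∈ Finset.range m, ∑ b ∈ Finset.range m, cellDual n m a b (toH1Zero φ) ^ 2 := by
      intro φ hφ
      have hj := testJet_of_testFunction φ
      have hnorm : ∫ z in stripBox n, (φ z ^ 2 + dt φ z ^ 2 + dx φ z ^ 2) ≤ 1 := by
        rw [← setIntegral_congr_set (halfPlaneBox_ae_eq n), ← norm_sq_toH1Zero]
        exact pow_le_one₀ (norm_nonneg _) hφ
      have h1 := hT i _ _ _ hj hnorm
      have h2 := hR _ _ _ hj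
      simp only [Prod.mk.eta] at h1 h2
      rw [divergenceDual_eq_stripBox, abs_neg]
      simp only [cellDual_apply]
      refine h1.trans ?_
      have h3 := mul_le_mul_of_nonneg_left (h2.trans (add_le_add_left
        (mul_le_mul_of_nonneg_left hnorm (by positivity : 0 ≤ δ / 2 / (K + 1))) _)) hK
      have h4 : K * (δ / 2 / (K + 1) * 1) ≤ δ / 2 := by
        rw [mul_one, ← mul_div_assoc, div_le_iff₀ (by positivity)]; nlinarith
      rw [mul_add] at h3
      linarith
    refine H1Zero.induction (isClosed_le (by fun_prop) (by fun_prop)) fun φ => ?_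
    rcases eq_or_ne ‖toH1Zero φ‖ 0 with h0 | h0
    · rw [h0, zero_mul]; positivity
    · have hpos : 0 < ‖toH1Zero φ‖ := lt_of_le_of_ne (norm_nonneg _) (Ne.symm h0)
      set c := ‖toH1Zero φ‖⁻¹ with hc
      have hs : toH1Zero (c • φ) = c • toH1Zero φ := Subtype.ext (toLp_jet_smul c φ)
      have hu := unit (c • φ) (by
        rw [hs, norm_smul, hc, norm_inv, norm_norm, inv_mul_cancel₀ h0])
      simp only [hs, map_smul, smul_eq_mul, mul_pow, ← Finset.mul_sum] at hu
      rw [abs_mul, abs_of_pos (inv_pos.2 hpos)] at hu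
      have h1 := mul_le_mul_of_nonneg_left hu (sq_nonneg ‖toH1Zero φ‖)
      set S := ∑ a ∈ Finset.range m, ∑ b ∈ Finset.range m, cellDual n m a b (toH1Zero φ) ^ 2
      set X := |divergenceDual (hf i) (hg i) n (toH1Zero φ)|
      have e1 : ‖toH1Zero φ‖ ^ 2 * (c * X) = ‖toH1Zero φ‖ * X := by rw [hc]; field_simp
      have e2 : ‖toH1Zero φ‖ ^ 2 * (δ + K * K' * (c ^ 2 * S)) =
          δ * ‖toH1Zero φ‖ ^ 2 + K * K' * S := by rw [hc]; field_simp
      rwa [e1, e2] at h1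
  obtain ⟨m, K, hK, hb⟩ := key 1 one_pos
  refine totallyBounded_of_small_on_orthogonal
    (B := 1 + K * ∑ a ∈ Finset.range m, ∑ b ∈ Finset.range m, ‖cellDual n m a b‖ ^ 2) ?_ ?_
  · rintro _ ⟨i, rfl⟩
    refine ContinuousLinearMap.opNorm_le_bound _ (by positivity) fun v => ?_
    rcases eq_or_ne ‖v‖ 0 with h0 | h0
    · rw [norm_eq_zero.1 h0]; simp
    · have hpos : 0 < ‖v‖ := lt_of_le_of_ne (norm_nonneg _) (Ne.symm h0)
      refine le_of_mul_le_mul_left ?_ hpos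
      refine (hb i v).trans ?_
      have h1 : ∑ a ∈ Finset.range m, ∑ b ∈ Finset.range m, cellDual n m a b v ^ 2 ≤
          ∑ a ∈ Finset.range m, ∑ b ∈ Finset.range m, ‖cellDual n m a b‖ ^ 2 * ‖v‖ ^ 2 := by
        refine Finset.sum_le_sum fun a _ => Finset.sum_le_sum fun b _ => ?_
        rw [← mul_pow, ← sq_abs (cellDual n m a b v), ← Real.norm_eq_abs]
        exact pow_le_pow_left₀ (norm_nonneg _) ((cellDual n m a b).le_opNorm v) 2
      simp only [← Finset.sum_mul] at h1
      have h2 := mul_le_mul_of_nonneg_left h1 hK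
      linarith
  · intro δ hδ
    obtain ⟨m, K, hK, hb⟩ := key δ hδ
    -- The subspace is spanned by the Riesz representatives of the cell functionals: on its
    -- orthogonal complement all cell integrals vanish and only δ‖v‖² is left.
    refine ⟨Submodule.span ℝ (range fun a : Fin m × Fin m =>
      (InnerProductSpace.toDual ℝ (H1Zero (halfPlaneBox n))).symm (cellDual n m a.1 a.2)),
      FiniteDimensional.span_of_finite ℝ (finite_range _), ?_⟩
    rintro _ ⟨i, rfl⟩ v hv
    have hz : ∀ a ∈ Finset.range m, ∀ b ∈ Finset.range m, cellDual n m a b v = 0 := by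
      intro a ha b hb
      have h1 := (Submodule.mem_orthogonal _ _).1 hv _ (Submodule.subset_span
        ⟨(⟨a, Finset.mem_range.1 ha⟩, ⟨b, Finset.mem_range.1 hb⟩), rfl⟩)
      rwa [InnerProductSpace.toDual_symm_apply] at h1
    have h1 := hb i v
    have h2 : ∑ a ∈ Finset.range m, ∑ b ∈ Finset.range m, cellDual n m a b v ^ 2 = 0 :=
      Finset.sum_eq_zero fun a ha => Finset.sum_eq_zero fun b hb => by rw [hz a ha b hb]; norm_num
    rw [h2, mul_zero, add_zero] at h1
    rcases eq_or_ne ‖v‖ 0 with h0 | h0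
    · rw [norm_eq_zero.1 h0]; simp
    · have hpos : 0 < ‖v‖ := lt_of_le_of_ne (norm_nonneg _) (Ne.symm h0)
      refine le_of_mul_le_mul_left ?_ hpos
      linarith

/-! ### Compactness in H⁻¹_loc of the half-plane -/

/-- The rectangle with n = 0 is empty and must be treated apart, because the grid argument requires
n > 0. -/
theorem subsingleton_HNegOne_zero : Subsingleton (HNegOne (halfPlaneBox 0)) := by
  refine ⟨fun S T => ContinuousLinearMap.ext fun v => ?_⟩
  have : v = 0 := by
    refine Subtype.ext (Lp.ext ?_)
    have h0 : (halfPlaneBox 0 : Set (ℝ × ℝ)) = ∅ := by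
      ext z; simp [halfPlaneBox]
    have h1 : ae (volume.restrict (halfPlaneBox 0 : Set (ℝ × ℝ))) = ⊥ := by
      rw [h0, Measure.restrict_empty, ae_zero]
    exact h1.le mem_bot
  rw [this, map_zero, map_zero]

theorem isClosed_compatible : IsClosed {T : (n : ℕ) → HNegOne (halfPlaneBox n) |
    ∀ (m n : ℕ) (φ : TestFunction (halfPlaneBox m) ℝ ⊤) (χ : TestFunction (halfPlaneBox n) ℝ ⊤),
      (∀ z, φ z = χ z) → T m (toH1Zero φ) = T n (toH1Zero χ)} := by
  simp only [ofPred_forall]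
  refine isClosed_iInter fun m => isClosed_iInter fun n => isClosed_iInter fun φ =>
    isClosed_iInter fun χ => isClosed_iInter fun _ => isClosed_eq ?_ ?_
  · exact (continuous_apply m).clm_apply continuous_const
  · exact (continuous_apply n).clm_apply continuous_const

/-- Tychonoff's theorem in the product over all rectangles; the compatible families form a closed
subset. -/
theorem isCompact_HNegOneLoc {k : (n : ℕ) → Set (HNegOne (halfPlaneBox n))}
    (hk : ∀ n, IsCompact (k n)) : IsCompact {T : HNegOneLoc | ∀ n, T.1 n ∈ k n} := by
  have h1 := (isClosed_compatible.isClosedEmbedding_subtypeVal).isCompact_preimage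
    (isCompact_univ_pi hk)
  have e : {T : HNegOneLoc | ∀ n, T.1 n ∈ k n} = Subtype.val ⁻¹' univ.pi k := by
    refine Set.ext fun T => ?_
    simp [Set.mem_pi]
  rw [e]
  exact h1

theorem proposition4p1 (γ : ℝ) (hγ : 1 < γ)
    (ψ : ℝ → ℝ) (hψ : ContDiff ℝ 2 ψ) (hψc : HasCompactSupport ψ)
    (ε₀ : ℝ) (hε₀ : 0 < ε₀)
    (ρl ρr ul ur : ℝ) (hρl : 0 < ρl) (hρr : 0 < ρr)
    (ρbar ubar : ℝ → ℝ) (hbar : IsReferenceProfile ρl ρr ul ur ρbar ubar)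
    (E₀ E₁ M₀ : ℝ)
    (ρ₀ u₀ : ℝ → ℝ → ℝ)
    (hdata : ∀ ε ∈ Set.Ioc 0 ε₀, HasDataBounds γ ε ρbar ubar E₀ E₁ M₀ (ρ₀ ε) (u₀ ε))
    (ρ u : ℝ → ℝ → ℝ → ℝ)
    (hsol : ∀ ε ∈ Set.Ioc 0 ε₀,
      IsNavierStokesSolution γ ε ρl ρr ul ur (ρ₀ ε) (u₀ ε) (ρ ε) (u ε)) :
    ∃ K : Set HNegOneLoc, IsCompact K ∧ ∀ ε ∈ Set.Ioc 0 ε₀, ∃ T ∈ K,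
      IsDistribDivergence T
        (fun z => weakEntropy γ ψ (ρ ε z.1 z.2) (ρ ε z.1 z.2 * u ε z.1 z.2))
        (fun z => weakEntropyFlux γ ψ (ρ ε z.1 z.2) (ρ ε z.1 z.2 * u ε z.1 z.2)) := by
  obtain ⟨A, hA, hflow⟩ := exists_entropyFlow hγ hψ hψc
  -- The flow frozen for t < 0 agrees with the solution for t > 0, and the open rectangles see no
  -- other times.
  have hex : ∀ i : Set.Ioc (0 : ℝ) ε₀, ∃ f g rx rxx ux uxx e ex fx gx : ℝ → ℝ → ℝ,
      ViscousFlow γ i.1 ρl ρr ul ur (fun t x => ρ i.1 (max t 0) x)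
        (fun t x => u i.1 (max t 0) x) rx rxx ux uxx ∧
      EntropyFlow γ i.1 A (fun t x => ρ i.1 (max t 0) x) rx ux uxx f g e ex fx gx ∧
      (∀ t x, 0 < t → weakEntropy γ ψ (ρ i.1 t x) (ρ i.1 t x * u i.1 t x) = f t x) ∧
      ∀ t x, 0 < t → weakEntropyFlux γ ψ (ρ i.1 t x) (ρ i.1 t x * u i.1 t x) = g t x := by
    intro i
    obtain ⟨rx, rxx, ux, uxx, hv⟩ := (hsol i.1 i.2).exists_viscousFlow
    obtain ⟨f, g, e, ex, fx, gx, he, hf, hg⟩ := hflow hv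
    refine ⟨f, g, rx, rxx, ux, uxx, e, ex, fx, gx, hv, he, fun t x ht => ?_, fun t x ht => ?_⟩
    · have := hf t x
      rwa [max_eq_left ht.le] at this
    · have := hg t x
      rwa [max_eq_left ht.le] at this
  choose f g rx rxx ux uxx e ex fx gx hv he hf hg using hex
  have hcf := fun i => (he i).cont_f
  have hcg := fun i => (he i).cont_g
  have htb : ∀ n : ℕ, TotallyBounded (range fun i => divergenceDual (hcf i) (hcg i) n) := by
    intro n
    rcases Nat.eq_zero_or_pos n with rfl | hn
    · have := subsingleton_HNegOne_zero
      exact (Set.subsingleton_of_subsingleton.finite).totallyBounded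
    · refine totallyBounded_range_divergenceDual hcf hcg hn fun δ hδ => ?_
      obtain ⟨K, hK, h⟩ := exists_dissipation_le hγ (ε₀ := ε₀) hA hρl hρr hbar E₀ E₁ M₀
        (Nat.cast_pos.2 hn) hδ
      refine ⟨K, hK, fun i => h i.1 i.2 (ρ₀ i.1) (u₀ i.1) _ _ _ _ _ _ _ _ _ _ _ _
        (hdata i.1 i.2) (fun x => ?_) (fun x => ?_) (hv i) (he i)⟩
      · rw [max_self]; exact (hsol i.1 i.2).init_rho x
      · rw [max_self]; exact (hsol i.1 i.2).init_u x
  -- Closures of totally bounded sets in the complete spaces H⁻¹ are compact, and every dissipation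
  -- measure lies in them on each rectangle.
  refine ⟨{T | ∀ n, T.1 n ∈ closure (range fun i => divergenceDual (hcf i) (hcg i) n)},
    isCompact_HNegOneLoc fun n => (htb n).closure.isCompact_of_isClosed isClosed_closure,
    fun ε hε => ⟨⟨fun n => divergenceDual (hcf ⟨ε, hε⟩) (hcg ⟨ε, hε⟩) n,
      fun m n φ χ h => divergenceDual_compatible _ _ m n φ χ h⟩,
      fun n => subset_closure ⟨⟨ε, hε⟩, rfl⟩, fun n φ => ?_⟩⟩
  refine (divergenceDual_apply (hcf ⟨ε, hε⟩) (hcg ⟨ε, hε⟩) n φ).trans ?_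
  congr 1
  refine setIntegral_congr_fun (halfPlaneBox n).isOpen.measurableSet fun z hz => ?_
  have ht : 0 < z.1 := hz.1.1
  simp only
  rw [hf ⟨ε, hε⟩ z.1 z.2 ht, hg ⟨ε, hε⟩ z.1 z.2 ht]
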